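/- Let $\mathbb K$ be a field. A finitely generated binary quadratic symmetric operad $\mathcal P(E,R)$ is presented by a finite dimensional representation $E$ of $S_2$ (the generating operations) and an $S_3$-submodule $R$ of the arity three part $\mathcal T(E)(3)=\bigoplus_{i\in\mathbb Z/3}E\otimes E$ of the free operad on $E$, where $a\otimes b$ in the $i$-th summand, written $a\circ_i b$, is the operation $(x_0,x_1,x_2)\mapsto a(b(x_i,x_{i+1}),x_{i+2})$. The Manin black product is $\mathcal P(E,R)\bullet\mathcal P(F,S)=\mathcal P(E\otimes F\otimes\mathrm{sgn},\Psi(R\otimes S))$, where $\Psi((a\circ_i b)\otimes(a'\circ_j b'))=(a\otimes a')\circ_i(b\otimes b')$ if $i=j$ and $0$ otherwise. The product $\mathcal O\times\mathcal P$ has as algebras the vector spaces with both an $\mathcal O$-algebra and a $\mathcal P$-algebra structure such that every triple product involving an operation of $\mathcal O$ and one of $\mathcal P$ vanishes. Let $\mathcal Ass$, $\mathcal Com$ be the operads of associative and of commutative associative algebras, and let $pre\mathcal Lie$: $(xy)z-x(yz)=(xz)y-x(zy)$; $\mathcal Dend$: $(x\prec y)\prec z=x\prec(y\prec z+y\succ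 z)$, $(x\succ y)\prec z=x\succ(y\prec z)$, $(x\prec y+x\succ y)\succ z=x\succ(y\succ z)$; $\mathcal Zinb$: $(xy)z=x(yz+zy)$; $nil\mathcal Ass$: one non-symmetric product with $(xy)z=x(yz)=0$; $nil\mathcal Lie$: one anti-commutative bracket, $\{x,y\}=-\{y,x\}$, with $\{\{x,y\},z\}=0$. (A) There are isomorphisms of symmetric operads $$\mathcal Ass\bullet\mathcal Ass\cong\mathcal Ass\times\mathcal Ass,\qquad \mathcal Com\bullet\mathcal Ass\cong nil\mathcal Ass,\qquad pre\mathcal Lie\bullet\mathcal Ass\cong\mathcal Dend,$$ $$\mathcal Ass\bullet\mathcal Com\cong nil\mathcal Ass,\qquad \mathcal Com\bullet\mathcal Com\cong nil\mathcal Lie,\qquad pre\mathcal Lie\bullet\mathcal Com\cong\mathcal Zinb.$$ (B) For a vector space $V$ let $C^*(\Delta_1;V)$ be the complex of non-degenerate cochains on the $1$-simplex, with $0$-cochains ${}_x\!\to_y$ (values $x,y\in V$ at the left and right vertex; a missing index means $0$), $1$-cochains $\xrightarrow{x}$, and $d({}_x\!\to_y)=\xrightarrow{y-x}$; let $C^*(\Delta_1,v_l;V)$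 be the subcomplex of cochains vanishing at the left vertex. For an operad $\mathcal O$ as above, an $\mathrm{Ass}_\bullet(\mathcal O)$-algebra structure on $V$ is a dg $\mathcal O$-algebra structure on $C^*(\Delta_1;V)$ for which the cochains vanishing on any given set of vertices form a dg ideal; its associated $\mathcal O$-algebra structure on $V$ is given by the products of the cochains $\to_x$. A $\mathrm{Com}_\bullet(\mathcal O)$-algebra structure is an $\mathrm{Ass}_\bullet(\mathcal O)$-algebra structure whose associated $\mathcal O$-algebra structure is trivial. A $\mathrm{preLie}_\bullet(\mathcal O)$-algebra structure on $V$ is a dg $\mathcal O$-algebra structure on $C^*(\Delta_1,v_l;V)$. Then for every $V$ the following formulas, in which $\cdot$ is the generating product of $\mathcal Ass$ or $\mathcal Com$ acting on cochains, define bijections between the structures on $V$ of the indicated types: 1. $\mathrm{Ass}_\bullet(\mathcal Ass)=\mathcal Ass\times\mathcal Ass$, with products $\prec,\succ$: ${}_x\!\to\cdot\xrightarrow{y}=\xrightarrow{x\prec y}$, $\to_x\cdot\xrightarrow{y}=-\xrightarrow{y\succ x}$; 2. $\mathrm{Com}_\bullet(\mathcal Ass)=nil\mathcal Ass$, with product $\star$: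 ${}_x\!\to\cdot\xrightarrow{y}=\xrightarrow{x\star y}$; 3. $\mathrm{preLie}_\bullet(\mathcal Ass)=\mathcal Dend$, with products $\prec,\succ$: $\xrightarrow{x}\cdot\to_y=\xrightarrow{x\prec y}$, $\to_x\cdot\xrightarrow{y}=\xrightarrow{x\succ y}$; 4. $\mathrm{Ass}_\bullet(\mathcal Com)=nil\mathcal Ass$, with product $\circ$: ${}_x\!\to\cdot\xrightarrow{y}=\xrightarrow{x\circ y}$; 5. $\mathrm{Com}_\bullet(\mathcal Com)=nil\mathcal Lie$, with bracket $\{-,-\}$: ${}_x\!\to\cdot\xrightarrow{y}=\xrightarrow{\{x,y\}}$; 6. $\mathrm{preLie}_\bullet(\mathcal Com)=\mathcal Zinb$, with product $\circ$: $\xrightarrow{x}\cdot\to_y=\xrightarrow{x\circ y}$. -/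

import Mathlib

open scoped TensorProduct

universe u v w

namespace Manin

/-! ## Binary quadratic data

A generating space is a vector space `E` of binary operations together with the involution `τ`
sending an operation `e` to the opposite operation, `(τ e)(x, y) = e(y, x)`.
The arity three part of the free symmetric operad on `E` is the sum of three copies of `E ⊗ E`:
the element `a ⊗ b` of the copy with index `i` (modulo `3`) stands for the operation
`(x₀, x₁, x₂) ↦ a(b(xᵢ, xᵢ₊₁), xᵢ₊₂)`. -/

section Quad

variable (K : Type u) [Field K] {E : Type w} [AddCommGroup E] [Module K E]

/-- The arity three part of the free symmetric operad generated by `E`. -/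
abbrev Quad (E : Type w) [AddCommGroup E] [Module K E] : Type w := Fin 3 → E ⊗[K] E

/-- The action of the cyclic permutation of the three variables. -/
def rot : Quad K E →ₗ[K] Quad K E where
  toFun r := fun i => r (i + 1)
  map_add' _ _ := rfl
  map_smul' _ _ := rfl

variable {K}

/-- The action of the three transpositions of the variables: `c = 0` exchanges `x₀, x₁`,
`c = 2` exchanges `x₁, x₂`, and `c = 1` exchanges `x₀, x₂`. -/
def transp (τ : E →ₗ[K] E) (c : Fin 3) : Quad K E →ₗ[K] Quad K E where
  toFun r := fun i => LinearMap.lTensor E τ (r (c - i))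
  map_add' r s := by ext i; simp
  map_smul' k r := by ext i; simp

/-- The operation `(x₀, x₁, x₂) ↦ a(b(x₀, x₁), x₂)`. -/
def lmon (a b : E) : Quad K E := Pi.single 0 (a ⊗ₜ[K] b)

/-- The operation `(x₀, x₁, x₂) ↦ a(x₀, b(x₁, x₂))`. -/
def rmon (τ : E →ₗ[K] E) (a b : E) : Quad K E := Pi.single 1 (τ a ⊗ₜ[K] b)

/-- The `S₃`-submodule generated by a set of ternary operations. -/
def symSpan (τ : E →ₗ[K] E) (S : Set (Quad K E)) : Submodule K (Quad K E) :=
  sInf {N | S ⊆ N ∧ (∀ r ∈ N, rot K r ∈ N) ∧ ∀ c, ∀ r ∈ N, transp τ c r ∈ N}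

theorem rot_mem_symSpan (τ : E →ₗ[K] E) (S : Set (Quad K E)) :
    ∀ r ∈ symSpan τ S, rot K r ∈ symSpan τ S := by
  intro r hr
  simp only [symSpan, Submodule.mem_sInf] at hr ⊢
  exact fun N hN => hN.2.1 r (hr N hN)

theorem transp_mem_symSpan (τ : E →ₗ[K] E) (S : Set (Quad K E)) :
    ∀ c, ∀ r ∈ symSpan τ S, transp τ c r ∈ symSpan τ S := by
  intro c r hr
  simp only [symSpan, Submodule.mem_sInf] at hr ⊢
  exact fun N hN => hN.2.2 c r (hr N hN)

end Quad

/-- Binary quadratic data `(E, R)`: a finite dimensional space `E` of generating operations with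
its action of `S₂`, and an `S₃`-stable space `R` of relations in the arity three part of the free
operad on `E`. They present the binary quadratic operad `BQ.operad` below. -/
structure BQ (K : Type u) [Field K] where
  E : Type u
  [acg : AddCommGroup E]
  [mod : Module K E]
  [fin : Module.Finite K E]
  τ : E →ₗ[K] E
  τ_τ : ∀ e, τ (τ e) = e
  R : Submodule K (Quad K E)
  rot_mem : ∀ r ∈ R, rot K r ∈ R
  transp_mem : ∀ c, ∀ r ∈ R, transp τ c r ∈ R

attribute [instance] BQ.acg BQ.mod BQ.fin

/-- The data with the given generating operations, subject to the given relations and their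
consequences under permutation of the variables. -/
abbrev BQ.ofRel {K : Type u} [Field K] (E : Type u) [AddCommGroup E] [Module K E] [Module.Finite K E]
    (τ : E →ₗ[K] E) (hτ : ∀ e, τ (τ e) = e) (S : Set (Quad K E)) : BQ K where
  E := E
  τ := τ
  τ_τ := hτ
  R := symSpan τ S
  rot_mem := rot_mem_symSpan τ S
  transp_mem := transp_mem_symSpan τ S

/-! ## Algebras -/

section Algebras

variable {K : Type u} [Field K] {E : Type w} [AddCommGroup E] [Module K E]
  {V : Type v} [AddCommGroup V] [Module K V]

/-- For binary operations `op e` on `V`, the linear map `a ⊗ b ↦ a(b(x, y), z)`. -/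
def compAt (op : E →ₗ[K] V →ₗ[K] V →ₗ[K] V) (x y z : V) : E ⊗[K] E →ₗ[K] V :=
  TensorProduct.lift (LinearMap.mk₂ K (fun a b => op a (op b x y) z)
    (by intros; simp) (by intros; simp) (by intros; simp) (by intros; simp))

/-- The value at `(v 0, v 1, v 2)` of the ternary operation `r`. -/
def evalQ (op : E →ₗ[K] V →ₗ[K] V →ₗ[K] V) (r : Quad K E) (v : Fin 3 → V) : V :=
  ∑ i : Fin 3, compAt op (v i) (v (i + 1)) (v (i + 2)) (r i)

end Algebras

/-- The structures of algebra over the operad presented by `O` on the vector space `V`. -/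
@[ext]
structure BQ.Alg {K : Type u} [Field K] (O : BQ K) (V : Type v) [AddCommGroup V] [Module K V] where
  op : O.E →ₗ[K] V →ₗ[K] V →ₗ[K] V
  symm : ∀ e x y, op (O.τ e) x y = op e y x
  rel : ∀ r ∈ O.R, ∀ v : Fin 3 → V, evalQ op r v = 0

/-! ## Symmetric operads -/

/-- A symmetric operad in `K`-vector spaces, with operations indexed by finite sets of inputs:
`Op X` is the space of operations with set of inputs `X`, functorially in bijections, and
`comp p q` is the operation obtained by plugging `q x` in the input `x` of `p`. -/
structure SymOperad (K : Type u) [Field K] where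
  Op : (X : Type) → [Finite X] → Type u
  [acg : ∀ (X : Type) [Finite X], AddCommGroup (Op X)]
  [mod : ∀ (X : Type) [Finite X], Module K (Op X)]
  map : ∀ {X Y : Type} [Finite X] [Finite Y], (X ≃ Y) → (Op X →ₗ[K] Op Y)
  one : Op Unit
  comp : ∀ {X : Type} [Finite X] {Y : X → Type} [∀ x, Finite (Y x)],
    Op X →ₗ[K] MultilinearMap K (fun x => Op (Y x)) (Op (Σ x, Y x))
  map_refl : ∀ {X : Type} [Finite X] (p : Op X), map (Equiv.refl X) p = p
  map_trans : ∀ {X Y Z : Type} [Finite X] [Finite Y] [Finite Z] (e : X ≃ Y) (f : Y ≃ Z) (p : Op X),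
    map (e.trans f) p = map f (map e p)
  comp_map_left : ∀ {X X' : Type} [Finite X] [Finite X'] {Y : X' → Type} [∀ x, Finite (Y x)]
    (e : X ≃ X') (p : Op X) (q : ∀ x, Op (Y x)),
    comp (map e p) q = map (Equiv.sigmaCongrLeft (β := Y) e) (comp p (fun x => q (e x)))
  comp_map_right : ∀ {X : Type} [Finite X] {Y Y' : X → Type} [∀ x, Finite (Y x)]
    [∀ x, Finite (Y' x)] (e : ∀ x, Y x ≃ Y' x) (p : Op X) (q : ∀ x, Op (Y x)),
    comp p (fun x => map (e x) (q x)) = map (Equiv.sigmaCongrRight e) (comp p q)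
  one_comp : ∀ {X : Type} [Finite X] (p : Op X),
    comp one (fun _ => p) = map (Equiv.uniqueSigma (fun _ : Unit => X)).symm p
  comp_one : ∀ {X : Type} [Finite X] (p : Op X),
    comp p (fun _ => one) = map (Equiv.sigmaUnique X (fun _ => Unit)).symm p
  comp_assoc : ∀ {X : Type} [Finite X] {Y : X → Type} [∀ x, Finite (Y x)]
    {Z : (x : X) → Y x → Type} [∀ x y, Finite (Z x y)]
    (p : Op X) (q : ∀ x, Op (Y x)) (r : ∀ x y, Op (Z x y)),
    map (Equiv.sigmaAssoc Z) (comp (comp p q) (fun s : (Σ x, Y x) => r s.1 s.2)) =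
      comp p (fun x => comp (q x) (r x))

attribute [instance] SymOperad.acg SymOperad.mod

/-- Isomorphisms of symmetric operads. -/
structure SymOperad.Iso {K : Type u} [Field K] (P Q : SymOperad K) where
  toEquiv : ∀ (X : Type) [Finite X], P.Op X ≃ₗ[K] Q.Op X
  map_comm : ∀ {X Y : Type} [Finite X] [Finite Y] (e : X ≃ Y) (p : P.Op X),
    toEquiv Y (P.map e p) = Q.map e (toEquiv X p)
  one_comm : toEquiv Unit P.one = Q.one
  comp_comm : ∀ {X : Type} [Finite X] {Y : X → Type} [∀ x, Finite (Y x)]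
    (p : P.Op X) (q : ∀ x, P.Op (Y x)),
    toEquiv (Σ x, Y x) (P.comp p q) = Q.comp (toEquiv X p) (fun x => toEquiv (Y x) (q x))

/-! ## The operad presented by binary quadratic data

The free algebra on a set `X` of variables is spanned by the binary trees with leaves labelled by
`X` and vertices labelled by `E`, modulo multilinearity in the labels of the vertices,
`(τ e)(s, t) = e(t, s)`, and the relations in `R`, at every place of a tree. The operations with
set of inputs `X` are the part of the free algebra on `X` which is multilinear in `X`, and
composition is substitution. -/

/-- Binary trees, that is, formal monomials. -/
inductive Tree (E : Type u) (X : Type) : Type u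
  | leaf : X → Tree E X
  | node : E → Tree E X → Tree E X → Tree E X

namespace Tree

variable {E : Type u} {X : Type}

/-- The list of the variables occurring in a tree. -/
def leaves : Tree E X → List X
  | leaf x => [x]
  | node _ s t => s.leaves ++ t.leaves

/-- The value of a tree, given operations `op` and values `f` of the variables. -/
def eval {V : Type v} (op : E → V → V → V) (f : X → V) : Tree E X → V
  | leaf x => f x
  | node e s t => op e (s.eval op f) (t.eval op f)

end Tree

namespace BQ

variable {K : Type u} [Field K] (O : BQ K)

/-- Formal linear combinations of trees. -/
abbrev FT (X : Type) : Type u := Tree O.E X →₀ K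

/-- Joining two linear combinations of trees at a new root with label `e`. -/
noncomputable def nodeL {X : Type} (e : O.E) : O.FT X →ₗ[K] O.FT X →ₗ[K] O.FT X :=
  Finsupp.linearCombination K fun s =>
    Finsupp.linearCombination K fun t => Finsupp.single (Tree.node e s t) (1 : K)

/-- The linear combinations of trees that vanish in the free algebra: the ideal generated by
multilinearity, symmetry, and the relations of `O`. -/
inductive Rel {X : Type} : O.FT X → Prop
  | zero : Rel 0
  | add {p q} : Rel p → Rel q → Rel (p + q)
  | smul (c : K) {p} : Rel p → Rel (c • p)
  | left (e : O.E) {p} (q) : Rel p → Rel (O.nodeL e p q)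
  | right (e : O.E) (p) {q} : Rel q → Rel (O.nodeL e p q)
  | lin_add (e e' : O.E) (p q) : Rel (O.nodeL (e + e') p q - (O.nodeL e p q + O.nodeL e' p q))
  | lin_smul (c : K) (e : O.E) (p q) : Rel (O.nodeL (c • e) p q - c • O.nodeL e p q)
  | symm (e : O.E) (p q) : Rel (O.nodeL (O.τ e) p q - O.nodeL e q p)
  | rel (l : List (Fin 3 × O.E × O.E))
      (hl : (l.map fun m => (Pi.single m.1 (m.2.1 ⊗ₜ[K] m.2.2) : Quad K O.E)).sum ∈ O.R)
      (v : Fin 3 → O.FT X) :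
      Rel (l.map fun m =>
        O.nodeL m.2.1 (O.nodeL m.2.2 (v m.1) (v (m.1 + 1))) (v (m.1 + 2))).sum

/-- The space of relations of the free algebra on `X`. -/
def relSub (X : Type) : Submodule K (O.FT X) where
  carrier := {p | O.Rel p}
  zero_mem' := Rel.zero
  add_mem' := Rel.add
  smul_mem' c _ h := Rel.smul c h

/-- The free algebra on `X`. -/
abbrev Free (X : Type) : Type u := O.FT X ⧸ O.relSub X

variable {O} {X Y : Type}

/-- The class of a tree in the free algebra. -/
noncomputable def cls (t : Tree O.E X) : O.Free X := (O.relSub X).mkQ (Finsupp.single t 1)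

theorem nodeL_single (e : O.E) (s t : Tree O.E X) :
    O.nodeL e (Finsupp.single s 1) (Finsupp.single t 1) = Finsupp.single (Tree.node e s t) 1 := by
  simp [nodeL]

section Lift

variable {V : Type v} [AddCommGroup V] [Module K V]

/-- Evaluation in an algebra. -/
noncomputable def evalFT (A : O.Alg V) (f : X → V) : O.FT X →ₗ[K] V :=
  Finsupp.linearCombination K (Tree.eval (fun e x y => A.op e x y) f)

theorem evalFT_nodeL (A : O.Alg V) (f : X → V) (e : O.E) (p q : O.FT X) :
    evalFT A f (O.nodeL e p q) = A.op e (evalFT A f p) (evalFT A f q) := by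
  have h : (O.nodeL e).compr₂ (evalFT A f) =
      (A.op e).compl₁₂ (evalFT A f) (evalFT A f) := by
    ext s t
    simp [nodeL, evalFT, Tree.eval]
  exact LinearMap.congr_fun₂ h p q

theorem evalQ_single (op : O.E →ₗ[K] V →ₗ[K] V →ₗ[K] V) (i : Fin 3) (t : O.E ⊗[K] O.E)
    (v : Fin 3 → V) :
    evalQ op (Pi.single i t : Quad K O.E) v = compAt op (v i) (v (i + 1)) (v (i + 2)) t := by
  unfold evalQ
  rw [Finset.sum_eq_single i]
  · simp
  · intro j _ hj
    simp [hj]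
  · simp

theorem evalQ_list_sum (op : O.E →ₗ[K] V →ₗ[K] V →ₗ[K] V) (v : Fin 3 → V)
    (l : List (Fin 3 × O.E × O.E)) :
    evalQ op (l.map fun m => (Pi.single m.1 (m.2.1 ⊗ₜ[K] m.2.2) : Quad K O.E)).sum v =
      (l.map fun m => op m.2.1 (op m.2.2 (v m.1) (v (m.1 + 1))) (v (m.1 + 2))).sum := by
  induction l with
  | nil => simp [evalQ]
  | cons m l ih =>
    have hadd : ∀ r s : Quad K O.E, evalQ op (r + s) v = evalQ op r v + evalQ op s v := by
      intro r s
      simp [evalQ, Finset.sum_add_distrib]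
    simp only [List.map_cons, List.sum_cons, hadd, ih, evalQ_single]
    simp [compAt]

theorem evalFT_rel (A : O.Alg V) (f : X → V) {p : O.FT X} (h : O.Rel p) : evalFT A f p = 0 := by
  induction h with
  | zero => simp
  | add _ _ h1 h2 => simp [h1, h2]
  | smul c _ h => simp [h]
  | left e q _ h => simp [evalFT_nodeL, h]
  | right e p _ h => simp [evalFT_nodeL, h]
  | lin_add e e' p q => simp [evalFT_nodeL]
  | lin_smul c e p q => simp [evalFT_nodeL]
  | symm e p q => simp [evalFT_nodeL, A.symm]
  | rel l hl v =>
    have h := A.rel _ hl (fun i => evalFT A f (v i))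
    rw [evalQ_list_sum] at h
    rw [map_list_sum, List.map_map]
    simpa [Function.comp_def, evalFT_nodeL] using h

/-- The morphism of algebras from the free algebra extending `f`. -/
noncomputable def lift (A : O.Alg V) (f : X → V) : O.Free X →ₗ[K] V :=
  (O.relSub X).liftQ (evalFT A f) fun _ h => evalFT_rel A f h

theorem lift_cls (A : O.Alg V) (f : X → V) (t : Tree O.E X) :
    lift A f (cls t) = t.eval (fun e x y => A.op e x y) f := by
  simp [lift, cls, evalFT]

end Lift

variable (O) in
/-- The operations of the free algebra. -/
noncomputable def freeOp (X : Type) : O.E →ₗ[K] O.Free X →ₗ[K] O.Free X →ₗ[K] O.Free X where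
  toFun e :=
    (O.relSub X).liftQ
      { toFun := fun p => (O.relSub X).liftQ ((O.relSub X).mkQ ∘ₗ O.nodeL e p) (by
          intro q hq
          rw [LinearMap.mem_ker]
          exact (Submodule.Quotient.mk_eq_zero _).2 (Rel.right e p hq))
        map_add' := by
          intro p p'
          ext q
          simp
        map_smul' := by
          intro c p
          ext q
          simp }
      (by
        intro p hp
        rw [LinearMap.mem_ker]
        apply Submodule.linearMap_qext
        apply LinearMap.ext
        intro q
        exact (Submodule.Quotient.mk_eq_zero _).2 (Rel.left e q hp))
  map_add' e e' := by
    apply Submodule.linearMap_qext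
    apply LinearMap.ext
    intro p
    apply Submodule.linearMap_qext
    apply LinearMap.ext
    intro q
    exact (Submodule.Quotient.eq _).2 (Rel.lin_add e e' p q)
  map_smul' c e := by
    apply Submodule.linearMap_qext
    apply LinearMap.ext
    intro p
    apply Submodule.linearMap_qext
    apply LinearMap.ext
    intro q
    exact (Submodule.Quotient.eq _).2 (Rel.lin_smul c e p q)

theorem freeOp_mkQ (e : O.E) (p q : O.FT X) :
    O.freeOp X e ((O.relSub X).mkQ p) ((O.relSub X).mkQ q) = (O.relSub X).mkQ (O.nodeL e p q) :=
  rfl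

theorem freeOp_cls (e : O.E) (s t : Tree O.E X) :
    O.freeOp X e (cls s) (cls t) = cls (Tree.node e s t) := by
  simp only [cls, freeOp_mkQ, nodeL_single]

theorem exists_list (r : Quad K O.E) : ∃ l : List (Fin 3 × O.E × O.E),
    (l.map fun m => (Pi.single m.1 (m.2.1 ⊗ₜ[K] m.2.2) : Quad K O.E)).sum = r := by
  have key : ∀ (i : Fin 3) (t : O.E ⊗[K] O.E), ∃ l : List (Fin 3 × O.E × O.E),
      (l.map fun m => (Pi.single m.1 (m.2.1 ⊗ₜ[K] m.2.2) : Quad K O.E)).sum = Pi.single i t := by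
    intro i t
    induction t using TensorProduct.induction_on with
    | zero => exact ⟨[], by simp⟩
    | tmul a b => exact ⟨[(i, a, b)], by simp⟩
    | add s t hs ht =>
      obtain ⟨l, hl⟩ := hs
      obtain ⟨m, hm⟩ := ht
      exact ⟨l ++ m, by rw [List.map_append, List.sum_append, hl, hm, Pi.single_add]⟩
  obtain ⟨a, ha⟩ := key 0 (r 0)
  obtain ⟨b, hb⟩ := key 1 (r 1)
  obtain ⟨c, hc⟩ := key 2 (r 2)
  refine ⟨a ++ b ++ c, ?_⟩
  simp only [List.map_append, List.sum_append, ha, hb, hc]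
  ext i
  fin_cases i <;> simp

variable (O) in
/-- The free algebra is an algebra. -/
noncomputable def freeAlg (X : Type) : O.Alg (O.Free X) where
  op := O.freeOp X
  symm e x y := by
    obtain ⟨p, rfl⟩ := (O.relSub X).mkQ_surjective x
    obtain ⟨q, rfl⟩ := (O.relSub X).mkQ_surjective y
    rw [freeOp_mkQ, freeOp_mkQ]
    exact (Submodule.Quotient.eq _).2 (Rel.symm e p q)
  rel r hr v := by
    obtain ⟨l, rfl⟩ := exists_list r
    choose p hp using fun i => (O.relSub X).mkQ_surjective (v i)
    rw [evalQ_list_sum]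
    have h : (O.relSub X).mkQ _ = 0 := (Submodule.Quotient.mk_eq_zero _).2 (Rel.rel l hr p)
    rw [map_list_sum, List.map_map] at h
    simpa only [Function.comp_def, ← freeOp_mkQ, hp] using h

/-- Substitution of elements of the free algebra on `Y` for the variables. -/
noncomputable def subst (f : X → O.Free Y) : O.Free X →ₗ[K] O.Free Y := lift (O.freeAlg Y) f

theorem subst_cls_leaf (f : X → O.Free Y) (x : X) : subst f (cls (Tree.leaf x)) = f x := by
  simp [subst, lift_cls, Tree.eval]

theorem subst_cls_node (f : X → O.Free Y) (e : O.E) (s t : Tree O.E X) :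
    subst f (cls (Tree.node e s t)) = O.freeOp Y e (subst f (cls s)) (subst f (cls t)) := by
  simp only [subst, lift_cls, Tree.eval]
  rfl

theorem free_ext {M : Type v} [AddCommGroup M] [Module K M] {F G : O.Free X →ₗ[K] M}
    (h : ∀ t, F (cls t) = G (cls t)) : F = G := by
  apply Submodule.linearMap_qext
  ext t
  exact h t

theorem subst_freeOp (f : X → O.Free Y) (e : O.E) (p q : O.Free X) :
    subst f (O.freeOp X e p q) = O.freeOp Y e (subst f p) (subst f q) := by
  have h : (O.freeOp X e).compr₂ (subst f) = (O.freeOp Y e).compl₁₂ (subst f) (subst f) := by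
    apply free_ext
    intro s
    apply free_ext
    intro t
    simp only [LinearMap.compr₂_apply, LinearMap.compl₁₂_apply, freeOp_cls, subst_cls_node]
  exact LinearMap.congr_fun₂ h p q

theorem subst_subst {Z : Type} (g : Y → O.Free Z) (f : X → O.Free Y) (p : O.Free X) :
    subst g (subst f p) = subst (fun x => subst g (f x)) p := by
  have h : (subst g) ∘ₗ (subst f) = subst (fun x => subst g (f x)) := by
    apply free_ext
    intro t
    induction t with
    | leaf x => simp [subst_cls_leaf]
    | node e s t hs ht =>
      simp only [LinearMap.comp_apply, subst_cls_node, subst_freeOp] at hs ht ⊢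
      rw [hs, ht]
  exact LinearMap.congr_fun h p

theorem subst_id (p : O.Free X) : subst (fun x => cls (Tree.leaf x)) p = p := by
  have h : subst (O := O) (fun x : X => cls (Tree.leaf x)) = LinearMap.id := by
    apply free_ext
    intro t
    induction t with
    | leaf x => simp [subst_cls_leaf]
    | node e s t hs ht =>
      simp only [LinearMap.id_apply, subst_cls_node] at hs ht ⊢
      rw [hs, ht, freeOp_cls]
  exact LinearMap.congr_fun h p

/-- Renaming of the variables. -/
noncomputable def ren (g : X → Y) : O.Free X →ₗ[K] O.Free Y := subst fun x => cls (Tree.leaf (g x))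

theorem ren_leaf (g : X → Y) (x : X) :
    ren (O := O) g (cls (Tree.leaf x)) = cls (Tree.leaf (g x)) := subst_cls_leaf _ _

theorem subst_ren {Z : Type} (f : Y → O.Free Z) (g : X → Y) (p : O.Free X) :
    subst f (ren g p) = subst (fun x => f (g x)) p := by
  simp only [ren, subst_subst, subst_cls_leaf]

theorem ren_subst {Z : Type} (g : Y → Z) (f : X → O.Free Y) (p : O.Free X) :
    ren g (subst f p) = subst (fun x => ren g (f x)) p := subst_subst _ _ _

theorem ren_ren {Z : Type} (g : Y → Z) (f : X → Y) (p : O.Free X) :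
    ren g (ren f p) = ren (fun x => g (f x)) p := by
  simp only [ren, subst_subst, subst_cls_leaf]

variable (O) in
/-- The span of the trees in which every variable of `S` occurs exactly once, and no other
variable occurs. -/
noncomputable def multi (S : Set X) : Submodule K (O.Free X) :=
  Submodule.span K {p | ∃ t : Tree O.E X, t.leaves.Nodup ∧ {x | x ∈ t.leaves} = S ∧ p = cls t}

theorem freeOp_mem_multi {S T : Set X} (hST : Disjoint S T) (e : O.E) {p q : O.Free X}
    (hp : p ∈ O.multi S) (hq : q ∈ O.multi T) : O.freeOp X e p q ∈ O.multi (S ∪ T) := by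
  have h := Submodule.apply_mem_map₂ (O.freeOp X e) hp hq
  rw [multi, multi, Submodule.map₂_span_span] at h
  refine Submodule.span_mono ?_ h
  rintro _ ⟨_, ⟨s, hs, rfl, rfl⟩, _, ⟨t, ht, rfl, rfl⟩, rfl⟩
  refine ⟨Tree.node e s t, ?_, ?_, freeOp_cls e s t⟩
  · rw [Tree.leaves, List.nodup_append]
    refine ⟨hs, ht, ?_⟩
    rintro a ha b hb rfl
    exact Set.disjoint_left.1 hST ha hb
  · ext x
    simp [Tree.leaves]

theorem subst_mem_multi {S : X → Set Y} (hS : ∀ x x', x ≠ x' → Disjoint (S x) (S x'))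
    (f : X → O.Free Y) (hf : ∀ x, f x ∈ O.multi (S x)) (t : Tree O.E X) (ht : t.leaves.Nodup) :
    subst f (cls t) ∈ O.multi {y | ∃ x ∈ t.leaves, y ∈ S x} := by
  induction t with
  | leaf x =>
    rw [subst_cls_leaf]
    have : {y | ∃ x' ∈ (Tree.leaf x : Tree O.E X).leaves, y ∈ S x'} = S x := by
      ext y; simp [Tree.leaves]
    rw [this]
    exact hf x
  | node e s t hs ht' =>
    rw [Tree.leaves, List.nodup_append] at ht
    rw [subst_cls_node]
    have : {y | ∃ x ∈ (Tree.node e s t).leaves, y ∈ S x} =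
        {y | ∃ x ∈ s.leaves, y ∈ S x} ∪ {y | ∃ x ∈ t.leaves, y ∈ S x} := by
      ext y
      simp only [Tree.leaves, List.mem_append, Set.mem_ofPred_eq, Set.mem_union]
      constructor
      · rintro ⟨x, h | h, hy⟩
        · exact Or.inl ⟨x, h, hy⟩
        · exact Or.inr ⟨x, h, hy⟩
      · rintro (⟨x, h, hy⟩ | ⟨x, h, hy⟩)
        · exact ⟨x, Or.inl h, hy⟩
        · exact ⟨x, Or.inr h, hy⟩
    rw [this]
    refine freeOp_mem_multi ?_ e (hs ht.1) (ht' ht.2.1)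
    rw [Set.disjoint_left]
    rintro y ⟨x, hx, hy⟩ ⟨x', hx', hy'⟩
    exact Set.disjoint_left.1 (hS x x' (ht.2.2 x hx x' hx')) hy hy'

theorem subst_mem {S : X → Set Y} (hS : ∀ x x', x ≠ x' → Disjoint (S x) (S x'))
    (f : X → O.Free Y) (hf : ∀ x, f x ∈ O.multi (S x)) {T : Set X} {p : O.Free X}
    (hp : p ∈ O.multi T) : subst f p ∈ O.multi {y | ∃ x ∈ T, y ∈ S x} := by
  have h := Submodule.mem_map_of_mem (f := subst f) hp
  rw [multi, Submodule.map_span, ← SetLike.mem_coe] at h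
  refine Submodule.span_le.2 ?_ h
  rintro _ ⟨_, ⟨t, ht, rfl, rfl⟩, rfl⟩
  exact subst_mem_multi hS f hf t ht

theorem leaf_mem_multi (x : X) : cls (Tree.leaf x) ∈ O.multi {x} :=
  Submodule.subset_span ⟨Tree.leaf x, by simp [Tree.leaves], by ext; simp [Tree.leaves], rfl⟩

theorem ren_mem_multi {g : X → Y} (hg : Function.Injective g) {T : Set X} {p : O.Free X}
    (hp : p ∈ O.multi T) : ren g p ∈ O.multi (g '' T) := by
  have h := subst_mem (S := fun x => {g x}) (fun x x' hx => by simpa using hg.ne hx) _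
    (fun x => leaf_mem_multi (g x)) hp
  have hT : {y | ∃ x ∈ T, y ∈ ({g x} : Set Y)} = g '' T := by
    ext y
    simp [eq_comm]
  rwa [hT] at h

/-- Plugging `q x` in the input `x`. -/
noncomputable def plug {X : Type} {Y : X → Type} (q : ∀ x, O.Free (Y x)) :
    O.Free X →ₗ[K] O.Free (Σ x, Y x) := subst fun x => ren (Sigma.mk x) (q x)

theorem plug_mem {X : Type} {Y : X → Type} {q : ∀ x, O.Free (Y x)}
    (hq : ∀ x, q x ∈ O.multi Set.univ) {p : O.Free X} (hp : p ∈ O.multi Set.univ) :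
    plug q p ∈ O.multi Set.univ := by
  have h := subst_mem (S := fun x => Set.range (Sigma.mk (β := Y) x))
    (fun x x' hx => by
      rw [Set.disjoint_left]
      rintro _ ⟨y, rfl⟩ ⟨y', h⟩
      exact hx (congrArg Sigma.fst h).symm)
    (fun x => ren (Sigma.mk x) (q x))
    (fun x => by
      have := ren_mem_multi (g := Sigma.mk (β := Y) x) sigma_mk_injective (hq x)
      rwa [Set.image_univ] at this) hp
  have hT : {z | ∃ x ∈ (Set.univ : Set X), z ∈ Set.range (Sigma.mk (β := Y) x)} = Set.univ := by
    ext ⟨x, y⟩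
    simp
  rwa [hT] at h

theorem subst_congr_leaves {f g : X → O.Free Y} {t : Tree O.E X}
    (h : ∀ x ∈ t.leaves, f x = g x) : subst f (cls t) = subst g (cls t) := by
  induction t with
  | leaf x => simpa [subst_cls_leaf] using h x (by simp [Tree.leaves])
  | node e s t hs ht =>
    rw [subst_cls_node, subst_cls_node, hs, ht]
    · exact fun x hx => h x (by simp [Tree.leaves, hx])
    · exact fun x hx => h x (by simp [Tree.leaves, hx])

/-- In a tree where `x` occurs exactly once, substitution is linear in the value of `x`. -/
theorem subst_update_tree [DecidableEq X] (f : X → O.Free Y) (x : X) (t : Tree O.E X)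
    (ht : t.leaves.Nodup) (hx : x ∈ t.leaves) :
    ∃ L : O.Free Y →ₗ[K] O.Free Y, ∀ a, subst (Function.update f x a) (cls t) = L a := by
  induction t with
  | leaf y =>
    obtain rfl : x = y := by simpa [Tree.leaves] using hx
    exact ⟨LinearMap.id, fun a => by simp [subst_cls_leaf]⟩
  | node e s t hs ht' =>
    rw [Tree.leaves, List.nodup_append] at ht
    have hc : ∀ r : Tree O.E X, x ∉ r.leaves → ∀ a,
        subst (Function.update f x a) (cls r) = subst f (cls r) := fun r hr a =>
      subst_congr_leaves fun y hy =>
        Function.update_of_ne (by rintro rfl; exact hr hy) _ _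
    rcases List.mem_append.1 hx with h | h
    · obtain ⟨L, hL⟩ := hs ht.1 h
      refine ⟨(O.freeOp Y e).flip (subst f (cls t)) ∘ₗ L, fun a => ?_⟩
      rw [subst_cls_node, hL, hc t (fun h' => ht.2.2 x h x h' rfl)]
      rfl
    · obtain ⟨L, hL⟩ := ht' ht.2.1 h
      refine ⟨O.freeOp Y e (subst f (cls s)) ∘ₗ L, fun a => ?_⟩
      rw [subst_cls_node, hL, hc s (fun h' => ht.2.2 x h' x h rfl)]
      rfl

theorem subst_update [DecidableEq X] (f : X → O.Free Y) (x : X) {p : O.Free X}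
    (hp : p ∈ O.multi Set.univ) :
    ∃ L : O.Free Y →ₗ[K] O.Free Y, ∀ a, subst (Function.update f x a) p = L a := by
  induction hp using Submodule.span_induction with
  | mem p h =>
    obtain ⟨t, ht, hu, rfl⟩ := h
    exact subst_update_tree f x t ht (hu.symm ▸ Set.mem_univ x : x ∈ {x | x ∈ t.leaves})
  | zero => exact ⟨0, fun a => by simp⟩
  | add p q _ _ hp hq =>
    obtain ⟨L, hL⟩ := hp
    obtain ⟨M, hM⟩ := hq
    exact ⟨L + M, fun a => by simp [hL, hM]⟩
  | smul c p _ hp =>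
    obtain ⟨L, hL⟩ := hp
    exact ⟨c • L, fun a => by simp [hL]⟩

theorem plug_update {X : Type} [DecidableEq X] {Y : X → Type} (q : ∀ x, O.Free (Y x)) (x : X)
    {p : O.Free X} (hp : p ∈ O.multi Set.univ) :
    ∃ L : O.Free (Y x) →ₗ[K] O.Free (Σ x, Y x), ∀ a, plug (Function.update q x a) p = L a := by
  obtain ⟨L, hL⟩ := subst_update (fun x => ren (Sigma.mk x) (q x)) x hp
  refine ⟨L ∘ₗ ren (Sigma.mk x), fun a => ?_⟩
  rw [LinearMap.comp_apply, ← hL, plug]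
  congr 1
  congr 1
  ext1 y
  by_cases h : y = x
  · subst h; simp
  · simp [h]

theorem leaf_mem_univ : cls (Tree.leaf ()) ∈ O.multi (Set.univ : Set Unit) := by
  have h := leaf_mem_multi (O := O) ()
  rwa [show ({()} : Set Unit) = Set.univ from Set.eq_univ_of_forall fun _ => rfl] at h

theorem ren_mem_univ (e : X ≃ Y) (p : O.Free X) (hp : p ∈ O.multi Set.univ) :
    ren e p ∈ O.multi Set.univ := by
  have h := ren_mem_multi e.injective hp
  rwa [Set.image_univ, e.range_eq_univ] at h

variable (O) in
/-- The composition of multilinear operations. -/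
noncomputable def compose (X : Type) (Y : X → Type) :
    O.multi (Set.univ : Set X) →ₗ[K]
      MultilinearMap K (fun x => O.multi (Set.univ : Set (Y x)))
        (O.multi (Set.univ : Set (Σ x, Y x))) where
  toFun p :=
    { toFun := fun q => ⟨plug (fun x => (q x).1) p.1, plug_mem (fun x => (q x).2) p.2⟩
      map_update_add' := by
        intro _ q x a b
        obtain ⟨L, hL⟩ := plug_update (fun x => (q x).1) x p.2
        have h : ∀ a : O.multi (Set.univ : Set (Y x)),
            (fun y => (Function.update q x a y).1) =
              Function.update (fun y => (q y).1) x a.1 := by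
          intro a
          ext1 y
          by_cases h : y = x
          · subst h; simp
          · simp [h]
        apply Subtype.ext
        simp only [h, hL]
        exact L.map_add a.1 b.1
      map_update_smul' := by
        intro _ q x c a
        obtain ⟨L, hL⟩ := plug_update (fun x => (q x).1) x p.2
        have h : ∀ a : O.multi (Set.univ : Set (Y x)),
            (fun y => (Function.update q x a y).1) =
              Function.update (fun y => (q y).1) x a.1 := by
          intro a
          ext1 y
          by_cases h : y = x
          · subst h; simp
          · simp [h]
        apply Subtype.ext
        simp only [h, hL]
        exact L.map_smul c a.1 }
  map_add' p p' := MultilinearMap.ext fun q => Subtype.ext ((plug _).map_add p.1 p'.1)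
  map_smul' c p := MultilinearMap.ext fun q => Subtype.ext ((plug _).map_smul c p.1)

variable (O) in
/-- The symmetric operad presented by binary quadratic data. -/
noncomputable def operad : SymOperad K where
  Op X _ := O.multi (Set.univ : Set X)
  acg X _ := inferInstance
  mod X _ := inferInstance
  map e := (ren e).restrict (ren_mem_univ e)
  one := ⟨cls (Tree.leaf ()), leaf_mem_univ⟩
  comp {X} _ {Y} _ := O.compose X Y
  map_refl p := Subtype.ext (subst_id p.1)
  map_trans e f p := Subtype.ext (ren_ren f e p.1).symm
  comp_map_left e p q := Subtype.ext (by
    change plug _ (ren e p.1) = ren _ (plug _ p.1)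
    simp only [plug, subst_ren, ren_subst, ren_ren]
    rfl)
  comp_map_right e p q := Subtype.ext (by
    change plug _ p.1 = ren _ (plug _ p.1)
    simp only [plug, ren_subst]
    congr 1
    congr 1
    ext1 x
    change ren _ (ren _ _) = ren _ (ren _ _)
    simp only [ren_ren]
    rfl)
  one_comp p := Subtype.ext (by
    change plug _ (cls (Tree.leaf ())) = ren _ p.1
    simp only [plug, subst_cls_leaf]
    rfl)
  comp_one p := Subtype.ext (by
    change plug _ p.1 = ren _ p.1
    simp only [plug, ren_leaf]
    rfl)
  comp_assoc p q r := Subtype.ext (by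
    change ren _ (plug _ (plug _ p.1)) = plug (fun x => plug (fun y => (r x y).1) (q x).1) p.1
    simp only [plug, ren_subst, subst_subst, subst_ren, ren_ren]
    rfl)

end BQ

/-! ## Manin black product, and product -/

section Products

variable {K : Type u} [Field K]

/-- The map `Ψ` from (arity three part of the free operad on `E`) ⊗ (same for `F`) to the arity
three part of the free operad on `E ⊗ F ⊗ sgn`, sending
`(a ∘ᵢ b) ⊗ (a' ∘ⱼ b')` to `(a ⊗ a') ∘ᵢ (b ⊗ b')` if `i = j` and to `0` otherwise. -/
noncomputable def psi (E F : Type u) [AddCommGroup E] [Module K E] [AddCommGroup F] [Module K F] :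
    Quad K E →ₗ[K] Quad K F →ₗ[K] Quad K (E ⊗[K] F) :=
  LinearMap.mk₂ K
    (fun r s => fun i => TensorProduct.tensorTensorTensorComm K E E F F (r i ⊗ₜ[K] s i))
    (by intros; ext i; simp [TensorProduct.add_tmul])
    (by intros; ext i; simp [← TensorProduct.smul_tmul'])
    (by intros; ext i; simp [TensorProduct.tmul_add])
    (by intros; ext i; simp)

theorem psi_apply {E F : Type u} [AddCommGroup E] [Module K E] [AddCommGroup F] [Module K F]
    (r : Quad K E) (s : Quad K F) (i : Fin 3) :
    psi E F r s i = TensorProduct.tensorTensorTensorComm K E E F F (r i ⊗ₜ[K] s i) := rfl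

/-- The action of `S₂` on `E ⊗ F ⊗ sgn`. -/
noncomputable def blackτ (O P : BQ K) : O.E ⊗[K] P.E →ₗ[K] O.E ⊗[K] P.E :=
  -TensorProduct.map O.τ P.τ

theorem transp_psi (O P : BQ K) (c : Fin 3) (r : Quad K O.E) (s : Quad K P.E) :
    transp (blackτ O P) c (psi O.E P.E r s) =
      -psi O.E P.E (transp O.τ c r) (transp P.τ c s) := by
  ext i
  have h : (LinearMap.lTensor (O.E ⊗[K] P.E) (blackτ O P)) ∘ₗ
        (TensorProduct.tensorTensorTensorComm K O.E O.E P.E P.E).toLinearMap =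
      -((TensorProduct.tensorTensorTensorComm K O.E O.E P.E P.E).toLinearMap ∘ₗ
        TensorProduct.map (LinearMap.lTensor O.E O.τ) (LinearMap.lTensor P.E P.τ)) := by
    ext a b a' b'
    simp [blackτ]
  exact LinearMap.congr_fun h (r (c - i) ⊗ₜ[K] s (c - i))

/-- The Manin black product: `(E, R) • (F, S) = (E ⊗ F ⊗ sgn, Ψ(R ⊗ S))`. -/
noncomputable abbrev BQ.black (O P : BQ K) : BQ K where
  E := O.E ⊗[K] P.E
  τ := blackτ O P
  τ_τ e := by
    have h : blackτ O P ∘ₗ blackτ O P = LinearMap.id := by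
      ext a b
      simp [blackτ, O.τ_τ, P.τ_τ]
    exact LinearMap.congr_fun h e
  R := Submodule.map₂ (psi O.E P.E) O.R P.R
  rot_mem := by
    intro r hr
    suffices h : Submodule.map₂ (psi O.E P.E) O.R P.R ≤
        (Submodule.map₂ (psi O.E P.E) O.R P.R).comap (rot K) from h hr
    rw [Submodule.map₂_le]
    intro r hr s hs
    exact Submodule.apply_mem_map₂ (psi O.E P.E) (O.rot_mem r hr) (P.rot_mem s hs)
  transp_mem := by
    intro c r hr
    suffices h : Submodule.map₂ (psi O.E P.E) O.R P.R ≤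
        (Submodule.map₂ (psi O.E P.E) O.R P.R).comap (transp (blackτ O P) c) from h hr
    rw [Submodule.map₂_le]
    intro r hr s hs
    rw [Submodule.mem_comap, transp_psi]
    exact Submodule.neg_mem _
      (Submodule.apply_mem_map₂ (psi O.E P.E) (O.transp_mem c r hr) (P.transp_mem c s hs))

/-- The map induced on ternary operations by a map of generators. -/
def quadMap {E F : Type u} [AddCommGroup E] [Module K E] [AddCommGroup F] [Module K F]
    (f : E →ₗ[K] F) (r : Quad K E) : Quad K F := fun i => TensorProduct.map f f (r i)

/-- The product `O × P`: the generating operations of both, the relations of both, and the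
vanishing of every triple product that involves an operation from `O` and one from `P`. -/
abbrev BQ.prod (O P : BQ K) : BQ K :=
  BQ.ofRel (O.E × P.E) (LinearMap.prodMap O.τ P.τ) (by rintro ⟨a, b⟩; simp [O.τ_τ, P.τ_τ])
    ({t | ∃ r ∈ O.R, t = quadMap (LinearMap.inl K O.E P.E) r} ∪
      {t | ∃ s ∈ P.R, t = quadMap (LinearMap.inr K O.E P.E) s} ∪
      {t | ∃ (i : Fin 3) (a : O.E) (b : P.E), t = Pi.single i ((a, 0) ⊗ₜ[K] (0, b))} ∪
      {t | ∃ (i : Fin 3) (a : O.E) (b : P.E), t = Pi.single i ((0, b) ⊗ₜ[K] (a, 0))})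

end Products

/-! ## The operads of the statement -/

section Zoo

variable (K : Type u) [Field K]

/-- The regular representation of `S₂`: the generating space of one operation without symmetry.
The operation is `(1, 0)`, its opposite is `(0, 1)`. -/
def opp : K × K →ₗ[K] K × K := (LinearEquiv.prodComm K K K).toLinearMap

theorem opp_opp (e : K × K) : opp K (opp K e) = e := rfl

/-- The generating operation without symmetry. -/
def gen : K × K := (1, 0)

/-- Associative algebras: `(x y) z = x (y z)`. -/
abbrev Ass : BQ K := BQ.ofRel (K × K) (opp K) (opp_opp K)
  {lmon (gen K) (gen K) - rmon (opp K) (gen K) (gen K)}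

/-- Two step nilpotent associative algebras: `(x y) z = x (y z) = 0`. -/
abbrev nilAss : BQ K := BQ.ofRel (K × K) (opp K) (opp_opp K)
  {lmon (gen K) (gen K), rmon (opp K) (gen K) (gen K)}

/-- Right pre-Lie algebras: `(x y) z - x (y z) = (x z) y - x (z y)`. -/
abbrev preLie : BQ K := BQ.ofRel (K × K) (opp K) (opp_opp K)
  {(lmon (gen K) (gen K) - rmon (opp K) (gen K) (gen K)) -
    transp (opp K) 2 (lmon (gen K) (gen K) - rmon (opp K) (gen K) (gen K))}

/-- Right Zinbiel algebras: `(x y) z = x (y z) + x (z y)`. -/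
abbrev Zinb : BQ K := BQ.ofRel (K × K) (opp K) (opp_opp K)
  {lmon (gen K) (gen K) -
    (rmon (opp K) (gen K) (gen K) + transp (opp K) 2 (rmon (opp K) (gen K) (gen K)))}

/-- Commutative and associative algebras. -/
abbrev Com : BQ K := BQ.ofRel K LinearMap.id (fun _ => rfl)
  {lmon (1 : K) (1 : K) - rmon LinearMap.id (1 : K) (1 : K)}

/-- Two step nilpotent Lie algebras: an anti-commutative bracket with `{{x, y}, z} = 0`. -/
abbrev nilLie : BQ K := BQ.ofRel K (-LinearMap.id) (fun _ => by simp)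
  {lmon (1 : K) (1 : K)}

/-- The first generating operation `≺` of dendriform algebras. -/
def dprec : (K × K) × (K × K) := (gen K, 0)

/-- The second generating operation `≻` of dendriform algebras. -/
def dsucc : (K × K) × (K × K) := (0, gen K)

/-- The involution of the generating space of dendriform algebras. -/
def dopp : (K × K) × (K × K) →ₗ[K] (K × K) × (K × K) := LinearMap.prodMap (opp K) (opp K)

/-- Dendriform algebras: `(x ≺ y) ≺ z = x ≺ (y ≺ z) + x ≺ (y ≻ z)`,
`(x ≻ y) ≺ z = x ≻ (y ≺ z)`, and `(x ≺ y) ≻ z + (x ≻ y) ≻ z = x ≻ (y ≻ z)`. -/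
abbrev Dend : BQ K := BQ.ofRel ((K × K) × (K × K)) (dopp K) (fun _ => rfl)
  {lmon (dprec K) (dprec K) -
      (rmon (dopp K) (dprec K) (dprec K) + rmon (dopp K) (dprec K) (dsucc K)),
    lmon (dprec K) (dsucc K) - rmon (dopp K) (dsucc K) (dprec K),
    lmon (dsucc K) (dprec K) + lmon (dsucc K) (dsucc K) - rmon (dopp K) (dsucc K) (dsucc K)}

end Zoo

/-! ## Differential graded algebras -/

section DG

variable {K : Type u} [Field K] {C : Type v} [AddCommGroup C] [Module K C]

/-- A cochain complex, with underlying space `C`, grading `gr` and differential `d`. -/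
structure IsComplex (gr : ℤ → Submodule K C) (d : C →ₗ[K] C) : Prop where
  internal : DirectSum.IsInternal gr
  d_mem : ∀ n, ∀ x ∈ gr n, d x ∈ gr (n + 1)
  d_d : ∀ x, d (d x) = 0

/-- The value of a ternary operation at homogeneous elements `v 0, v 1, v 2` of degrees
`n 0, n 1, n 2`, with the Koszul sign of the cyclic permutation of the arguments. -/
def evalQSigned {E : Type w} [AddCommGroup E] [Module K E] (op : E →ₗ[K] C →ₗ[K] C →ₗ[K] C)
    (r : Quad K E) (n : Fin 3 → ℤ) (v : Fin 3 → C) : C :=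
  ∑ i : Fin 3,
    (((∑ j ∈ Finset.univ.filter (· < i), n j) *
      (∑ j ∈ Finset.univ.filter (i ≤ ·), n j)).negOnePow : ℤ) •
        compAt op (v i) (v (i + 1)) (v (i + 2)) (r i)

/-- The operations `op` make the complex `(C, gr, d)` into a dg algebra over the operad
presented by `O`. -/
structure IsDGAlg (O : BQ K) (gr : ℤ → Submodule K C) (d : C →ₗ[K] C)
    (op : O.E →ₗ[K] C →ₗ[K] C →ₗ[K] C) : Prop where
  complex : IsComplex gr d
  op_mem : ∀ e m n, ∀ x ∈ gr m, ∀ y ∈ gr n, op e x y ∈ gr (m + n)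
  leibniz : ∀ e m, ∀ x ∈ gr m, ∀ y,
    d (op e x y) = op e (d x) y + (m.negOnePow : ℤ) • op e x (d y)
  symm : ∀ e m n, ∀ x ∈ gr m, ∀ y ∈ gr n,
    op (O.τ e) x y = ((m * n).negOnePow : ℤ) • op e y x
  rel : ∀ r ∈ O.R, ∀ (n : Fin 3 → ℤ) (v : Fin 3 → C), (∀ i, v i ∈ gr (n i)) →
    evalQSigned op r n v = 0

/-- A dg ideal. -/
structure IsDGIdeal (O : BQ K) (d : C →ₗ[K] C) (op : O.E →ₗ[K] C →ₗ[K] C →ₗ[K] C)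
    (I : Submodule K C) : Prop where
  d_mem : ∀ x ∈ I, d x ∈ I
  left_mem : ∀ e, ∀ x ∈ I, ∀ y, op e x y ∈ I
  right_mem : ∀ e x, ∀ y ∈ I, op e x y ∈ I

end DG

/-! ## Cochains on the 1-simplex -/

section Cochains

variable (K : Type u) [Field K] (X : Set (Fin 2)) (V : Type v) [AddCommGroup V] [Module K V]

/-- The `0`-cochains on the `1`-simplex with coefficients in `V`, relative to a set `X` of vertices
(`0` is the left vertex, `1` is the right vertex). -/
def zeroCoch : Submodule K (Fin 2 → V) where
  carrier := {f | ∀ i ∈ X, f i = 0}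
  zero_mem' := fun _ _ => rfl
  add_mem' := fun hf hg i hi => by simp [hf i hi, hg i hi]
  smul_mem' := fun c f hf i hi => by simp [hf i hi]

/-- The non-degenerate cochains on the `1`-simplex relative to a set `X` of vertices:
pairs of a `0`-cochain and a `1`-cochain. -/
abbrev Coch : Type v := zeroCoch K X V × V

/-- The grading: `0`-cochains in degree `0`, `1`-cochains in degree `1`. -/
def cochGr (n : ℤ) : Submodule K (Coch K X V) :=
  if n = 0 then LinearMap.range (LinearMap.inl K (zeroCoch K X V) V)
  else if n = 1 then LinearMap.range (LinearMap.inr K (zeroCoch K X V) V)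
  else ⊥

/-- The differential: `d f = f(right vertex) - f(left vertex)`. -/
def cochD : Coch K X V →ₗ[K] Coch K X V where
  toFun a := (0, a.1.1 1 - a.1.1 0)
  map_add' a b := by ext <;> simp [add_sub_add_comm]
  map_smul' c a := by ext <;> simp [smul_sub]

theorem coch_isComplex : IsComplex (cochGr K X V) (cochD K X V) where
  internal := by
    rw [DirectSum.isInternal_submodule_iff_iSupIndep_and_iSup_eq_top]
    have h0 : cochGr K X V 0 = LinearMap.range (LinearMap.inl K (zeroCoch K X V) V) := by
      simp [cochGr]
    have h1 : cochGr K X V 1 = LinearMap.range (LinearMap.inr K (zeroCoch K X V) V) := by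
      simp [cochGr]
    have hc := LinearMap.isCompl_range_inl_inr (R := K) (M := zeroCoch K X V) (M₂ := V)
    constructor
    · intro n
      by_cases hn0 : n = 0
      · subst hn0
        rw [h0]
        refine hc.disjoint.mono_right (iSup₂_le fun j hj => ?_)
        by_cases hj1 : j = 1
        · rw [hj1, h1]
        · simp [cochGr, hj, hj1]
      · by_cases hn1 : n = 1
        · subst hn1
          rw [h1]
          refine hc.disjoint.symm.mono_right (iSup₂_le fun j hj => ?_)
          by_cases hj0 : j = 0
          · rw [hj0, h0]
          · simp [cochGr, hj, hj0]
        · simp [cochGr, hn0, hn1]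
    · rw [eq_top_iff, ← hc.sup_eq_top, ← h0, ← h1]
      exact sup_le (le_iSup _ 0) (le_iSup _ 1)
  d_mem := by
    intro n x hx
    by_cases hn0 : n = 0
    · subst hn0
      exact ⟨x.1.1 1 - x.1.1 0, rfl⟩
    · have hx1 : x.1 = 0 := by
        by_cases hn1 : n = 1
        · subst hn1
          simp only [cochGr, one_ne_zero, if_false, if_true] at hx
          obtain ⟨y, rfl⟩ := hx
          rfl
        · simp only [cochGr, hn0, hn1, if_false, Submodule.mem_bot] at hx
          simp [hx]
      have : cochD K X V x = 0 := by simp [cochD, hx1]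
      rw [this]
      exact Submodule.zero_mem _
  d_d := by intro x; simp [cochD]

/-- The `0`-cochain with value `x` at the vertex `i` and `0` at the other one. -/
def vert {X : Set (Fin 2)} {V : Type v} [AddCommGroup V] [Module K V]
    (i : Fin 2) (hi : i ∉ X) (x : V) : Coch K X V :=
  (⟨Pi.single i x, fun j hj => by
    have : j ≠ i := fun h => hi (h ▸ hj)
    simp [this]⟩, 0)

/-- The `1`-cochain with value `x`. -/
def arrow {X : Set (Fin 2)} {V : Type v} [AddCommGroup V] [Module K V] (x : V) : Coch K X V :=
  (0, x)

/-- The cochains that moreover vanish on a set `Y` of vertices. -/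
def relCoch (Y : Set (Fin 2)) : Submodule K (Coch K X V) where
  carrier := {a | ∀ i ∈ Y, a.1.1 i = 0}
  zero_mem' := fun _ _ => rfl
  add_mem' := fun hf hg i hi => by simp [hf i hi, hg i hi]
  smul_mem' := fun c f hf i hi => by simp [hf i hi]

end Cochains

/-! ## The functors -/

section Functors

variable {K : Type u} [Field K] (O : BQ K) (V : Type v) [AddCommGroup V] [Module K V]

/-- `Ass_•(O)`-algebra structures on `V`: local dg `O`-algebra structures on the complex of
cochains on the `1`-simplex with coefficients in `V`. -/
@[ext]
structure AssBullet where
  op : O.E →ₗ[K] Coch K ∅ V →ₗ[K] Coch K ∅ V →ₗ[K] Coch K ∅ V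
  isDGAlg : IsDGAlg O (cochGr K ∅ V) (cochD K ∅ V) op
  isLocal : ∀ Y : Set (Fin 2), IsDGIdeal O (cochD K ∅ V) op (relCoch K ∅ V Y)

/-- `preLie_•(O)`-algebra structures on `V`: dg `O`-algebra structures on the complex of cochains
on the `1`-simplex, relative to the left vertex, with coefficients in `V`. -/
@[ext]
structure PreLieBullet where
  op : O.E →ₗ[K] Coch K {0} V →ₗ[K] Coch K {0} V →ₗ[K] Coch K {0} V
  isDGAlg : IsDGAlg O (cochGr K {0} V) (cochD K {0} V) op

/-- The `0`-cochain with value `x` at the left vertex and `0` at the right vertex. -/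
def atLeft {V : Type v} [AddCommGroup V] [Module K V] (x : V) : Coch K ∅ V :=
  vert K 0 (Set.notMem_empty _) x

/-- The `0`-cochain with value `x` at the right vertex and `0` at the left vertex. -/
def atRight {V : Type v} [AddCommGroup V] [Module K V] (x : V) : Coch K ∅ V :=
  vert K 1 (Set.notMem_empty _) x

/-- The `0`-cochain relative to the left vertex with value `x` at the right vertex. -/
def relRight {V : Type v} [AddCommGroup V] [Module K V] (x : V) : Coch K {0} V :=
  vert K 1 (by simp) x

variable {O V} in
/-- The operations of the `O`-algebra structure on `V` associated to an `Ass_•(O)`-algebra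
structure: the operations on `0`-cochains supported at the right vertex. -/
def AssBullet.assoc (A : AssBullet O V) (e : O.E) (x y : V) : V :=
  (A.op e (atRight x) (atRight y)).1.1 1

/-- `Com_•(O)`-algebra structures on `V`: the `Ass_•(O)`-algebra structures with trivial associated
`O`-algebra structure. -/
abbrev ComBullet : Type (max u v) := {A : AssBullet O V // ∀ e x y, A.assoc e x y = 0}

end Functors

end Manin

/-! Operads. An equivariant linear isomorphism of generating spaces that matches the relations in
both directions induces an isomorphism of the presented operads (`BQ.nonempty_iso`), so each
isomorphism of (A) is a computation in arity three. Up to sign, Ψ commutes with S₃, and each factor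
has a single defining relation, say `r` and `s`. Hence Ψ(R ⊗ S) is generated as an S₃-module by the
six elements Ψ(r ⊗ g s) with g in S₃ (`map₂_psi_symSpan_le`, `nonempty_iso_black`). Ψ multiplies
summand by summand. The relations of Ass and Com live on two of the three summands, so when the
supports of `r` and `g s` meet in one index the pairing is one monomial: a triple product is forced
to vanish. This is the origin of the nilpotent operads and of the mixed relations in Ass × Ass. The
pre-Lie relation lives on all three summands, so its pairings retain both summands of `g s` and give
the Zinbiel and dendriform identities. The twist by sgn is absorbed by a minus sign on opposite
operations.

Cochains. There are only degrees 0 and 1, and two 1-cochains have product 0, so every Koszul sign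
can be dropped (`isDGAlg_coch_iff`). Locality kills the product of cochains at different vertices.
The Leibniz rule and the S₂-symmetry then express all products through L(x, y), the product of the
left vertex cochain x and the arrow y (`AssBullet.op_eq`). Conversely any linear family L gives
local operations compatible with d, and only the relations of the operad remain to be imposed
(`AssBullet.ofLeft`). For cochains relative to the left vertex the same holds with the product of an
arrow and a right vertex cochain (`PreLieBullet.op_eq`, `PreLieBullet.ofRight`).

Associativity of such a product, tested on triples with exactly one arrow, becomes two
associativities with vanishing mixed products in the local case (`localMul_assoc_iff`), and the
three dendriform axioms in the relative case (`rightMul_assoc_iff`). Over Com the second product is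
the flip of the first; a trivial associated structure makes it minus the flip. Substituting gives
the six bijections, without using the operad isomorphisms. -/

set_option maxSynthPendingDepth 10
set_option linter.unusedSimpArgs false

namespace Manin

/-! ### Monomials and the action of S₃ in arity three -/

section Quad

variable {K : Type u} [Field K] {E : Type w} [AddCommGroup E] [Module K E]

/-- The operation `(x₀, x₁, x₂) ↦ a(b(xᵢ, xᵢ₊₁), xᵢ₊₂)`. -/
def mon (i : Fin 3) (a b : E) : Quad K E := Pi.single i (a ⊗ₜ[K] b)

theorem lmon_eq_mon (a b : E) : lmon a b = (mon 0 a b : Quad K E) := rfl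

theorem rmon_eq_mon (τ : E →ₗ[K] E) (a b : E) : rmon τ a b = mon 1 (τ a) b := rfl

theorem rot_mon (i : Fin 3) (a b : E) : rot K (mon i a b) = mon (i + 2) a b := by
  ext j
  change (Pi.single i (a ⊗ₜ[K] b) : Quad K E) (j + 1) =
    (Pi.single (i + 2) (a ⊗ₜ[K] b) : Quad K E) j
  have h : j + 1 = i ↔ j = i + 2 := by omega
  simp only [Pi.single_apply, h]

/-- The index is `c - i`, written as `c + 2 * i` modulo 3. Only the inner operation is replaced by
its opposite, since the outer one keeps its two slots. -/
theorem transp_mon (τ : E →ₗ[K] E) (c i : Fin 3) (a b : E) :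
    transp τ c (mon i a b) = mon (c + 2 * i) a (τ b) := by
  ext j
  change LinearMap.lTensor E τ ((Pi.single i (a ⊗ₜ[K] b) : Quad K E) (c - j)) =
    (Pi.single (c + 2 * i) (a ⊗ₜ[K] τ b) : Quad K E) j
  have h : c - j = i ↔ j = c + 2 * i := by omega
  simp only [Pi.single_apply, h]
  split_ifs <;> simp

theorem mon_add_left (i : Fin 3) (a a' b : E) :
    (mon i (a + a') b : Quad K E) = mon i a b + mon i a' b := by
  simp [mon, TensorProduct.add_tmul, Pi.single_add]

theorem mon_add_right (i : Fin 3) (a b b' : E) :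
    (mon i a (b + b') : Quad K E) = mon i a b + mon i a b' := by
  simp [mon, TensorProduct.tmul_add, Pi.single_add]

theorem mon_neg_left (i : Fin 3) (a b : E) : (mon i (-a) b : Quad K E) = -mon i a b := by
  simp [mon, TensorProduct.neg_tmul, Pi.single_neg]

theorem mon_neg_right (i : Fin 3) (a b : E) : (mon i a (-b) : Quad K E) = -mon i a b := by
  simp [mon, TensorProduct.tmul_neg, Pi.single_neg]

theorem mon_smul_left (i : Fin 3) (c : K) (a b : E) :
    (mon i (c • a) b : Quad K E) = c • mon i a b := by
  simp [mon, ← TensorProduct.smul_tmul', Pi.single_smul]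

theorem mon_smul_right (i : Fin 3) (c : K) (a b : E) :
    (mon i a (c • b) : Quad K E) = c • mon i a b := by
  simp [mon, Pi.single_smul]

theorem subset_symSpan (τ : E →ₗ[K] E) {S : Set (Quad K E)} {r : Quad K E} (hr : r ∈ S) :
    r ∈ symSpan τ S := by
  simp only [symSpan, Submodule.mem_sInf]
  exact fun N hN => hN.1 hr

theorem symSpan_le {τ : E →ₗ[K] E} {S : Set (Quad K E)} {N : Submodule K (Quad K E)}
    (hS : ∀ r ∈ S, r ∈ N) (hrot : ∀ r ∈ N, rot K r ∈ N)
    (htransp : ∀ c, ∀ r ∈ N, transp τ c r ∈ N) : symSpan τ S ≤ N :=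
  sInf_le ⟨hS, hrot, htransp⟩

theorem rot_rot_rot (r : Quad K E) : rot K (rot K (rot K r)) = r := by
  ext i
  change r (i + 1 + 1 + 1) = r i
  congr 1
  omega

/-- This and the next two lemmas are the dihedral composition rules. They show that the three powers
of `rot` and the three `transp τ c` exhaust the S₃-orbit of `r`. -/
theorem transp_rot (τ : E →ₗ[K] E) (c : Fin 3) (r : Quad K E) :
    transp τ c (rot K r) = transp τ (c + 1) r := by
  ext i
  change LinearMap.lTensor E τ (r (c - i + 1)) = LinearMap.lTensor E τ (r (c + 1 - i))
  rw [sub_add_eq_add_sub]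

theorem rot_transp (τ : E →ₗ[K] E) (c : Fin 3) (r : Quad K E) :
    rot K (transp τ c r) = transp τ (c - 1) r := by
  ext i
  change LinearMap.lTensor E τ (r (c - (i + 1))) = LinearMap.lTensor E τ (r (c - 1 - i))
  rw [sub_add_eq_sub_sub_swap]

theorem transp_transp {τ : E →ₗ[K] E} (hτ : ∀ e, τ (τ e) = e) (c c' : Fin 3) (r : Quad K E) :
    transp τ c (transp τ c' r) = fun i => r (c' - (c - i)) := by
  ext i
  change LinearMap.lTensor E τ (LinearMap.lTensor E τ (r (c' - (c - i)))) = _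
  rw [← LinearMap.comp_apply, ← LinearMap.lTensor_comp,
    show τ ∘ₗ τ = LinearMap.id from LinearMap.ext hτ, LinearMap.lTensor_id, LinearMap.id_apply]

end Quad

/-! ### Equivariance of Ψ and of maps induced by generators -/

section Psi

variable {K : Type u} [Field K]

theorem psi_mon {E F : Type u} [AddCommGroup E] [Module K E] [AddCommGroup F] [Module K F]
    (i j : Fin 3) (a b : E) (a' b' : F) :
    psi E F (mon i a b : Quad K E) (mon j a' b') =
      if i = j then mon i (a ⊗ₜ[K] a') (b ⊗ₜ[K] b') else 0 := by
  ext k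
  rw [psi_apply]
  by_cases hi : k = i
  · subst hi
    by_cases hj : k = j
    · subst hj
      simp [mon]
    · simp [mon, hj]
  · have : (mon i a b : Quad K E) k = 0 := by simp [mon, hi]
    rw [this]
    split_ifs <;> simp [mon, hi]

theorem psi_sub_left {E F : Type u} [AddCommGroup E] [Module K E] [AddCommGroup F] [Module K F]
    (r r' : Quad K E) (s : Quad K F) : psi E F (r - r') s = psi E F r s - psi E F r' s := by
  rw [map_sub, LinearMap.sub_apply]

theorem psi_sub_right {E F : Type u} [AddCommGroup E] [Module K E] [AddCommGroup F] [Module K F]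
    (r : Quad K E) (s s' : Quad K F) : psi E F r (s - s') = psi E F r s - psi E F r s' :=
  map_sub _ _ _

theorem rot_psi {E F : Type u} [AddCommGroup E] [Module K E] [AddCommGroup F] [Module K F]
    (r : Quad K E) (s : Quad K F) : rot K (psi E F r s) = psi E F (rot K r) (rot K s) := rfl

section QuadMap

variable {E F G : Type u} [AddCommGroup E] [Module K E] [AddCommGroup F] [Module K F]
  [AddCommGroup G] [Module K G]

theorem quadMap_mon (f : E →ₗ[K] F) (i : Fin 3) (a b : E) :
    quadMap f (mon i a b) = mon i (f a) (f b) := by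
  ext k
  by_cases hk : k = i
  · subst hk
    simp [quadMap, mon]
  · simp [quadMap, mon, hk]

/-- `quadMap` as a linear map. -/
def quadMapₗ (f : E →ₗ[K] F) : Quad K E →ₗ[K] Quad K F where
  toFun := quadMap f
  map_add' r s := by ext i; simp [quadMap]
  map_smul' c r := by ext i; simp [quadMap]

theorem quadMapₗ_mon (f : E →ₗ[K] F) (i : Fin 3) (a b : E) :
    quadMapₗ f (mon i a b) = mon i (f a) (f b) := quadMap_mon f i a b

theorem quadMapₗ_apply (f : E →ₗ[K] F) (r : Quad K E) : quadMapₗ f r = quadMap f r := rfl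

theorem quadMapₗ_rot (f : E →ₗ[K] F) (r : Quad K E) :
    quadMapₗ f (rot K r) = rot K (quadMapₗ f r) := rfl

theorem quadMapₗ_transp {f : E →ₗ[K] F} {τ : E →ₗ[K] E} {σ : F →ₗ[K] F}
    (h : ∀ e, f (τ e) = σ (f e)) (c : Fin 3) (r : Quad K E) :
    quadMapₗ f (transp τ c r) = transp σ c (quadMapₗ f r) := by
  ext i
  change TensorProduct.map f f (LinearMap.lTensor E τ (r (c - i))) =
    LinearMap.lTensor F σ (TensorProduct.map f f (r (c - i)))
  simp only [LinearMap.lTensor, ← LinearMap.comp_apply, ← TensorProduct.map_comp]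
  rw [show f ∘ₗ τ = σ ∘ₗ f from LinearMap.ext h]
  rfl

theorem quadMapₗ_quadMapₗ (g : F →ₗ[K] G) (f : E →ₗ[K] F) (r : Quad K E) :
    quadMapₗ g (quadMapₗ f r) = quadMapₗ (g ∘ₗ f) r := by
  ext i
  change TensorProduct.map g g (TensorProduct.map f f (r i)) = _
  rw [← LinearMap.comp_apply, ← TensorProduct.map_comp]
  rfl

end QuadMap

/-- Relations of a black product of presented data: by equivariance, it is enough to pair the
given relations of the first factor with the six images of those of the second one. -/
theorem map₂_psi_symSpan_le {E F : Type u} [AddCommGroup E] [Module K E] [AddCommGroup F]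
    [Module K F] {σ : E →ₗ[K] E} {ρ : F →ₗ[K] F} (hρ : ∀ e, ρ (ρ e) = e)
    {S : Set (Quad K E)} {T : Set (Quad K F)} {N : Submodule K (Quad K (E ⊗[K] F))}
    (hrot : ∀ r ∈ N, rot K r ∈ N)
    (htransp : ∀ c, ∀ r ∈ N, transp (-TensorProduct.map σ ρ) c r ∈ N)
    (htp : ∀ c r s, transp (-TensorProduct.map σ ρ) c (psi E F r s) =
      -psi E F (transp σ c r) (transp ρ c s))
    (h0 : ∀ r ∈ S, ∀ s ∈ T, psi E F r s ∈ N)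
    (h1 : ∀ r ∈ S, ∀ s ∈ T, psi E F r (rot K s) ∈ N)
    (h2 : ∀ r ∈ S, ∀ s ∈ T, psi E F r (rot K (rot K s)) ∈ N)
    (h3 : ∀ r ∈ S, ∀ s ∈ T, ∀ c, psi E F r (transp ρ c s) ∈ N) :
    Submodule.map₂ (psi E F) (symSpan σ S) (symSpan ρ T) ≤ N := by
  -- With `r` fixed, the `s` all of whose six images pair with `r` into `N` form a stable subspace.
  -- Asking for the identity image alone would not be a stable condition.
  have hfix : ∀ r ∈ S, symSpan ρ T ≤ N.comap (psi E F r) := by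
    intro r hr
    let M : Submodule K (Quad K F) :=
      (N.comap (psi E F r) ⊓ N.comap (psi E F r ∘ₗ rot K) ⊓
        N.comap (psi E F r ∘ₗ rot K ∘ₗ rot K)) ⊓
        ⨅ c, N.comap (psi E F r ∘ₗ transp ρ c)
    have hM : symSpan ρ T ≤ M := by
      apply symSpan_le
      · intro s hs
        simp only [M, Submodule.mem_inf, Submodule.mem_iInf, Submodule.mem_comap,
          LinearMap.comp_apply]
        exact ⟨⟨⟨h0 r hr s hs, h1 r hr s hs⟩, h2 r hr s hs⟩, h3 r hr s hs⟩
      · intro s hs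
        simp only [M, Submodule.mem_inf, Submodule.mem_iInf, Submodule.mem_comap,
          LinearMap.comp_apply] at hs ⊢
        obtain ⟨⟨⟨a, b⟩, c⟩, d⟩ := hs
        refine ⟨⟨⟨b, c⟩, by rwa [rot_rot_rot]⟩, fun i => ?_⟩
        rw [transp_rot]
        exact d _
      · intro i s hs
        simp only [M, Submodule.mem_inf, Submodule.mem_iInf, Submodule.mem_comap,
          LinearMap.comp_apply] at hs ⊢
        obtain ⟨⟨⟨a, b⟩, c⟩, d⟩ := hs
        refine ⟨⟨⟨d _, by rw [rot_transp]; exact d _⟩, by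
          rw [rot_transp, rot_transp]; exact d _⟩, fun j => ?_⟩
        rw [transp_transp hρ]
        -- Two transpositions compose to the rotation by `i - j`, whose three values correspond to
        -- the three rotation conditions.
        have hk : ∀ k : Fin 3, k = 0 ∨ k = 1 ∨ k = 1 + 1 := by decide
        rcases hk (i - j) with h | h | h
        · convert a using 2
          ext k
          congr 1
          rw [sub_sub_eq_add_sub, add_sub_right_comm, h, zero_add]
        · convert b using 2
          ext k
          change s _ = s (k + 1)
          congr 1
          rw [sub_sub_eq_add_sub, add_sub_right_comm, h, add_comm]
        · convert c using 2
          ext k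
          change s _ = s (k + 1 + 1)
          congr 1
          rw [sub_sub_eq_add_sub, add_sub_right_comm, h, add_comm, add_assoc]
    exact hM.trans (inf_le_left.trans (inf_le_left.trans inf_le_left))
  rw [Submodule.map₂_le]
  -- Now `s` ranges over the whole stable span. Stability in `r` follows by moving a permutation to
  -- the other argument: Ψ(g r, s) = ± g Ψ(r, g⁻¹ s), where g⁻¹ is `rot` twice for a rotation and g
  -- itself for a transposition.
  let M : Submodule K (Quad K E) := ⨅ s : symSpan ρ T, N.comap ((psi E F).flip s.1)
  have hM : symSpan σ S ≤ M := by
    apply symSpan_le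
    · intro r hr
      simp only [M, Submodule.mem_iInf]
      exact fun s => hfix r hr s.2
    · intro r hr
      simp only [M, Submodule.mem_iInf, Submodule.mem_comap, LinearMap.flip_apply] at hr ⊢
      rintro ⟨s, hs⟩
      have h := hrot _ (hr ⟨_, rot_mem_symSpan ρ T _ (rot_mem_symSpan ρ T _ hs)⟩)
      rwa [rot_psi, rot_rot_rot] at h
    · intro c r hr
      simp only [M, Submodule.mem_iInf, Submodule.mem_comap, LinearMap.flip_apply] at hr ⊢
      rintro ⟨s, hs⟩
      have h := htransp c _ (hr ⟨_, transp_mem_symSpan ρ T c _ hs⟩)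
      rw [htp, transp_transp hρ, neg_mem_iff] at h
      convert h using 2
      ext i
      rw [sub_sub_cancel]
  intro r hr s hs
  have h := hM hr
  simp only [M, Submodule.mem_iInf, Submodule.mem_comap, LinearMap.flip_apply] at h
  exact h ⟨s, hs⟩

end Psi

/-! ## Isomorphisms of presented operads -/

namespace Tree

variable {E F : Type u} {X : Type}

/-- Relabelling of the vertices. -/
def mapLabel (f : E → F) : Tree E X → Tree F X
  | leaf x => leaf x
  | node e s t => node (f e) (s.mapLabel f) (t.mapLabel f)

theorem leaves_mapLabel (f : E → F) (t : Tree E X) : (t.mapLabel f).leaves = t.leaves := by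
  induction t with
  | leaf x => rfl
  | node e s t hs ht => simp [mapLabel, leaves, hs, ht]

end Tree

namespace BQ

variable {K : Type u} [Field K]

section

variable {E F : Type u} [AddCommGroup E] [Module K E] [AddCommGroup F] [Module K F]
  {V : Type v} [AddCommGroup V] [Module K V]

/-- Pulling operations back along `f` therefore turns algebras over the target data into algebras
over the source, provided `f` respects the relations and the involutions. -/
theorem evalQ_quadMap (op : F →ₗ[K] V →ₗ[K] V →ₗ[K] V) (f : E →ₗ[K] F) (r : Quad K E)
    (v : Fin 3 → V) : evalQ op (quadMap f r) v = evalQ (op ∘ₗ f) r v := by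
  refine Finset.sum_congr rfl fun i _ => ?_
  have h : ∀ x y z : V,
      compAt op x y z ∘ₗ TensorProduct.map f f = compAt (op ∘ₗ f) x y z := by
    intro x y z
    ext a b
    simp [compAt]
  exact LinearMap.congr_fun (h _ _ _) _

end

/-- Maps of binary quadratic data. -/
structure Hom (O P : BQ K) where
  toFun : O.E →ₗ[K] P.E
  map_τ : ∀ e, toFun (O.τ e) = P.τ (toFun e)
  map_R : ∀ r ∈ O.R, quadMap toFun r ∈ P.R

variable {O P : BQ K}

/-- Restriction of algebra structures along a map of data. -/
def Alg.comap {V : Type v} [AddCommGroup V] [Module K V] (f : Hom O P) (A : P.Alg V) :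
    O.Alg V where
  op := A.op ∘ₗ f.toFun
  symm e x y := by simp [f.map_τ, A.symm]
  rel r hr v := by
    rw [← evalQ_quadMap]
    exact A.rel _ (f.map_R r hr) v

/-- The map of free algebras induced by a map of data. -/
noncomputable def Hom.free (f : Hom O P) (X : Type) : O.Free X →ₗ[K] P.Free X :=
  lift (Alg.comap f (P.freeAlg X)) fun x => cls (Tree.leaf x)

theorem Hom.free_cls (f : Hom O P) {X : Type} (t : Tree O.E X) :
    f.free X (cls t) = cls (t.mapLabel f.toFun) := by
  rw [Hom.free, lift_cls]
  induction t with
  | leaf x => rfl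
  | node e s t hs ht =>
    simp only [Tree.eval, hs, ht]
    exact freeOp_cls _ _ _

theorem Hom.free_freeOp (f : Hom O P) {X : Type} (e : O.E) (p q : O.Free X) :
    f.free X (O.freeOp X e p q) = P.freeOp X (f.toFun e) (f.free X p) (f.free X q) := by
  have h : (O.freeOp X e).compr₂ (f.free X) =
      (P.freeOp X (f.toFun e)).compl₁₂ (f.free X) (f.free X) := by
    apply free_ext
    intro s
    apply free_ext
    intro t
    simp only [LinearMap.compr₂_apply, LinearMap.compl₁₂_apply, freeOp_cls, Hom.free_cls,
      Tree.mapLabel]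
  exact LinearMap.congr_fun₂ h p q

/-- Composition and renaming in the operad are both substitutions, so this is the only compatibility
needed for a morphism of operads. -/
theorem Hom.free_subst (f : Hom O P) {X Y : Type} (g : X → O.Free Y) (p : O.Free X) :
    f.free Y (subst g p) = subst (fun x => f.free Y (g x)) (f.free X p) := by
  have h : f.free Y ∘ₗ subst g = subst (fun x => f.free Y (g x)) ∘ₗ f.free X := by
    apply free_ext
    intro t
    induction t with
    | leaf x => simp [subst_cls_leaf, Hom.free_cls, Tree.mapLabel]
    | node e s t hs ht =>
      simp only [LinearMap.comp_apply, subst_cls_node, Hom.free_freeOp, Hom.free_cls,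
        Tree.mapLabel] at hs ht ⊢
      rw [hs, ht]
  exact LinearMap.congr_fun h p

theorem Hom.free_ren (f : Hom O P) {X Y : Type} (g : X → Y) (p : O.Free X) :
    f.free Y (ren g p) = ren g (f.free X p) := by
  rw [ren, Hom.free_subst]
  simp only [Hom.free_cls, Tree.mapLabel]
  rfl

/-- Relabelling vertices leaves the leaves untouched, so the map restricts to the multilinear parts,
which are the spaces of the operad. -/
theorem Hom.free_mem_multi (f : Hom O P) {X : Type} (S : Set X) :
    ∀ p ∈ O.multi S, f.free X p ∈ P.multi S := by
  have h : O.multi S ≤ (P.multi S).comap (f.free X) := by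
    refine Submodule.span_le.2 ?_
    rintro _ ⟨t, ht, hS, rfl⟩
    refine Submodule.subset_span ⟨t.mapLabel f.toFun, ?_, ?_, f.free_cls t⟩
    · rwa [Tree.leaves_mapLabel]
    · rwa [Tree.leaves_mapLabel]
  exact h

theorem Hom.free_free (f : Hom O P) (g : Hom P O) (h : ∀ e, g.toFun (f.toFun e) = e) {X : Type}
    (p : O.Free X) : g.free X (f.free X p) = p := by
  have h' : g.free X ∘ₗ f.free X = LinearMap.id := by
    apply free_ext
    intro t
    simp only [LinearMap.comp_apply, Hom.free_cls, LinearMap.id_apply]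
    congr 1
    induction t with
    | leaf x => rfl
    | node e s t hs ht => simp only [Tree.mapLabel, h, hs, ht]
  exact LinearMap.congr_fun h' p

/-- Inverse maps of data induce an isomorphism of the operads that they present. -/
noncomputable def operadIso (f : Hom O P) (g : Hom P O) (hgf : ∀ e, g.toFun (f.toFun e) = e)
    (hfg : ∀ e, f.toFun (g.toFun e) = e) : O.operad.Iso P.operad where
  toEquiv X _ :=
    LinearEquiv.ofLinearMap ((f.free X).restrict (f.free_mem_multi Set.univ))
      ((g.free X).restrict (g.free_mem_multi Set.univ))
      (LinearMap.ext fun p => Subtype.ext (g.free_free f hfg p.1))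
      (LinearMap.ext fun p => Subtype.ext (f.free_free g hgf p.1))
  map_comm e p := Subtype.ext (f.free_ren e p.1)
  one_comm := Subtype.ext (f.free_cls _)
  comp_comm p q := Subtype.ext (by
    change f.free _ (plug _ p.1) = plug _ (f.free _ p.1)
    simp only [plug, Hom.free_subst, Hom.free_ren]
    rfl)

/-- A linear equivalence of generating spaces that matches the relations induces an isomorphism
of operads. -/
theorem nonempty_iso (f : O.E ≃ₗ[K] P.E) (hτ : ∀ e, f (O.τ e) = P.τ (f e))
    (hOP : O.R ≤ P.R.comap (quadMapₗ f.toLinearMap))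
    (hPO : P.R ≤ O.R.comap (quadMapₗ f.symm.toLinearMap)) :
    Nonempty (O.operad.Iso P.operad) :=
  ⟨operadIso ⟨f.toLinearMap, hτ, hOP⟩
    ⟨f.symm.toLinearMap, fun e => by
      change f.symm (P.τ e) = O.τ (f.symm e)
      rw [f.symm_apply_eq, hτ, f.apply_symm_apply], hPO⟩
    f.symm_apply_apply f.apply_symm_apply⟩

end BQ

/-! ### The six black products -/

section Black

variable {K : Type u} [Field K]

/-- Identification of a black product with presented data, checked on generators. -/
theorem nonempty_iso_black {E F G : Type u} [AddCommGroup E] [Module K E] [Module.Finite K E]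
    [AddCommGroup F] [Module K F] [Module.Finite K F]
    [AddCommGroup G] [Module K G] [Module.Finite K G]
    {σ : E →ₗ[K] E} (hσ : ∀ e, σ (σ e) = e) {S : Set (Quad K E)}
    {ρ : F →ₗ[K] F} (hρ : ∀ e, ρ (ρ e) = e) {T : Set (Quad K F)}
    {υ : G →ₗ[K] G} (hυ : ∀ e, υ (υ e) = e) {U : Set (Quad K G)}
    (f : (E ⊗[K] F) ≃ₗ[K] G) (hf : ∀ a b, f (σ a ⊗ₜ ρ b) = -υ (f (a ⊗ₜ b)))
    (hST : ∀ N : Submodule K (Quad K G), (∀ r ∈ U, r ∈ N) → (∀ r ∈ N, rot K r ∈ N) →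
      (∀ c, ∀ r ∈ N, transp υ c r ∈ N) → ∀ r ∈ S, ∀ s ∈ T,
      quadMapₗ f.toLinearMap (psi E F r s) ∈ N ∧
      quadMapₗ f.toLinearMap (psi E F r (rot K s)) ∈ N ∧
      quadMapₗ f.toLinearMap (psi E F r (rot K (rot K s))) ∈ N ∧
      quadMapₗ f.toLinearMap (psi E F r (transp ρ 0 s)) ∈ N ∧
      quadMapₗ f.toLinearMap (psi E F r (transp ρ 1 s)) ∈ N ∧
      quadMapₗ f.toLinearMap (psi E F r (transp ρ 2 s)) ∈ N)
    (hU : ∀ N : Submodule K (Quad K (E ⊗[K] F)), (∀ r ∈ N, rot K r ∈ N) →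
      (∀ c, ∀ r ∈ N, transp (-TensorProduct.map σ ρ) c r ∈ N) →
      (∀ r ∈ S, ∀ s ∈ T, psi E F r s ∈ N ∧ psi E F r (rot K s) ∈ N ∧
        psi E F r (rot K (rot K s)) ∈ N ∧ psi E F r (transp ρ 0 s) ∈ N ∧
        psi E F r (transp ρ 1 s) ∈ N ∧ psi E F r (transp ρ 2 s) ∈ N) →
      ∀ r ∈ U, quadMapₗ f.symm.toLinearMap r ∈ N) :
    Nonempty (((BQ.ofRel E σ hσ S).black (BQ.ofRel F ρ hρ T)).operad.Iso
      (BQ.ofRel G υ hυ U).operad) := by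
  have hf' : ∀ e, f ((-TensorProduct.map σ ρ) e) = υ (f e) := by
    have : f.toLinearMap ∘ₗ (-TensorProduct.map σ ρ) = υ ∘ₗ f.toLinearMap := by
      ext a b
      simp [hf]
    exact LinearMap.congr_fun this
  have hfs : ∀ e, f.symm (υ e) = (-TensorProduct.map σ ρ) (f.symm e) := by
    intro e
    rw [f.symm_apply_eq, hf', f.apply_symm_apply]
  refine BQ.nonempty_iso (O := (BQ.ofRel E σ hσ S).black (BQ.ofRel F ρ hρ T)) f hf' ?_ ?_
  · have h := hST (symSpan υ U) (fun r hr => subset_symSpan υ hr) (rot_mem_symSpan υ U)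
      (transp_mem_symSpan υ U)
    refine map₂_psi_symSpan_le hρ ?_ ?_ ?_ (fun r hr s hs => (h r hr s hs).1)
      (fun r hr s hs => (h r hr s hs).2.1) (fun r hr s hs => (h r hr s hs).2.2.1)
      (fun r hr s hs c => ?_)
    rotate_right
    · obtain ⟨-, -, -, h0, h1, h2⟩ := h r hr s hs
      fin_cases c
      · exact h0
      · exact h1
      · exact h2
    · intro r hr
      rw [Submodule.mem_comap, quadMapₗ_rot]
      exact rot_mem_symSpan υ U _ hr
    · intro c r hr
      rw [Submodule.mem_comap, quadMapₗ_transp (f := f.toLinearMap) hf']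
      exact transp_mem_symSpan υ U c _ hr
    · exact transp_psi (BQ.ofRel E σ hσ S) (BQ.ofRel F ρ hρ T)
  · have hrot := ((BQ.ofRel E σ hσ S).black (BQ.ofRel F ρ hρ T)).rot_mem
    have htransp := ((BQ.ofRel E σ hσ S).black (BQ.ofRel F ρ hρ T)).transp_mem
    refine symSpan_le (hU _ hrot htransp fun r hr s hs => ?_) ?_ ?_
    · have hr := subset_symSpan σ hr
      have hs := subset_symSpan ρ hs
      have hs' := rot_mem_symSpan _ _ _ hs
      exact ⟨Submodule.apply_mem_map₂ _ hr hs, Submodule.apply_mem_map₂ _ hr hs',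
        Submodule.apply_mem_map₂ _ hr (rot_mem_symSpan _ _ _ hs'),
        Submodule.apply_mem_map₂ _ hr (transp_mem_symSpan _ _ 0 _ hs),
        Submodule.apply_mem_map₂ _ hr (transp_mem_symSpan _ _ 1 _ hs),
        Submodule.apply_mem_map₂ _ hr (transp_mem_symSpan _ _ 2 _ hs)⟩
    · intro r hr
      rw [Submodule.mem_comap, quadMapₗ_rot]
      exact hrot _ hr
    · intro c r hr
      rw [Submodule.mem_comap, quadMapₗ_transp (f := f.symm.toLinearMap) hfs]
      exact htransp c _ hr

variable (K)

/-- `a ⊗ (b, c) ↦ (a b, - a c)`. -/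
noncomputable def comAssEquiv : (K ⊗[K] (K × K)) ≃ₗ[K] K × K :=
  (TensorProduct.lid K (K × K)).trans
    (LinearEquiv.prodCongr (LinearEquiv.refl K K) (LinearEquiv.neg K))

/-- `(b, c) ⊗ a ↦ (a b, - a c)`. -/
noncomputable def assComEquiv : ((K × K) ⊗[K] K) ≃ₗ[K] K × K :=
  (TensorProduct.rid K (K × K)).trans
    (LinearEquiv.prodCongr (LinearEquiv.refl K K) (LinearEquiv.neg K))

/-- The involution of the black product exchanges `1 ⊗ gen` with minus its opposite because of sgn.
The sign placed on the opposite operation makes the equivalence commute with the involutions; the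
other equivalences are normalised likewise. -/
theorem comAssEquiv_gen : comAssEquiv K (1 ⊗ₜ gen K) = gen K := by
  simp [comAssEquiv, gen]

theorem comAssEquiv_opp_gen : comAssEquiv K (1 ⊗ₜ opp K (gen K)) = -opp K (gen K) := by
  simp [comAssEquiv, gen, opp]

theorem assComEquiv_gen : assComEquiv K (gen K ⊗ₜ 1) = gen K := by
  simp [assComEquiv, gen]

theorem assComEquiv_opp_gen : assComEquiv K (opp K (gen K) ⊗ₜ 1) = -opp K (gen K) := by
  simp [assComEquiv, gen, opp]

theorem comAssEquiv_symm_gen : (comAssEquiv K).symm (gen K) = 1 ⊗ₜ gen K := by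
  rw [LinearEquiv.symm_apply_eq, comAssEquiv_gen]

theorem comAssEquiv_symm_opp_gen :
    (comAssEquiv K).symm (opp K (gen K)) = -(1 ⊗ₜ opp K (gen K)) := by
  rw [LinearEquiv.symm_apply_eq, map_neg, comAssEquiv_opp_gen, neg_neg]

theorem assComEquiv_symm_gen : (assComEquiv K).symm (gen K) = gen K ⊗ₜ 1 := by
  rw [LinearEquiv.symm_apply_eq, assComEquiv_gen]

theorem assComEquiv_symm_opp_gen :
    (assComEquiv K).symm (opp K (gen K)) = -(opp K (gen K) ⊗ₜ 1) := by
  rw [LinearEquiv.symm_apply_eq, map_neg, assComEquiv_opp_gen, neg_neg]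

/-- The S₃-orbit of a monomial: rotations reach every index, and transpositions reach every index
with the inner operation reversed. -/
theorem mon_mem_of_mon_zero_mem {E : Type u} [AddCommGroup E] [Module K E] {τ : E →ₗ[K] E}
    {N : Submodule K (Quad K E)} (hrot : ∀ r ∈ N, rot K r ∈ N)
    (htransp : ∀ c, ∀ r ∈ N, transp τ c r ∈ N) {a b : E} (h : mon 0 a b ∈ N) (i : Fin 3) :
    mon i a b ∈ N ∧ mon i a (τ b) ∈ N := by
  constructor
  · have h1 := hrot _ h
    have h2 := hrot _ h1
    rw [rot_mon] at h1 h2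
    rw [rot_mon] at h2
    fin_cases i
    · exact h
    · exact h2
    · exact h1
  · have h1 := htransp i _ h
    rwa [transp_mon, mul_zero, add_zero] at h1

theorem eq_top_of_mon_mem {E : Type u} [AddCommGroup E] [Module K E]
    {N : Submodule K (Quad K E)} (h : ∀ i a b, mon i a b ∈ N) : N = ⊤ := by
  rw [eq_top_iff]
  rintro r -
  have hr : r = ∑ i, (Pi.single i (r i) : Quad K E) := (Finset.univ_sum_single r).symm
  rw [hr]
  refine Submodule.sum_mem _ fun i _ => ?_
  induction r i using TensorProduct.induction_on with
  | zero => simp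
  | tmul a b => exact h i a b
  | add s t hs ht =>
    rw [Pi.single_add]
    exact Submodule.add_mem _ hs ht

theorem eq_gen_add_opp_gen (a : K × K) : a = a.1 • gen K + a.2 • opp K (gen K) := by
  ext <;> simp [gen, opp]

/-- Membership of all monomials in operations of the given shapes, from the generating one. -/
theorem mon_mem_of_gen {E : Type u} [AddCommGroup E] [Module K E] {N : Submodule K (Quad K E)}
    (i : Fin 3) (p q : K × K →ₗ[K] E)
    (h1 : mon i (p (gen K)) (q (gen K)) ∈ N) (h2 : mon i (p (gen K)) (q (opp K (gen K))) ∈ N)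
    (h3 : mon i (p (opp K (gen K))) (q (gen K)) ∈ N)
    (h4 : mon i (p (opp K (gen K))) (q (opp K (gen K))) ∈ N) (a b : K × K) :
    mon i (p a) (q b) ∈ N := by
  rw [eq_gen_add_opp_gen K a, eq_gen_add_opp_gen K b]
  simp only [map_add, map_smul, mon_add_left, mon_add_right, mon_smul_left, mon_smul_right]
  refine add_mem (Submodule.smul_mem _ _ (add_mem ?_ ?_))
    (Submodule.smul_mem _ _ (add_mem ?_ ?_)) <;>
  exact Submodule.smul_mem _ _ (by assumption)

/-- With `e` the generator and `e'` its opposite, the orbit of the first relation contains all `mon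
i e e` and `mon i e e'`, and that of the second all `mon i e' e` and `mon i e' e'`. These span arity
three, so one inclusion is automatic whenever the target is `nilAss`. -/
theorem nilAss_eq_top {N : Submodule K (Quad K (K × K))}
    (hN : ∀ r ∈ ({lmon (gen K) (gen K), rmon (opp K) (gen K) (gen K)} : Set (Quad K (K × K))),
      r ∈ N) (hrot : ∀ r ∈ N, rot K r ∈ N) (htransp : ∀ c, ∀ r ∈ N, transp (opp K) c r ∈ N) :
    N = ⊤ := by
  have h1 := hN _ (Set.mem_insert _ _)
  have h2 := hrot _ (hN _ (Set.mem_insert_of_mem _ rfl))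
  rw [rmon_eq_mon, rot_mon] at h2
  have h1 := mon_mem_of_mon_zero_mem K hrot htransp h1
  have h2 := mon_mem_of_mon_zero_mem K hrot htransp h2
  exact eq_top_of_mon_mem K fun i a b => mon_mem_of_gen K i LinearMap.id LinearMap.id
    (h1 i).1 (h1 i).2 (h2 i).1 (h2 i).2 a b

theorem nilLie_eq_top {N : Submodule K (Quad K K)} (h : lmon (1 : K) (1 : K) ∈ N)
    (hrot : ∀ r ∈ N, rot K r ∈ N) (htransp : ∀ c, ∀ r ∈ N, transp (-LinearMap.id) c r ∈ N) :
    N = ⊤ := by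
  have h1 := mon_mem_of_mon_zero_mem K hrot htransp h
  refine eq_top_of_mon_mem K fun i a b => ?_
  rw [← mul_one a, ← mul_one b, ← smul_eq_mul, ← smul_eq_mul, mon_smul_left, mon_smul_right]
  exact Submodule.smul_mem _ _ (Submodule.smul_mem _ _ (h1 i).1)

/-- The relation of Com and a proper rotation of that of Ass share one summand. The two proper
rotations give, up to sign and rotation, the two monomials that define `nilAss`. -/
theorem black_com_ass : Nonempty (((Com K).black (Ass K)).operad.Iso (nilAss K).operad) := by
  refine nonempty_iso_black _ _ _ (comAssEquiv K) ?_ ?_ ?_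
  · rintro a ⟨b, c⟩
    simp [comAssEquiv, opp]
  · intro N hN hrot htransp
    simp [nilAss_eq_top K hN hrot htransp]
  · intro N hrot _ h
    simp only [Set.mem_insert_iff, Set.mem_singleton_iff, forall_eq_or_imp, forall_eq] at h ⊢
    have h1 := hrot _ h.2.2.1
    have h2 := hrot _ (hrot _ h.2.1)
    simp [lmon_eq_mon, rmon_eq_mon, quadMapₗ_mon, comAssEquiv_symm_gen, psi_sub_left,
      psi_sub_right, psi_mon, rot_mon, comAssEquiv_symm_opp_gen, mon_neg_left] at h1 h2 ⊢
    exact ⟨h1, h2⟩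

/-- Pairing with the two rotated Com relations isolates each term of the associativity relation, so
(xy)z and x(yz) vanish separately. -/
theorem black_ass_com : Nonempty (((Ass K).black (Com K)).operad.Iso (nilAss K).operad) := by
  refine nonempty_iso_black _ _ _ (assComEquiv K) ?_ ?_ ?_
  · rintro ⟨b, c⟩ a
    simp [assComEquiv, opp]
  · intro N hN hrot htransp
    simp [nilAss_eq_top K hN hrot htransp]
  · intro N hrot _ h
    simp only [Set.mem_insert_iff, Set.mem_singleton_iff, forall_eq_or_imp, forall_eq] at h ⊢
    have h1 := h.2.1
    have h2 := h.2.2.1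
    simp [lmon_eq_mon, rmon_eq_mon, quadMapₗ_mon, assComEquiv_symm_gen, psi_sub_left,
      psi_sub_right, psi_mon, rot_mon, assComEquiv_symm_opp_gen, mon_neg_left] at h1 h2 ⊢
    exact ⟨h1, h2⟩

/-- One single-monomial pairing suffices, because its orbit spans. The bracket is anti-commutative
because the only symmetry of the generator left is sgn. -/
theorem black_com_com : Nonempty (((Com K).black (Com K)).operad.Iso (nilLie K).operad) := by
  refine nonempty_iso_black _ _ _ (TensorProduct.lid K K) ?_ ?_ ?_
  · simp
  · intro N hN hrot htransp
    simp [nilLie_eq_top K (hN _ rfl) hrot htransp]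
  · intro N hrot _ h
    simp only [Set.mem_singleton_iff, forall_eq] at h ⊢
    have h1 := h.2.1
    simp [lmon_eq_mon, rmon_eq_mon, quadMapₗ_mon, psi_sub_left, psi_sub_right, psi_mon,
      rot_mon] at h1 ⊢
    exact h1

/-- Let Z be the Zinbiel relation and Z' its image under the exchange of the last two variables. The
first pairing gives Z, and the six pairings are ±Z, ±Z' and ±(Z - Z'). -/
theorem black_preLie_com : Nonempty (((preLie K).black (Com K)).operad.Iso (Zinb K).operad) := by
  refine nonempty_iso_black _ _ _ (assComEquiv K) ?_ ?_ ?_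
  · rintro ⟨b, c⟩ a
    simp [assComEquiv, opp]
  · intro N hN hrot htransp
    have h1 := hN _ rfl
    have h2 := htransp 2 _ h1
    simp only [Set.mem_singleton_iff, forall_eq]
    simp [psi_sub_left, psi_sub_right, lmon_eq_mon, rmon_eq_mon, psi_mon, rot_mon, transp_mon,
      opp_opp, quadMapₗ_mon, assComEquiv_gen, assComEquiv_opp_gen, mon_neg_left, mon_neg_right]
      at h1 h2 ⊢
    refine ⟨?_, ?_, ?_, ?_, ?_, ?_⟩
    · convert h1 using 1
      abel
    · convert sub_mem h2 h1 using 1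
      abel
    · convert neg_mem h2 using 1
      abel
    · convert sub_mem h1 h2 using 1
      abel
    · convert neg_mem h1 using 1
      abel
    · convert h2 using 1
      abel
  · intro N hrot _ h
    simp only [Set.mem_singleton_iff, forall_eq] at h ⊢
    have h1 := h.1
    simp [psi_sub_left, psi_sub_right, lmon_eq_mon, rmon_eq_mon, psi_mon, rot_mon, transp_mon,
      opp_opp, quadMapₗ_mon, assComEquiv_symm_gen, assComEquiv_symm_opp_gen, mon_neg_left,
      mon_neg_right] at h1 ⊢
    convert h1 using 1
    abel

/-- The generators `e ⊗ e`, `e' ⊗ e'` are sent to the first operation and to minus its opposite,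
and `e' ⊗ e`, `e ⊗ e'` to minus the second operation and to its opposite, where `e` is the
operation without symmetry and `e'` its opposite. -/
noncomputable def dendEquiv : ((K × K) ⊗[K] (K × K)) ≃ₗ[K] (K × K) × (K × K) :=
  ((TensorProduct.prodLeft K K K K (K × K)).trans
    (LinearEquiv.prodCongr (TensorProduct.lid K (K × K)) (TensorProduct.lid K (K × K)))).trans
  { toFun := fun x => ((x.1.1, -x.2.2), (-x.2.1, x.1.2))
    invFun := fun x => ((x.1.1, x.2.2), (-x.2.1, -x.1.2))
    map_add' := by intros; ext <;> simp [add_comm]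
    map_smul' := by intros; ext <;> simp
    left_inv := by intro x; ext <;> simp
    right_inv := by intro x; ext <;> simp }

/-- The generators `e ⊗ e`, `e' ⊗ e'` are sent to the first operation and to minus its opposite,
and `e ⊗ e'`, `e' ⊗ e` to the second operation and to minus its opposite, where `e` is the
operation without symmetry and `e'` its opposite. -/
noncomputable def assProdEquiv : ((K × K) ⊗[K] (K × K)) ≃ₗ[K] (K × K) × (K × K) :=
  ((TensorProduct.prodLeft K K K K (K × K)).trans
    (LinearEquiv.prodCongr (TensorProduct.lid K (K × K)) (TensorProduct.lid K (K × K)))).trans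
  { toFun := fun x => ((x.1.1, -x.2.2), (x.1.2, -x.2.1))
    invFun := fun x => ((x.1.1, x.2.1), (-x.2.2, -x.1.2))
    map_add' := by intros; ext <;> simp [add_comm]
    map_smul' := by intros; ext <;> simp
    left_inv := by intro x; ext <;> simp
    right_inv := by intro x; ext <;> simp }

theorem dendEquiv_gen : dendEquiv K (gen K ⊗ₜ gen K) = dprec K ∧
    dendEquiv K (opp K (gen K) ⊗ₜ opp K (gen K)) = -dopp K (dprec K) ∧
    dendEquiv K (opp K (gen K) ⊗ₜ gen K) = -dsucc K ∧
    dendEquiv K (gen K ⊗ₜ opp K (gen K)) = dopp K (dsucc K) := by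
  refine ⟨?_, ?_, ?_, ?_⟩ <;> simp [dendEquiv, gen, opp, dopp, dprec, dsucc]

theorem assProdEquiv_gen : assProdEquiv K (gen K ⊗ₜ gen K) = (gen K, 0) ∧
    assProdEquiv K (opp K (gen K) ⊗ₜ opp K (gen K)) = -(opp K (gen K), 0) ∧
    assProdEquiv K (gen K ⊗ₜ opp K (gen K)) = (0, gen K) ∧
    assProdEquiv K (opp K (gen K) ⊗ₜ gen K) = -(0, opp K (gen K)) := by
  refine ⟨?_, ?_, ?_, ?_⟩ <;> simp [assProdEquiv, gen, opp]

/-- The three rotations of associativity pair with the pre-Lie relation to the three dendriform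
relations, up to rotation. The pre-Lie relation changes sign when the last two variables are
exchanged, which cancels the sign in the equivariance of Ψ: the three transposed pairings are the
transposes of the first three. -/
theorem black_preLie_ass : Nonempty (((preLie K).black (Ass K)).operad.Iso (Dend K).operad) := by
  obtain ⟨g1, g2, g3, g4⟩ := dendEquiv_gen K
  have hd : ∀ x, dopp K (dopp K x) = x := fun x => rfl
  refine nonempty_iso_black _ _ _ (dendEquiv K) ?_ ?_ ?_
  · rintro ⟨a, b⟩ ⟨c, d⟩
    simp [dendEquiv, opp, dopp]
  · intro N hN hrot htransp
    have h1 := hN _ (Or.inl rfl)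
    have h2 := hrot _ (hN _ (Or.inr (Or.inl rfl)))
    have h3 := hrot _ (hrot _ (hN _ (Or.inr (Or.inr rfl))))
    have h4 := htransp 2 _ h1
    have h5 := htransp 2 _ h2
    have h6 := htransp 2 _ h3
    simp only [Set.mem_singleton_iff, forall_eq]
    simp [psi_sub_left, psi_sub_right, lmon_eq_mon, rmon_eq_mon, psi_mon, rot_mon, transp_mon,
      opp_opp, quadMapₗ_mon, g1, g2, g3, g4, hd, mon_neg_left, mon_neg_right]
      at h1 h2 h3 h4 h5 h6 ⊢
    refine ⟨?_, ?_, ?_, ?_, ?_, ?_⟩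
    · convert h1 using 1
      abel
    · convert h2 using 1
      abel
    · convert h3 using 1
      abel
    · convert h5 using 1
      abel
    · convert h6 using 1
      abel
    · convert h4 using 1
      abel
  · intro N hrot _ h
    have g5 : (dendEquiv K).symm (dprec K) = gen K ⊗ₜ gen K := by
      rw [LinearEquiv.symm_apply_eq, g1]
    have g6 : (dendEquiv K).symm (dopp K (dprec K)) = -(opp K (gen K) ⊗ₜ opp K (gen K)) := by
      rw [LinearEquiv.symm_apply_eq, map_neg, g2, neg_neg]
    have g7 : (dendEquiv K).symm (dsucc K) = -(opp K (gen K) ⊗ₜ gen K) := by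
      rw [LinearEquiv.symm_apply_eq, map_neg, g3, neg_neg]
    have g8 : (dendEquiv K).symm (dopp K (dsucc K)) = gen K ⊗ₜ opp K (gen K) := by
      rw [LinearEquiv.symm_apply_eq, g4]
    simp only [Set.mem_insert_iff, Set.mem_singleton_iff, forall_eq_or_imp, forall_eq] at h ⊢
    obtain ⟨h1, h2, h3, -⟩ := h
    -- These rotations undo the rotation of the second factor, bringing the relations back to the
    -- indices used in `Dend`.
    have h2 := hrot _ (hrot _ h2)
    have h3 := hrot _ h3
    simp [psi_sub_left, psi_sub_right, lmon_eq_mon, rmon_eq_mon, psi_mon, rot_mon, transp_mon,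
      opp_opp, quadMapₗ_mon, g5, g6, g7, g8, mon_neg_left, mon_neg_right] at h1 h2 h3 ⊢
    refine ⟨?_, ?_, ?_⟩
    · convert h1 using 1
      abel
    · convert h2 using 1
      abel
    · convert h3 using 1
      abel

theorem assProdEquiv_symm_gen : (assProdEquiv K).symm (gen K, 0) = gen K ⊗ₜ gen K ∧
    (assProdEquiv K).symm (opp K (gen K), 0) = -(opp K (gen K) ⊗ₜ opp K (gen K)) ∧
    (assProdEquiv K).symm (0, gen K) = gen K ⊗ₜ opp K (gen K) ∧
    (assProdEquiv K).symm (0, opp K (gen K)) = -(opp K (gen K) ⊗ₜ gen K) := by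
  obtain ⟨g1, g2, g3, g4⟩ := assProdEquiv_gen K
  simp only [LinearEquiv.symm_apply_eq, map_neg, g1, g2, g3, g4, neg_neg, and_self]

/-- A stable subspace that contains the images of the associativity relations of both operations,
and the mixed triple products, contains the images of all relations of `Ass × Ass`. -/
theorem assProd_rel_mem {G : Type u} [AddCommGroup G] [Module K G] {υ : G →ₗ[K] G}
    (f : (K × K) × (K × K) →ₗ[K] G)
    (hf : ∀ e, f (LinearMap.prodMap (opp K) (opp K) e) = υ (f e)) (N : Submodule K (Quad K G))
    (hrot : ∀ r ∈ N, rot K r ∈ N) (htransp : ∀ c, ∀ r ∈ N, transp υ c r ∈ N)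
    (h1 : mon 0 (f (gen K, 0)) (f (gen K, 0)) - mon 1 (f (opp K (gen K), 0)) (f (gen K, 0)) ∈ N)
    (h2 : mon 0 (f (0, gen K)) (f (0, gen K)) - mon 1 (f (0, opp K (gen K))) (f (0, gen K)) ∈ N)
    (h3 : mon 0 (f (gen K, 0)) (f (0, gen K)) ∈ N)
    (h4 : mon 0 (f (opp K (gen K), 0)) (f (0, gen K)) ∈ N)
    (h5 : mon 0 (f (0, gen K)) (f (gen K, 0)) ∈ N)
    (h6 : mon 0 (f (0, opp K (gen K))) (f (gen K, 0)) ∈ N) :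
    (∀ r ∈ (Ass K).R, quadMapₗ f (quadMapₗ (LinearMap.inl K (K × K) (K × K)) r) ∈ N) ∧
    (∀ r ∈ (Ass K).R, quadMapₗ f (quadMapₗ (LinearMap.inr K (K × K) (K × K)) r) ∈ N) ∧
    (∀ i (a b : K × K), mon i (f (a, 0)) (f (0, b)) ∈ N) ∧
    ∀ i (a b : K × K), mon i (f (0, b)) (f (a, 0)) ∈ N := by
  have hl : ∀ a, υ (f (a, 0)) = f (opp K a, 0) := fun a => by simp [← hf]
  have hr : ∀ a, υ (f (0, a)) = f (0, opp K a) := fun a => by simp [← hf]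
  refine ⟨?_, ?_, fun i a b => ?_, fun i a b => ?_⟩
  · suffices h : symSpan (opp K) {lmon (gen K) (gen K) - rmon (opp K) (gen K) (gen K)} ≤
        N.comap (quadMapₗ (f ∘ₗ LinearMap.inl K (K × K) (K × K))) by
      intro r hr
      rw [quadMapₗ_quadMapₗ]
      exact h hr
    refine symSpan_le ?_ ?_ ?_
    · simpa [lmon_eq_mon, rmon_eq_mon, quadMapₗ_mon] using h1
    · exact fun r hr => hrot _ hr
    · intro c r hr
      rw [Submodule.mem_comap, quadMapₗ_transp (σ := υ) fun e => (hl e).symm]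
      exact htransp _ _ hr
  · suffices h : symSpan (opp K) {lmon (gen K) (gen K) - rmon (opp K) (gen K) (gen K)} ≤
        N.comap (quadMapₗ (f ∘ₗ LinearMap.inr K (K × K) (K × K))) by
      intro r hr
      rw [quadMapₗ_quadMapₗ]
      exact h hr
    refine symSpan_le ?_ ?_ ?_
    · simpa [lmon_eq_mon, rmon_eq_mon, quadMapₗ_mon] using h2
    · exact fun r hr => hrot _ hr
    · intro c r hr'
      rw [Submodule.mem_comap, quadMapₗ_transp (σ := υ) fun e => (hr e).symm]
      exact htransp _ _ hr'
  · have h3 := mon_mem_of_mon_zero_mem K hrot htransp h3 i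
    have h4 := mon_mem_of_mon_zero_mem K hrot htransp h4 i
    rw [hr] at h3 h4
    exact mon_mem_of_gen K i (f ∘ₗ LinearMap.inl K (K × K) (K × K))
      (f ∘ₗ LinearMap.inr K (K × K) (K × K)) h3.1 h3.2 h4.1 h4.2 a b
  · have h5 := mon_mem_of_mon_zero_mem K hrot htransp h5 i
    have h6 := mon_mem_of_mon_zero_mem K hrot htransp h6 i
    rw [hl] at h5 h6
    exact mon_mem_of_gen K i (f ∘ₗ LinearMap.inr K (K × K) (K × K))
      (f ∘ₗ LinearMap.inl K (K × K) (K × K)) h5.1 h5.2 h6.1 h6.2 b a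

/-- Pairing with the identity image gives associativity of the first product, and with `transp 1`
that of the second. In the other four pairings the supports meet once, which gives the four mixed
monomials. -/
theorem black_ass_ass :
    Nonempty (((Ass K).black (Ass K)).operad.Iso ((Ass K).prod (Ass K)).operad) := by
  have hf : ∀ a b, assProdEquiv K (opp K a ⊗ₜ opp K b) =
      -LinearMap.prodMap (opp K) (opp K) (assProdEquiv K (a ⊗ₜ b)) := by
    rintro ⟨a, b⟩ ⟨c, d⟩
    simp [assProdEquiv, opp]
  refine nonempty_iso_black _ _ _ (assProdEquiv K) hf ?_ ?_
  · intro N hN _ _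
    obtain ⟨g1, g2, g3, g4⟩ := assProdEquiv_gen K
    have h1 := hN _ (Or.inl (Or.inl (Or.inl ⟨_, subset_symSpan _ rfl, rfl⟩)))
    have h2 := hN _ (Or.inl (Or.inl (Or.inr ⟨_, subset_symSpan _ rfl, rfl⟩)))
    have h3 : ∀ i a b, mon i ((a, 0) : (K × K) × (K × K)) (0, b) ∈ N :=
      fun i a b => hN _ (Or.inl (Or.inr ⟨i, a, b, rfl⟩))
    have h4 : ∀ i a b, mon i ((0, b) : (K × K) × (K × K)) (a, 0) ∈ N :=
      fun i a b => hN _ (Or.inr ⟨i, a, b, rfl⟩)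
    -- Simplification pushes negation into pairs; these equalities pull it out again so that it
    -- leaves the monomial.
    have e1 : ((-opp K (gen K), 0) : (K × K) × (K × K)) = -(opp K (gen K), 0) := by simp
    have e2 : ((0, -opp K (gen K)) : (K × K) × (K × K)) = -(0, opp K (gen K)) := by simp
    simp only [Set.mem_singleton_iff, forall_eq]
    rw [← quadMapₗ_apply] at h1 h2
    simp [psi_sub_left, psi_sub_right, lmon_eq_mon, rmon_eq_mon, psi_mon, rot_mon, transp_mon,
      opp_opp, quadMapₗ_mon, g1, g2, g3, g4, mon_neg_left, mon_neg_right, h3, h4] at h1 h2 ⊢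
    rw [e1, e2, mon_neg_left, mon_neg_left]
    refine ⟨?_, ?_⟩
    · convert h1 using 1
      abel
    · convert neg_mem h2 using 1
      abel
  · intro N hrot htransp h
    obtain ⟨g1, g2, g3, g4⟩ := assProdEquiv_symm_gen K
    simp only [Set.mem_singleton_iff, forall_eq] at h
    obtain ⟨h1, h2, h3, h4, h5, h6⟩ := h
    have h3 := hrot _ h3
    have h6 := hrot _ h6
    simp [psi_sub_left, psi_sub_right, lmon_eq_mon, rmon_eq_mon, psi_mon, rot_mon, transp_mon,
      opp_opp, mon_neg_left, mon_neg_right] at h1 h2 h3 h4 h5 h6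
    have hfs : ∀ e, (assProdEquiv K).symm (LinearMap.prodMap (opp K) (opp K) e) =
        (-TensorProduct.map (opp K) (opp K)) ((assProdEquiv K).symm e) := by
      have : (assProdEquiv K).toLinearMap ∘ₗ (-TensorProduct.map (opp K) (opp K)) =
          (LinearMap.prodMap (opp K) (opp K)) ∘ₗ (assProdEquiv K).toLinearMap := by
        apply TensorProduct.ext'
        intro a b
        simp [hf]
      intro e
      rw [LinearEquiv.symm_apply_eq]
      refine .trans ?_ (LinearMap.congr_fun this _).symm
      simp
    have key := assProd_rel_mem K (assProdEquiv K).symm.toLinearMap hfs N hrot htransp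
    simp only [LinearEquiv.coe_coe, g1, g2, g3, g4, mon_neg_left, mon_neg_right, neg_mem_iff,
      sub_neg_eq_add] at key
    obtain ⟨k1, k2, k3, k4⟩ := key h1
      (by convert neg_mem h5 using 1; abel) h4 h6 h2 h3
    rintro r (((⟨r, hr, rfl⟩ | ⟨r, hr, rfl⟩) | ⟨i, a, b, rfl⟩) | ⟨i, a, b, rfl⟩)
    · exact k1 r hr
    · exact k2 r hr
    · rw [← mon, quadMapₗ_mon]
      exact k3 i a b
    · rw [← mon, quadMapₗ_mon]
      exact k4 i a b

end Black

theorem forall_fin_three_iff {V : Type v} {p : V → V → V → Prop} :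
    (∀ v : Fin 3 → V, p (v 0) (v 1) (v 2)) ↔ ∀ x y z, p x y z :=
  ⟨fun h x y z => h ![x, y, z], fun h _ => h _ _ _⟩

/-! ### Relations evaluated on algebras -/

section Eval

variable {K : Type u} [Field K] {E : Type w} [AddCommGroup E] [Module K E]
  {V : Type v} [AddCommGroup V] [Module K V]

theorem compAt_tmul (op : E →ₗ[K] V →ₗ[K] V →ₗ[K] V) (x y z : V) (a b : E) :
    compAt op x y z (a ⊗ₜ b) = op a (op b x y) z := by
  simp [compAt]

theorem evalQ_mon (op : E →ₗ[K] V →ₗ[K] V →ₗ[K] V) (i : Fin 3) (a b : E) (v : Fin 3 → V) :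
    evalQ op (mon i a b) v = op a (op b (v i) (v (i + 1))) (v (i + 2)) := by
  unfold evalQ
  rw [Finset.sum_eq_single i]
  · simp [mon, compAt_tmul]
  · intro j _ hj
    simp [mon, hj]
  · simp

theorem evalQ_add (op : E →ₗ[K] V →ₗ[K] V →ₗ[K] V) (r s : Quad K E) (v : Fin 3 → V) :
    evalQ op (r + s) v = evalQ op r v + evalQ op s v := by
  simp [evalQ, Finset.sum_add_distrib]

theorem evalQ_smul (op : E →ₗ[K] V →ₗ[K] V →ₗ[K] V) (c : K) (r : Quad K E) (v : Fin 3 → V) :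
    evalQ op (c • r) v = c • evalQ op r v := by
  simp [evalQ, Finset.smul_sum]

theorem evalQ_sub (op : E →ₗ[K] V →ₗ[K] V →ₗ[K] V) (r s : Quad K E) (v : Fin 3 → V) :
    evalQ op (r - s) v = evalQ op r v - evalQ op s v := by
  simp [evalQ, Finset.sum_sub_distrib]

/-- Permuting a relation amounts to permuting its arguments. Identities quantified over all
arguments are thus stable, and checking the defining relations is enough. -/
theorem evalQ_rot (op : E →ₗ[K] V →ₗ[K] V →ₗ[K] V) (r : Quad K E) (v : Fin 3 → V) :
    evalQ op (rot K r) v = evalQ op r fun i => v (i - 1) := by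
  unfold evalQ
  refine Fintype.sum_equiv (Equiv.addRight 1) _ _ fun i => ?_
  have h1 : i + 1 - 1 = i := by omega
  have h2 : i + 1 + 1 - 1 = i + 1 := by omega
  have h3 : i + 1 + 2 - 1 = i + 2 := by omega
  simp only [Equiv.coe_addRight, h1, h2, h3]
  rfl

theorem evalQ_transp (op : E →ₗ[K] V →ₗ[K] V →ₗ[K] V) {τ : E →ₗ[K] E}
    (hop : ∀ e x y, op (τ e) x y = op e y x) (c : Fin 3) (r : Quad K E) (v : Fin 3 → V) :
    evalQ op (transp τ c r) v = evalQ op r fun i => v (c + 1 - i) := by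
  unfold evalQ
  refine Fintype.sum_equiv (Equiv.subLeft c) _ _ fun i => ?_
  have h1 : c + 1 - (c - i) = i + 1 := by omega
  have h2 : c + 1 - (c - i + 1) = i := by omega
  have h3 : c + 1 - (c - i + 2) = i + 2 := by omega
  have h : ∀ x y z : V, compAt op x y z ∘ₗ LinearMap.lTensor E τ = compAt op y x z := by
    intro x y z
    ext a b
    simp [compAt_tmul, hop]
  simp only [Equiv.subLeft_apply, h1, h2, h3]
  exact LinearMap.congr_fun (h _ _ _) _

/-- For operations compatible with the action of `S₂`, the relations need only be checked on
generators. -/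
theorem evalQ_symSpan_iff {op : E →ₗ[K] V →ₗ[K] V →ₗ[K] V} {τ : E →ₗ[K] E}
    (hop : ∀ e x y, op (τ e) x y = op e y x) {S : Set (Quad K E)} :
    (∀ r ∈ symSpan τ S, ∀ v, evalQ op r v = 0) ↔ ∀ r ∈ S, ∀ v, evalQ op r v = 0 := by
  refine ⟨fun h r hr => h r (subset_symSpan τ hr), fun h => ?_⟩
  let N : Submodule K (Quad K E) :=
    { carrier := {r | ∀ v, evalQ op r v = 0}
      zero_mem' := fun v => by simp [evalQ]
      add_mem' := fun hr hs v => by rw [evalQ_add, hr, hs, add_zero]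
      smul_mem' := fun c r hr v => by rw [evalQ_smul, hr, smul_zero] }
  have hN : symSpan τ S ≤ N := symSpan_le h
    (fun r hr v => by rw [evalQ_rot]; exact hr _)
    (fun c r hr v => by rw [evalQ_transp op hop]; exact hr _)
  exact hN

end Eval

/-! ### Explicit identities for each type of algebra -/

section EvalZoo

variable {K : Type u} [Field K] {V : Type v} [AddCommGroup V] [Module K V]

theorem ass_rel_iff {op : K × K →ₗ[K] V →ₗ[K] V →ₗ[K] V}
    (hop : ∀ e x y, op (opp K e) x y = op e y x) :
    (∀ r ∈ (Ass K).R, ∀ v, evalQ op r v = 0) ↔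
      ∀ x y z, op (gen K) (op (gen K) x y) z = op (gen K) x (op (gen K) y z) := by
  rw [← forall_fin_three_iff
    (p := fun x y z => op (gen K) (op (gen K) x y) z = op (gen K) x (op (gen K) y z))]
  refine (evalQ_symSpan_iff hop).trans ?_
  simp [lmon_eq_mon, rmon_eq_mon, evalQ_sub, evalQ_mon, hop, sub_eq_zero]

theorem nilAss_rel_iff {op : K × K →ₗ[K] V →ₗ[K] V →ₗ[K] V}
    (hop : ∀ e x y, op (opp K e) x y = op e y x) :
    (∀ r ∈ (nilAss K).R, ∀ v, evalQ op r v = 0) ↔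
      (∀ x y z, op (gen K) (op (gen K) x y) z = 0) ∧
      ∀ x y z, op (gen K) x (op (gen K) y z) = 0 := by
  rw [← forall_fin_three_iff (p := fun x y z => op (gen K) (op (gen K) x y) z = 0),
    ← forall_fin_three_iff (p := fun x y z => op (gen K) x (op (gen K) y z) = 0)]
  refine (evalQ_symSpan_iff hop).trans ?_
  simp [lmon_eq_mon, rmon_eq_mon, evalQ_mon, hop]

theorem zinb_rel_iff {op : K × K →ₗ[K] V →ₗ[K] V →ₗ[K] V}
    (hop : ∀ e x y, op (opp K e) x y = op e y x) :
    (∀ r ∈ (Zinb K).R, ∀ v, evalQ op r v = 0) ↔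
      ∀ x y z, op (gen K) (op (gen K) x y) z =
        op (gen K) x (op (gen K) y z) + op (gen K) x (op (gen K) z y) := by
  rw [← forall_fin_three_iff (p := fun x y z => op (gen K) (op (gen K) x y) z =
        op (gen K) x (op (gen K) y z) + op (gen K) x (op (gen K) z y))]
  refine (evalQ_symSpan_iff hop).trans ?_
  simp [lmon_eq_mon, rmon_eq_mon, transp_mon, evalQ_sub, evalQ_add, evalQ_mon, hop, sub_eq_zero]

theorem com_rel_iff {op : K →ₗ[K] V →ₗ[K] V →ₗ[K] V} (hop : ∀ e x y, op e x y = op e y x) :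
    (∀ r ∈ (Com K).R, ∀ v, evalQ op r v = 0) ↔
      ∀ x y z, op 1 (op 1 x y) z = op 1 x (op 1 y z) := by
  rw [← forall_fin_three_iff (p := fun x y z => op 1 (op 1 x y) z = op 1 x (op 1 y z))]
  refine (evalQ_symSpan_iff (τ := LinearMap.id) hop).trans ?_
  simp only [Set.mem_singleton_iff, forall_eq, lmon_eq_mon, rmon_eq_mon, evalQ_sub, evalQ_mon,
    LinearMap.id_apply, sub_eq_zero]
  -- The second term evaluates as (v₁v₂)v₀; commutativity brings it to v₀(v₁v₂).
  simp [hop 1 _ (_ : V)]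

theorem nilLie_rel_iff {op : K →ₗ[K] V →ₗ[K] V →ₗ[K] V}
    (hop : ∀ e x y, op (-e) x y = op e y x) :
    (∀ r ∈ (nilLie K).R, ∀ v, evalQ op r v = 0) ↔ ∀ x y z, op 1 (op 1 x y) z = 0 := by
  rw [← forall_fin_three_iff (p := fun x y z => op 1 (op 1 x y) z = 0)]
  refine (evalQ_symSpan_iff (τ := -LinearMap.id) hop).trans ?_
  simp [lmon_eq_mon, evalQ_mon]

theorem dend_rel_iff {op : (K × K) × (K × K) →ₗ[K] V →ₗ[K] V →ₗ[K] V}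
    (hop : ∀ e x y, op (dopp K e) x y = op e y x) :
    (∀ r ∈ (Dend K).R, ∀ v, evalQ op r v = 0) ↔
      (∀ x y z, op (dprec K) (op (dprec K) x y) z =
        op (dprec K) x (op (dprec K) y z) + op (dprec K) x (op (dsucc K) y z)) ∧
      (∀ x y z, op (dprec K) (op (dsucc K) x y) z = op (dsucc K) x (op (dprec K) y z)) ∧
      ∀ x y z, op (dsucc K) (op (dprec K) x y) z + op (dsucc K) (op (dsucc K) x y) z =
        op (dsucc K) x (op (dsucc K) y z) := by
  rw [← forall_fin_three_iff (p := fun x y z => op (dprec K) (op (dprec K) x y) z =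
        op (dprec K) x (op (dprec K) y z) + op (dprec K) x (op (dsucc K) y z)),
    ← forall_fin_three_iff (p := fun x y z =>
      op (dprec K) (op (dsucc K) x y) z = op (dsucc K) x (op (dprec K) y z)),
    ← forall_fin_three_iff (p := fun x y z =>
      op (dsucc K) (op (dprec K) x y) z + op (dsucc K) (op (dsucc K) x y) z =
        op (dsucc K) x (op (dsucc K) y z))]
  refine (evalQ_symSpan_iff hop).trans ?_
  simp [lmon_eq_mon, rmon_eq_mon, evalQ_sub, evalQ_add, evalQ_mon, hop, sub_eq_zero]

/-- Only left-nested mixed products are listed: since `a` and `b` run over all generators, including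
the opposite ones, they also cover the right-nested products. -/
theorem assProd_rel_iff {op : (K × K) × (K × K) →ₗ[K] V →ₗ[K] V →ₗ[K] V}
    (hop : ∀ e x y, op (LinearMap.prodMap (opp K) (opp K) e) x y = op e y x) :
    (∀ r ∈ ((Ass K).prod (Ass K)).R, ∀ v, evalQ op r v = 0) ↔
      (∀ x y z, op (gen K, 0) (op (gen K, 0) x y) z = op (gen K, 0) x (op (gen K, 0) y z)) ∧
      (∀ x y z, op (0, gen K) (op (0, gen K) x y) z = op (0, gen K) x (op (0, gen K) y z)) ∧
      (∀ a b x y z, op (a, 0) (op (0, b) x y) z = 0) ∧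
      (∀ a b x y z, op (0, b) (op (a, 0) x y) z = 0) := by
  have hl := ass_rel_iff (op := op ∘ₗ LinearMap.inl K (K × K) (K × K)) (fun e x y => by
    simpa using hop (e, 0) x y)
  have hr := ass_rel_iff (op := op ∘ₗ LinearMap.inr K (K × K) (K × K)) (fun e x y => by
    simpa using hop (0, e) x y)
  simp only [LinearMap.comp_apply, LinearMap.inl_apply, LinearMap.inr_apply] at hl hr
  rw [← hl, ← hr]
  refine (evalQ_symSpan_iff hop).trans ⟨fun h => ⟨?_, ?_, ?_, ?_⟩, ?_⟩
  · intro r hm v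
    rw [← BQ.evalQ_quadMap]
    exact h _ (Or.inl (Or.inl (Or.inl ⟨r, hm, rfl⟩))) v
  · intro r hm v
    rw [← BQ.evalQ_quadMap]
    exact h _ (Or.inl (Or.inl (Or.inr ⟨r, hm, rfl⟩))) v
  · intro a b x y z
    have := h _ (Or.inl (Or.inr ⟨0, a, b, rfl⟩)) ![x, y, z]
    rw [← mon, evalQ_mon] at this
    exact this
  · intro a b x y z
    have := h _ (Or.inr ⟨0, a, b, rfl⟩) ![x, y, z]
    rw [← mon, evalQ_mon] at this
    exact this
  · rintro ⟨h1, h2, h3, h4⟩ r (((⟨r, hm, rfl⟩ | ⟨r, hm, rfl⟩) | ⟨i, a, b, rfl⟩) | ⟨i, a, b, rfl⟩) v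
    · rw [BQ.evalQ_quadMap]
      exact h1 r hm v
    · rw [BQ.evalQ_quadMap]
      exact h2 r hm v
    · rw [← mon, evalQ_mon]
      exact h3 _ _ _ _ _
    · rw [← mon, evalQ_mon]
      exact h4 _ _ _ _ _

end EvalZoo

/-! ### Dg algebra structures on cochains without Koszul signs -/

section CochAlg

variable {K : Type u} [Field K] {X : Set (Fin 2)} {V : Type v} [AddCommGroup V] [Module K V]

theorem mem_cochGr_zero {a : Coch K X V} : a ∈ cochGr K X V 0 ↔ a.2 = 0 := by
  simp only [cochGr, if_true, LinearMap.mem_range, LinearMap.inl_apply]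
  exact ⟨fun ⟨f, hf⟩ => by simp [← hf], fun h => ⟨a.1, by simp [← h]⟩⟩

theorem mem_cochGr_one {a : Coch K X V} : a ∈ cochGr K X V 1 ↔ a.1 = 0 := by
  simp only [cochGr, one_ne_zero, if_false, if_true, LinearMap.mem_range, LinearMap.inr_apply]
  exact ⟨fun ⟨f, hf⟩ => by simp [← hf], fun h => ⟨a.2, by simp [← h]⟩⟩

theorem mem_cochGr_two {a : Coch K X V} : a ∈ cochGr K X V 2 ↔ a = 0 := by
  simp [cochGr]

theorem mem_cochGr_cases {n : ℤ} {a : Coch K X V} (h : a ∈ cochGr K X V n) :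
    n = 0 ∧ a.2 = 0 ∨ n = 1 ∧ a.1 = 0 ∨ a = 0 := by
  by_cases h0 : n = 0
  · subst h0
    exact Or.inl ⟨rfl, mem_cochGr_zero.1 h⟩
  · by_cases h1 : n = 1
    · subst h1
      exact Or.inr (Or.inl ⟨rfl, mem_cochGr_one.1 h⟩)
    · simp only [cochGr, h0, h1, if_false, Submodule.mem_bot] at h
      exact Or.inr (Or.inr h)

theorem coch_eq_add (a : Coch K X V) : a = (a.1, 0) + (0, a.2) := by simp

variable {O : BQ K} {op : O.E →ₗ[K] Coch K X V →ₗ[K] Coch K X V →ₗ[K] Coch K X V}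

/-- The algebra structures on cochains, without signs: they do not matter, since a product of two
cochains of degree `1` vanishes. -/
structure IsCochAlg (O : BQ K) (op : O.E →ₗ[K] Coch K X V →ₗ[K] Coch K X V →ₗ[K] Coch K X V) :
    Prop where
  op_zero_zero : ∀ e a b, a.2 = 0 → b.2 = 0 → (op e a b).2 = 0
  op_one_left : ∀ e a b, a.1 = 0 → (op e a b).1 = 0
  op_one_right : ∀ e a b, b.1 = 0 → (op e a b).1 = 0
  op_one_one : ∀ e a b, a.1 = 0 → b.1 = 0 → op e a b = 0
  leibniz : ∀ e a b, cochD K X V (op e a b) = op e (cochD K X V a) b + op e a (cochD K X V b)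
  symm : ∀ e a b, op (O.τ e) a b = op e b a
  rel : ∀ r ∈ O.R, ∀ v, evalQ op r v = 0

/-- Two arguments of degree 1 would put the product in degree at least 2, where there are no
cochains. -/
theorem compAt_eq_zero_of_degree {E : Type w} [AddCommGroup E] [Module K E]
    {op : E →ₗ[K] Coch K X V →ₗ[K] Coch K X V →ₗ[K] Coch K X V}
    (h1 : ∀ e a b, a.1 = 0 → (op e a b).1 = 0) (h2 : ∀ e a b, b.1 = 0 → (op e a b).1 = 0)
    (h3 : ∀ e a b, a.1 = 0 → b.1 = 0 → op e a b = 0) {x y z : Coch K X V}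
    (h : x.1 = 0 ∧ y.1 = 0 ∨ x.1 = 0 ∧ z.1 = 0 ∨ y.1 = 0 ∧ z.1 = 0) :
    compAt op x y z = 0 := by
  ext1
  ext1 a
  apply LinearMap.ext
  intro b
  change compAt op x y z (a ⊗ₜ b) = 0
  rw [compAt_tmul]
  rcases h with ⟨hx, hy⟩ | ⟨hx, hz⟩ | ⟨hy, hz⟩
  · simp [h3 b x y hx hy]
  · exact h3 a _ _ (h1 b _ _ hx) hz
  · exact h3 a _ _ (h2 b _ _ hy) hz

theorem compAt_eq_zero_of_eq_zero {E : Type w} [AddCommGroup E] [Module K E]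
    {C : Type v} [AddCommGroup C] [Module K C]
    {op : E →ₗ[K] C →ₗ[K] C →ₗ[K] C} {x y z : C} (h : x = 0 ∨ y = 0 ∨ z = 0) :
    compAt op x y z = 0 := by
  ext1
  ext1 a
  apply LinearMap.ext
  intro b
  change compAt op x y z (a ⊗ₜ b) = 0
  rw [compAt_tmul]
  rcases h with rfl | rfl | rfl <;> simp

/-- A nonzero term has all its arguments in degree 0 except at most one in degree 1, and a single
odd argument moves past even ones without a sign. -/
theorem evalQSigned_eq {E : Type w} [AddCommGroup E] [Module K E]
    {op : E →ₗ[K] Coch K X V →ₗ[K] Coch K X V →ₗ[K] Coch K X V}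
    (h1 : ∀ e a b, a.1 = 0 → (op e a b).1 = 0) (h2 : ∀ e a b, b.1 = 0 → (op e a b).1 = 0)
    (h3 : ∀ e a b, a.1 = 0 → b.1 = 0 → op e a b = 0) (r : Quad K E) (n : Fin 3 → ℤ)
    (v : Fin 3 → Coch K X V) (hv : ∀ i, v i ∈ cochGr K X V (n i)) :
    evalQSigned op r n v = evalQ op r v := by
  refine Finset.sum_congr rfl fun i _ => ?_
  have hz : ∀ j, v j = 0 → compAt op (v i) (v (i + 1)) (v (i + 2)) = 0 := by
    intro j hj
    apply compAt_eq_zero_of_eq_zero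
    have : j = i ∨ j = i + 1 ∨ j = i + 2 := by omega
    rcases this with rfl | rfl | rfl
    · exact Or.inl hj
    · exact Or.inr (Or.inl hj)
    · exact Or.inr (Or.inr hj)
  have ho : ∀ j k, j ≠ k → (v j).1 = 0 → (v k).1 = 0 →
      compAt op (v i) (v (i + 1)) (v (i + 2)) = 0 := by
    intro j k hjk hj hk
    apply compAt_eq_zero_of_degree h1 h2 h3
    have h1 : j = i ∨ j = i + 1 ∨ j = i + 2 := by omega
    have h2 : k = i ∨ k = i + 1 ∨ k = i + 2 := by omega
    rcases h1 with rfl | rfl | rfl <;> rcases h2 with rfl | rfl | rfl <;> simp_all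
  by_cases hc : compAt op (v i) (v (i + 1)) (v (i + 2)) = 0
  · simp [hc]
  have hn : ∀ j, n j = 0 ∨ n j = 1 ∧ (v j).1 = 0 := by
    intro j
    rcases mem_cochGr_cases (hv j) with h | h | h
    · exact Or.inl h.1
    · exact Or.inr h
    · exact absurd (hz j h) hc
  have hn2 : ∀ j k, j ≠ k → n j = 0 ∨ n k = 0 := by
    intro j k hjk
    rcases hn j with h | h
    · exact Or.inl h
    · rcases hn k with h' | h'
      · exact Or.inr h'
      · exact absurd (ho j k hjk h.2 h'.2) hc
  -- The exponent is a sum of products `n j * n k` with `j ≠ k`, each of which has a zero factor.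
  have hs : (∑ j ∈ Finset.univ.filter (· < i), n j) *
      (∑ j ∈ Finset.univ.filter (i ≤ ·), n j) = 0 := by
    rw [Finset.sum_mul_sum]
    refine Finset.sum_eq_zero fun j hj => Finset.sum_eq_zero fun k hk => ?_
    simp only [Finset.mem_filter_univ] at hj hk
    rcases hn2 j k (by omega) with h | h <;> simp [h]
  rw [hs]
  simp

theorem compAt_add_left {E : Type w} [AddCommGroup E] [Module K E]
    {C : Type v} [AddCommGroup C] [Module K C] (op : E →ₗ[K] C →ₗ[K] C →ₗ[K] C) (x x' y z : C) :
    compAt op (x + x') y z = compAt op x y z + compAt op x' y z := by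
  ext a b
  simp [compAt_tmul]

theorem compAt_add_mid {E : Type w} [AddCommGroup E] [Module K E]
    {C : Type v} [AddCommGroup C] [Module K C] (op : E →ₗ[K] C →ₗ[K] C →ₗ[K] C) (x y y' z : C) :
    compAt op x (y + y') z = compAt op x y z + compAt op x y' z := by
  ext a b
  simp [compAt_tmul]

theorem compAt_add_right {E : Type w} [AddCommGroup E] [Module K E]
    {C : Type v} [AddCommGroup C] [Module K C] (op : E →ₗ[K] C →ₗ[K] C →ₗ[K] C) (x y z z' : C) :
    compAt op x y (z + z') = compAt op x y z + compAt op x y z' := by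
  ext a b
  simp [compAt_tmul]

theorem evalQ_add_vec {E : Type w} [AddCommGroup E] [Module K E]
    {C : Type v} [AddCommGroup C] [Module K C] (op : E →ₗ[K] C →ₗ[K] C →ₗ[K] C) (r : Quad K E)
    (x x' y z : C) :
    evalQ op r ![x + x', y, z] = evalQ op r ![x, y, z] + evalQ op r ![x', y, z] ∧
    evalQ op r ![y, x + x', z] = evalQ op r ![y, x, z] + evalQ op r ![y, x', z] ∧
    evalQ op r ![y, z, x + x'] = evalQ op r ![y, z, x] + evalQ op r ![y, z, x'] := by
  refine ⟨?_, ?_, ?_⟩ <;>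
  · simp only [evalQ, ← Finset.sum_add_distrib]
    refine Finset.sum_congr rfl fun i _ => ?_
    fin_cases i <;>
    simp [compAt_add_left, compAt_add_mid, compAt_add_right]

/-- The signs in the Leibniz and symmetry rules can differ from 1 only in front of products of two
1-cochains, or on zero elements. Bilinearity then removes the homogeneity assumptions. -/
theorem isDGAlg_coch_iff : IsDGAlg O (cochGr K X V) (cochD K X V) op ↔ IsCochAlg O op := by
  constructor
  · intro h
    have m0 : ∀ f : zeroCoch K X V, ((f, 0) : Coch K X V) ∈ cochGr K X V 0 :=
      fun f => mem_cochGr_zero.2 rfl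
    have m1 : ∀ x : V, ((0, x) : Coch K X V) ∈ cochGr K X V 1 := fun x => mem_cochGr_one.2 rfl
    have h11 : ∀ e x y, op e (0, x) (0, y) = 0 := fun e x y =>
      mem_cochGr_two.1 (h.op_mem e 1 1 _ (m1 x) _ (m1 y))
    have h01 : ∀ e f y, (op e (f, 0) (0, y)).1 = 0 := fun e f y =>
      mem_cochGr_one.1 (h.op_mem e 0 1 _ (m0 f) _ (m1 y))
    have h10 : ∀ e x g, (op e (0, x) (g, 0)).1 = 0 := fun e x g =>
      mem_cochGr_one.1 (h.op_mem e 1 0 _ (m1 x) _ (m0 g))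
    have h00 : ∀ e f g, (op e (f, 0) (g, 0)).2 = 0 := fun e f g =>
      mem_cochGr_zero.1 (h.op_mem e 0 0 _ (m0 f) _ (m0 g))
    have hl : ∀ e a b, a.1 = 0 → (op e a b).1 = 0 := by
      rintro e ⟨f, x⟩ b rfl
      rw [coch_eq_add b, map_add, h11, add_zero, h10]
    have hr : ∀ e a b, b.1 = 0 → (op e a b).1 = 0 := by
      rintro e a ⟨f, x⟩ rfl
      rw [coch_eq_add a, map_add, LinearMap.add_apply, h11, add_zero, h01]
    have ho : ∀ e a b, a.1 = 0 → b.1 = 0 → op e a b = 0 := by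
      rintro e ⟨f, x⟩ ⟨g, y⟩ rfl rfl
      exact h11 e x y
    refine ⟨?_, hl, hr, ho, ?_, ?_, ?_⟩
    · rintro e ⟨f, x⟩ ⟨g, y⟩ rfl rfl
      exact h00 e f g
    · intro e a b
      have e0 := h.leibniz e 0 _ (m0 a.1) b
      have e1 := h.leibniz e 1 _ (m1 a.2) b
      have hz : op e (0, a.2) (cochD K X V b) = 0 := ho e _ _ rfl rfl
      rw [hz] at e1
      simp only [Int.negOnePow_zero, Units.val_one, one_smul] at e0
      rw [smul_zero, add_zero] at e1
      conv_lhs => rw [coch_eq_add a]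
      conv_rhs => rw [coch_eq_add a]
      simp only [map_add, LinearMap.add_apply, e0, e1, hz, add_zero]
      abel
    · intro e a b
      rw [coch_eq_add a, coch_eq_add b]
      have s00 := h.symm e 0 0 _ (m0 a.1) _ (m0 b.1)
      have s01 := h.symm e 0 1 _ (m0 a.1) _ (m1 b.2)
      have s10 := h.symm e 1 0 _ (m1 a.2) _ (m0 b.1)
      simp only [mul_zero, zero_mul, Int.negOnePow_zero, Units.val_one, one_smul] at s00 s01 s10
      simp only [map_add, LinearMap.add_apply, s00, s01, s10, h11]
      abel
    · intro r hr'
      have key : ∀ n0 n1 n2 a b c, a ∈ cochGr K X V n0 → b ∈ cochGr K X V n1 →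
          c ∈ cochGr K X V n2 → evalQ op r ![a, b, c] = 0 := by
        intro n0 n1 n2 a b c ha hb hc
        have hv : ∀ i, ![a, b, c] i ∈ cochGr K X V (![n0, n1, n2] i) := by
          intro i
          fin_cases i
          · exact ha
          · exact hb
          · exact hc
        rw [← evalQSigned_eq hl hr ho r ![n0, n1, n2] _ hv]
        exact h.rel r hr' _ _ hv
      intro v
      have hv : v = ![v 0, v 1, v 2] := by
        ext1 i
        fin_cases i <;> rfl
      -- Trilinearity reduces to the eight homogeneous triples.
      rw [hv, coch_eq_add (v 0), coch_eq_add (v 1), coch_eq_add (v 2)]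
      simp only [(evalQ_add_vec op r _ _ _ _).1, (evalQ_add_vec op r _ _ _ _).2.1,
        (evalQ_add_vec op r _ _ _ _).2.2]
      rw [key 0 0 0 _ _ _ (m0 _) (m0 _) (m0 _), key 0 0 1 _ _ _ (m0 _) (m0 _) (m1 _),
        key 0 1 0 _ _ _ (m0 _) (m1 _) (m0 _), key 0 1 1 _ _ _ (m0 _) (m1 _) (m1 _),
        key 1 0 0 _ _ _ (m1 _) (m0 _) (m0 _), key 1 0 1 _ _ _ (m1 _) (m0 _) (m1 _),
        key 1 1 0 _ _ _ (m1 _) (m1 _) (m0 _), key 1 1 1 _ _ _ (m1 _) (m1 _) (m1 _)]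
      simp
  · intro h
    refine ⟨coch_isComplex K X V, ?_, ?_, ?_, ?_⟩
    · intro e m n x hx y hy
      rcases mem_cochGr_cases hx with ⟨rfl, hx'⟩ | ⟨rfl, hx'⟩ | rfl
      · rcases mem_cochGr_cases hy with ⟨rfl, hy'⟩ | ⟨rfl, hy'⟩ | rfl
        · exact mem_cochGr_zero.2 (h.op_zero_zero e x y hx' hy')
        · exact mem_cochGr_one.2 (h.op_one_right e x y hy')
        · simp
      · rcases mem_cochGr_cases hy with ⟨rfl, hy'⟩ | ⟨rfl, hy'⟩ | rfl
        · exact mem_cochGr_one.2 (h.op_one_left e x y hx')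
        · rw [h.op_one_one e x y hx' hy']
          exact Submodule.zero_mem _
        · simp
      · simp
    · intro e m x hx y
      rcases mem_cochGr_cases hx with ⟨rfl, hx'⟩ | ⟨rfl, hx'⟩ | rfl
      · simpa using h.leibniz e x y
      · have hz : op e x (cochD K X V y) = 0 := h.op_one_one e _ _ hx' rfl
        rw [h.leibniz, hz, smul_zero]
      · simp
    · intro e m n x hx y hy
      rcases mem_cochGr_cases hx with ⟨rfl, hx'⟩ | ⟨rfl, hx'⟩ | rfl
      · simpa using h.symm e x y
      · rcases mem_cochGr_cases hy with ⟨rfl, hy'⟩ | ⟨rfl, hy'⟩ | rfl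
        · simpa using h.symm e x y
        · rw [h.op_one_one _ x y hx' hy', h.op_one_one _ y x hy' hx', smul_zero]
        · simp
      · simp
    · intro r hr n v hv
      rw [evalQSigned_eq h.op_one_left h.op_one_right h.op_one_one r n v hv]
      exact h.rel r hr v

end CochAlg

/-! ### Local structures on all cochains of the 1-simplex -/

section Local

variable {K : Type u} [Field K] {V : Type v} [AddCommGroup V] [Module K V]

/-- The local product of cochains on the `1`-simplex in which the vertex cochains with value `x`
multiply the arrows from the left by `L x` (left vertex) and by `R x` (right vertex). -/
def localMul (L R : V →ₗ[K] V →ₗ[K] V) : Coch K ∅ V →ₗ[K] Coch K ∅ V →ₗ[K] Coch K ∅ V :=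
  LinearMap.mk₂ K
    (fun a b => (⟨fun i => L (a.1.1 i) (b.1.1 i) + R (a.1.1 i) (b.1.1 i), fun _ h => h.elim⟩,
      -- For an arrow on the left the roles of `L` and `R` are exchanged: applying d to the
      -- vanishing products of cochains at different vertices forces this.
      L (a.1.1 0) b.2 + R (a.1.1 1) b.2 + (R a.2 (b.1.1 0) + L a.2 (b.1.1 1))))
    (fun a a' b => by ext <;> simp <;> abel)
    (fun c a b => by ext <;> simp [smul_add])
    (fun a b b' => by ext <;> simp <;> abel)
    (fun c a b => by ext <;> simp [smul_add])

theorem localMul_fst (L R : V →ₗ[K] V →ₗ[K] V) (a b : Coch K ∅ V) (i : Fin 2) :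
    (localMul L R a b).1.1 i = L (a.1.1 i) (b.1.1 i) + R (a.1.1 i) (b.1.1 i) := rfl

theorem localMul_snd (L R : V →ₗ[K] V →ₗ[K] V) (a b : Coch K ∅ V) :
    (localMul L R a b).2 =
      L (a.1.1 0) b.2 + R (a.1.1 1) b.2 + (R a.2 (b.1.1 0) + L a.2 (b.1.1 1)) := rfl

theorem coch_ext {X : Set (Fin 2)} {a b : Coch K X V} (h : ∀ i, a.1.1 i = b.1.1 i)
    (h' : a.2 = b.2) : a = b :=
  Prod.ext (Subtype.ext (funext h)) h'

/-- The operations on cochains determined by their values on pairs of a cochain at the left vertex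
and an arrow. -/
def localOp {E : Type w} [AddCommGroup E] [Module K E] (τ : E →ₗ[K] E)
    (L : E →ₗ[K] V →ₗ[K] V →ₗ[K] V) : E →ₗ[K] Coch K ∅ V →ₗ[K] Coch K ∅ V →ₗ[K] Coch K ∅ V where
  toFun e := localMul (L e) (L (τ e)).flip
  map_add' e e' := by
    refine LinearMap.ext₂ fun a b => coch_ext (fun i => ?_) ?_
    · simp [localMul_fst]
      abel
    · simp [localMul_snd]
      abel
  map_smul' c e := by
    refine LinearMap.ext₂ fun a b => coch_ext (fun i => ?_) ?_
    · simp [localMul_fst]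
    · simp [localMul_snd]

theorem localOp_apply {E : Type w} [AddCommGroup E] [Module K E] (τ : E →ₗ[K] E)
    (L : E →ₗ[K] V →ₗ[K] V →ₗ[K] V) (e : E) : localOp τ L e = localMul (L e) (L (τ e)).flip := rfl

theorem localOp_symm {E : Type w} [AddCommGroup E] [Module K E] {τ : E →ₗ[K] E}
    (hτ : ∀ e, τ (τ e) = e) (L : E →ₗ[K] V →ₗ[K] V →ₗ[K] V) (e : E) (a b : Coch K ∅ V) :
    localOp τ L (τ e) a b = localOp τ L e b a := by
  refine coch_ext (fun i => ?_) ?_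
  · simp [localOp_apply, localMul_fst, hτ, add_comm]
  · simp only [localOp_apply, localMul_snd, hτ, LinearMap.flip_apply]
    abel

variable {O : BQ K}

namespace AssBullet

/-- Operations on cochains determined by products of a cochain at the left vertex and an arrow,
when they satisfy the relations. -/
def ofLeft (L : O.E →ₗ[K] V →ₗ[K] V →ₗ[K] V)
    (hL : ∀ r ∈ O.R, ∀ v, evalQ (localOp O.τ L) r v = 0) : AssBullet O V where
  op := localOp O.τ L
  isDGAlg := isDGAlg_coch_iff.2
    { op_zero_zero := fun e a b ha hb => by simp [localOp_apply, localMul_snd, ha, hb]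
      op_one_left := fun e a b ha => by
        ext i
        simp [localOp_apply, localMul_fst, ha]
      op_one_right := fun e a b hb => by
        ext i
        simp [localOp_apply, localMul_fst, hb]
      op_one_one := fun e a b ha hb => coch_ext
        (fun i => by simp [localOp_apply, localMul_fst, ha, hb])
        (by simp [localOp_apply, localMul_snd, ha, hb])
      leibniz := fun e a b => coch_ext (fun i => by simp [localOp_apply, localMul_fst, cochD])
        (by
          simp only [localOp_apply, localMul_snd, localMul_fst, cochD, LinearMap.coe_mk,
            AddHom.coe_mk, LinearMap.flip_apply, Prod.snd_add, Submodule.coe_zero, Pi.zero_apply,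
            map_zero, map_sub, LinearMap.sub_apply, LinearMap.zero_apply]
          abel)
      symm := localOp_symm O.τ_τ L
      rel := hL }
  isLocal Y :=
    { d_mem := fun x _ i _ => rfl
      left_mem := fun e x hx y i hi => by
        have : x.1.1 i = 0 := hx i hi
        simp [localOp_apply, localMul_fst, this]
      right_mem := fun e x y hy i hi => by
        have : y.1.1 i = 0 := hy i hi
        simp [localOp_apply, localMul_fst, this] }

theorem isCochAlg (A : AssBullet O V) : IsCochAlg O A.op := isDGAlg_coch_iff.1 A.isDGAlg

/-- The products of a cochain at the left vertex and an arrow. -/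
def left (A : AssBullet O V) : O.E →ₗ[K] V →ₗ[K] V →ₗ[K] V where
  toFun e := LinearMap.mk₂ K (fun x y => (A.op e (atLeft x) (arrow K y)).2)
    (fun x x' y => by
      have : (atLeft (x + x') : Coch K ∅ V) = atLeft x + atLeft x' := by
        refine coch_ext (fun i => ?_) (by simp [atLeft, vert])
        fin_cases i <;> simp [atLeft, vert]
      simp [this])
    (fun c x y => by
      have : (atLeft (c • x) : Coch K ∅ V) = c • atLeft x := by
        refine coch_ext (fun i => ?_) (by simp [atLeft, vert])
        fin_cases i <;> simp [atLeft, vert]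
      simp [this])
    (fun x y y' => by
      have : (arrow K (y + y') : Coch K ∅ V) = arrow K y + arrow K y' := by simp [arrow]
      simp [this])
    (fun c x y => by
      have : (arrow K (c • y) : Coch K ∅ V) = c • arrow K y := by simp [arrow]
      simp [this])
  map_add' e e' := by ext; simp
  map_smul' c e := by ext; simp

theorem left_apply (A : AssBullet O V) (e : O.E) (x y : V) :
    A.left e x y = (A.op e (atLeft x) (arrow K y)).2 := rfl

theorem op_atLeft_arrow (A : AssBullet O V) (e : O.E) (x y : V) :
    A.op e (atLeft x) (arrow K y) = arrow K (A.left e x y) :=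
  Prod.ext (A.isCochAlg.op_one_right e _ _ rfl) rfl

theorem op_swap (A : AssBullet O V) (e : O.E) (a b : Coch K ∅ V) :
    A.op e a b = A.op (O.τ e) b a := (A.isCochAlg.symm e b a).symm

theorem op_arrow_atLeft (A : AssBullet O V) (e : O.E) (x y : V) :
    A.op e (arrow K x) (atLeft y) = arrow K (A.left (O.τ e) y x) := by
  rw [op_swap, op_atLeft_arrow]

theorem cochD_atLeft (x : V) : cochD K ∅ V (atLeft x) = -arrow K x := by
  refine coch_ext (fun i => ?_) ?_ <;> simp [cochD, atLeft, vert, arrow]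

theorem cochD_atRight (x : V) : cochD K ∅ V (atRight x) = arrow K x := by
  refine coch_ext (fun i => ?_) ?_ <;> simp [cochD, atRight, vert, arrow]

/-- The product lies in the ideal of cochains vanishing at the left vertex and in the one for the
right vertex, and it has degree 0. -/
theorem op_atLeft_atRight (A : AssBullet O V) (e : O.E) (x y : V) :
    A.op e (atLeft x) (atRight y) = 0 := by
  refine coch_ext (fun i => ?_) (A.isCochAlg.op_zero_zero e _ _ rfl rfl)
  have h0 := (A.isLocal {0}).right_mem e (atLeft x) (atRight y)
    (by rintro i rfl; simp [atRight, vert]) 0 rfl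
  have h1 := (A.isLocal {1}).left_mem e (atLeft x)
    (by rintro i rfl; simp [atLeft, vert]) (atRight y) 1 rfl
  fin_cases i
  · exact h0
  · exact h1

theorem op_atRight_atLeft (A : AssBullet O V) (e : O.E) (x y : V) :
    A.op e (atRight x) (atLeft y) = 0 := by
  rw [op_swap, op_atLeft_atRight]

/-- Leibniz applied to the zero product of a left and a right vertex cochain: the two boundary terms
must cancel, so an arrow meets the right vertex exactly as a left vertex meets an arrow. -/
theorem op_arrow_atRight (A : AssBullet O V) (e : O.E) (x y : V) :
    A.op e (arrow K x) (atRight y) = arrow K (A.left e x y) := by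
  have h := A.isCochAlg.leibniz e (atLeft x) (atRight y)
  rw [op_atLeft_atRight, map_zero, cochD_atLeft, cochD_atRight, op_atLeft_arrow, map_neg,
    LinearMap.neg_apply, eq_comm, neg_add_eq_zero] at h
  exact h

theorem op_atRight_arrow (A : AssBullet O V) (e : O.E) (x y : V) :
    A.op e (atRight x) (arrow K y) = arrow K (A.left (O.τ e) y x) := by
  rw [op_swap, op_arrow_atRight]

/-- Locality makes the product vanish at the right vertex. Its value at the left vertex is then
minus its differential, which Leibniz computes. -/
theorem op_atLeft_atLeft (A : AssBullet O V) (e : O.E) (x y : V) :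
    A.op e (atLeft x) (atLeft y) = atLeft (A.left e x y + A.left (O.τ e) y x) := by
  have h1 := (A.isLocal {1}).left_mem e (atLeft x)
    (by rintro i rfl; simp [atLeft, vert]) (atLeft y) 1 rfl
  have h := congrArg Prod.snd (A.isCochAlg.leibniz e (atLeft x) (atLeft y))
  rw [cochD_atLeft, cochD_atLeft, map_neg, map_neg, LinearMap.neg_apply, op_atLeft_arrow,
    op_arrow_atLeft] at h
  simp only [cochD, LinearMap.coe_mk, AddHom.coe_mk, h1, arrow, Prod.snd_add, Prod.snd_neg] at h
  refine coch_ext (fun i => ?_) (A.isCochAlg.op_zero_zero e _ _ rfl rfl)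
  fin_cases i
  · simp only [atLeft, vert]
    simp only [atLeft, vert] at h
    simp
    rw [← neg_inj, ← zero_sub, h]
    abel
  · simpa [atLeft, vert] using h1

theorem op_atRight_atRight (A : AssBullet O V) (e : O.E) (x y : V) :
    A.op e (atRight x) (atRight y) = atRight (A.left e x y + A.left (O.τ e) y x) := by
  have h1 := (A.isLocal {0}).left_mem e (atRight x)
    (by rintro i rfl; simp [atRight, vert]) (atRight y) 0 rfl
  have h := congrArg Prod.snd (A.isCochAlg.leibniz e (atRight x) (atRight y))
  rw [cochD_atRight, cochD_atRight, op_atRight_arrow, op_arrow_atRight] at h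
  simp only [cochD, LinearMap.coe_mk, AddHom.coe_mk, h1, arrow, Prod.snd_add, sub_zero] at h
  refine coch_ext (fun i => ?_) (A.isCochAlg.op_zero_zero e _ _ rfl rfl)
  fin_cases i
  · simpa [atRight, vert] using h1
  · simpa [atRight, vert] using h

theorem coch_eq_atLeft_add (a : Coch K ∅ V) :
    a = atLeft (a.1.1 0) + atRight (a.1.1 1) + arrow K a.2 := by
  refine coch_ext (fun i => ?_) ?_
  · fin_cases i <;> simp [atLeft, atRight, arrow, vert]
  · simp [atLeft, atRight, arrow, vert]

/-- This makes `A.left` a complete invariant: cochains are sums of two vertex cochains and an arrow,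
and all nine kinds of products are known. -/
theorem op_eq (A : AssBullet O V) : A.op = localOp O.τ A.left := by
  refine LinearMap.ext fun e => LinearMap.ext₂ fun a b => ?_
  rw [coch_eq_atLeft_add a, coch_eq_atLeft_add b]
  have h : A.op e (arrow K a.2) (arrow K b.2) = 0 := A.isCochAlg.op_one_one e _ _ rfl rfl
  simp only [map_add, LinearMap.add_apply, op_atLeft_arrow, op_arrow_atLeft, op_atLeft_atRight,
    op_atRight_atLeft, op_arrow_atRight, op_atRight_arrow, op_atLeft_atLeft, op_atRight_atRight, h]
  refine coch_ext (fun i => ?_) ?_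
  · fin_cases i <;> simp [atLeft, atRight, arrow, vert, localOp_apply, localMul_fst]
  · simp [atLeft, atRight, arrow, vert, localOp_apply, localMul_snd]

theorem left_ofLeft (L : O.E →ₗ[K] V →ₗ[K] V →ₗ[K] V)
    (hL : ∀ r ∈ O.R, ∀ v, evalQ (localOp O.τ L) r v = 0) : (ofLeft L hL).left = L := by
  ext e x y
  simp [left_apply, ofLeft, localOp_apply, localMul_snd, atLeft, vert, arrow]

theorem ext_left {A B : AssBullet O V} (h : A.left = B.left) : A = B :=
  AssBullet.ext (by rw [op_eq, op_eq, h])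

theorem rel_left (A : AssBullet O V) : ∀ r ∈ O.R, ∀ v, evalQ (localOp O.τ A.left) r v = 0 := by
  rw [← op_eq]
  exact A.isCochAlg.rel

/-- This turns triviality of the associated structure into an antisymmetry condition relating
`A.left` at an operation and at its opposite. -/
theorem assoc_eq (A : AssBullet O V) (e : O.E) (x y : V) :
    A.assoc e x y = A.left e x y + A.left (O.τ e) y x := by
  rw [assoc, op_atRight_atRight]
  simp [atRight, vert]

end AssBullet

/-- Triples with one arrow and two adjacent cochains at different vertices have one bracketing equal
to 0, which forces the mixed products to vanish. Two cochains at the same vertex followed by an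
arrow give the associativities. Conversely these six identities kill or match every term. -/
theorem localMul_assoc_iff (L R : V →ₗ[K] V →ₗ[K] V) :
    (∀ a b c, localMul L R (localMul L R a b) c = localMul L R a (localMul L R b c)) ↔
      (∀ x y z, L (L x y) z = L x (L y z)) ∧ (∀ x y z, R (R x y) z = R x (R y z)) ∧
      (∀ x y z, L (R x y) z = 0) ∧ (∀ x y z, L x (R y z) = 0) ∧
      (∀ x y z, R (L x y) z = 0) ∧ ∀ x y z, R x (L y z) = 0 := by
  constructor
  · intro h
    have h1 : ∀ x y z, L x (R y z) = 0 := fun x y z => by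
      simpa [localMul_snd, localMul_fst, atLeft, atRight, vert, arrow] using
        (congrArg Prod.snd (h (atLeft x) (atRight y) (arrow K z))).symm
    have h2 : ∀ x y z, R x (L y z) = 0 := fun x y z => by
      simpa [localMul_snd, localMul_fst, atLeft, atRight, vert, arrow] using
        (congrArg Prod.snd (h (atRight x) (atLeft y) (arrow K z))).symm
    have h3 : ∀ x y z, L (R x y) z = 0 := fun x y z => by
      simpa [localMul_snd, localMul_fst, atLeft, atRight, vert, arrow] using
        congrArg Prod.snd (h (arrow K x) (atLeft y) (atRight z))
    have h4 : ∀ x y z, R (L x y) z = 0 := fun x y z => by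
      simpa [localMul_snd, localMul_fst, atLeft, atRight, vert, arrow] using
        congrArg Prod.snd (h (arrow K x) (atRight y) (atLeft z))
    -- Vertex cochains multiply by `L + R`, so the mixed identities are needed to discard the extra
    -- term.
    refine ⟨fun x y z => ?_, fun x y z => ?_, h3, h1, h4, h2⟩
    · simpa [localMul_snd, localMul_fst, atLeft, atRight, vert, arrow, h3] using
        congrArg Prod.snd (h (atLeft x) (atLeft y) (arrow K z))
    · simpa [localMul_snd, localMul_fst, atLeft, atRight, vert, arrow, h4] using
        congrArg Prod.snd (h (atRight x) (atRight y) (arrow K z))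
  · rintro ⟨h1, h2, h3, h4, h5, h6⟩ a b c
    refine coch_ext (fun i => ?_) ?_
    · simp [localMul_fst, h1, h2, h3, h4, h5, h6]
    · simp only [localMul_snd, localMul_fst, map_add, LinearMap.add_apply, h1, h2, h3, h4, h5, h6]
      abel

end Local

/-! ### Structures on cochains relative to the left vertex -/

section Right

variable {K : Type u} [Field K] {V : Type v} [AddCommGroup V] [Module K V]

theorem coch_zero_left (a : Coch K {0} V) : a.1.1 0 = 0 := a.1.2 0 rfl

/-- The product of cochains relative to the left vertex in which arrows and vertices are multiplied
by `P` (arrow on the left) and by `S` (arrow on the right). -/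
def rightMul (P S : V →ₗ[K] V →ₗ[K] V) : Coch K {0} V →ₗ[K] Coch K {0} V →ₗ[K] Coch K {0} V :=
  LinearMap.mk₂ K
    (fun a b => (⟨fun i => P (a.1.1 i) (b.1.1 i) + S (a.1.1 i) (b.1.1 i), by
        rintro i rfl; simp [coch_zero_left]⟩,
      P a.2 (b.1.1 1) + S (a.1.1 1) b.2))
    (fun a a' b => by ext <;> simp <;> abel)
    (fun c a b => by ext <;> simp [smul_add])
    (fun a b b' => by ext <;> simp <;> abel)
    (fun c a b => by ext <;> simp [smul_add])

theorem rightMul_fst (P S : V →ₗ[K] V →ₗ[K] V) (a b : Coch K {0} V) (i : Fin 2) :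
    (rightMul P S a b).1.1 i = P (a.1.1 i) (b.1.1 i) + S (a.1.1 i) (b.1.1 i) := rfl

theorem rightMul_snd (P S : V →ₗ[K] V →ₗ[K] V) (a b : Coch K {0} V) :
    (rightMul P S a b).2 = P a.2 (b.1.1 1) + S (a.1.1 1) b.2 := rfl

/-- The operations on relative cochains determined by their values on pairs of an arrow and a
cochain at the right vertex. -/
def rightOp {E : Type w} [AddCommGroup E] [Module K E] (τ : E →ₗ[K] E)
    (P : E →ₗ[K] V →ₗ[K] V →ₗ[K] V) :
    E →ₗ[K] Coch K {0} V →ₗ[K] Coch K {0} V →ₗ[K] Coch K {0} V where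
  toFun e := rightMul (P e) (P (τ e)).flip
  map_add' e e' := by
    refine LinearMap.ext₂ fun a b => coch_ext (fun i => ?_) ?_
    · simp [rightMul_fst]
      abel
    · simp [rightMul_snd]
      abel
  map_smul' c e := by
    refine LinearMap.ext₂ fun a b => coch_ext (fun i => ?_) ?_
    · simp [rightMul_fst]
    · simp [rightMul_snd]

theorem rightOp_apply {E : Type w} [AddCommGroup E] [Module K E] (τ : E →ₗ[K] E)
    (P : E →ₗ[K] V →ₗ[K] V →ₗ[K] V) (e : E) : rightOp τ P e = rightMul (P e) (P (τ e)).flip := rfl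

theorem rightOp_symm {E : Type w} [AddCommGroup E] [Module K E] {τ : E →ₗ[K] E}
    (hτ : ∀ e, τ (τ e) = e) (P : E →ₗ[K] V →ₗ[K] V →ₗ[K] V) (e : E) (a b : Coch K {0} V) :
    rightOp τ P (τ e) a b = rightOp τ P e b a := by
  refine coch_ext (fun i => ?_) ?_
  · simp [rightOp_apply, rightMul_fst, hτ, add_comm]
  · simp only [rightOp_apply, rightMul_snd, hτ, LinearMap.flip_apply]
    abel

variable {O : BQ K}

namespace PreLieBullet

/-- Operations on relative cochains determined by products of an arrow and a cochain at the right
vertex, when they satisfy the relations. -/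
def ofRight (P : O.E →ₗ[K] V →ₗ[K] V →ₗ[K] V)
    (hP : ∀ r ∈ O.R, ∀ v, evalQ (rightOp O.τ P) r v = 0) : PreLieBullet O V where
  op := rightOp O.τ P
  isDGAlg := isDGAlg_coch_iff.2
    { op_zero_zero := fun e a b ha hb => by simp [rightOp_apply, rightMul_snd, ha, hb]
      op_one_left := fun e a b ha => by
        ext i
        simp [rightOp_apply, rightMul_fst, ha]
      op_one_right := fun e a b hb => by
        ext i
        simp [rightOp_apply, rightMul_fst, hb]
      op_one_one := fun e a b ha hb => coch_ext
        (fun i => by simp [rightOp_apply, rightMul_fst, ha, hb])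
        (by simp [rightOp_apply, rightMul_snd, ha, hb])
      leibniz := fun e a b => coch_ext (fun i => by simp [rightOp_apply, rightMul_fst, cochD])
        (by simp [rightOp_apply, rightMul_snd, rightMul_fst, cochD, coch_zero_left])
      symm := rightOp_symm O.τ_τ P
      rel := hP }

theorem isCochAlg (A : PreLieBullet O V) : IsCochAlg O A.op := isDGAlg_coch_iff.1 A.isDGAlg

/-- The products of an arrow and a cochain at the right vertex. -/
def right (A : PreLieBullet O V) : O.E →ₗ[K] V →ₗ[K] V →ₗ[K] V where
  toFun e := LinearMap.mk₂ K (fun x y => (A.op e (arrow K x) (relRight y)).2)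
    (fun x x' y => by
      have : (arrow K (x + x') : Coch K {0} V) = arrow K x + arrow K x' := by simp [arrow]
      simp [this])
    (fun c x y => by
      have : (arrow K (c • x) : Coch K {0} V) = c • arrow K x := by simp [arrow]
      simp [this])
    (fun x y y' => by
      have : (relRight (y + y') : Coch K {0} V) = relRight y + relRight y' := by
        refine coch_ext (fun i => ?_) (by simp [relRight, vert])
        fin_cases i <;> simp [relRight, vert]
      simp [this])
    (fun c x y => by
      have : (relRight (c • y) : Coch K {0} V) = c • relRight y := by
        refine coch_ext (fun i => ?_) (by simp [relRight, vert])
        fin_cases i <;> simp [relRight, vert]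
      simp [this])
  map_add' e e' := by ext; simp
  map_smul' c e := by ext; simp

theorem right_apply (A : PreLieBullet O V) (e : O.E) (x y : V) :
    A.right e x y = (A.op e (arrow K x) (relRight y)).2 := rfl

theorem op_arrow_relRight (A : PreLieBullet O V) (e : O.E) (x y : V) :
    A.op e (arrow K x) (relRight y) = arrow K (A.right e x y) :=
  Prod.ext (A.isCochAlg.op_one_left e _ _ rfl) rfl

theorem op_relRight_arrow (A : PreLieBullet O V) (e : O.E) (x y : V) :
    A.op e (relRight x) (arrow K y) = arrow K (A.right (O.τ e) y x) := by
  rw [← op_arrow_relRight, A.isCochAlg.symm]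

theorem cochD_relRight (x : V) : cochD K {0} V (relRight x) = arrow K x := by
  refine coch_ext (fun i => ?_) ?_ <;> simp [cochD, relRight, vert, arrow]

/-- Relative to the left vertex, d maps 0-cochains bijectively onto arrows, so Leibniz alone
determines this product and no locality condition is needed. -/
theorem op_relRight_relRight (A : PreLieBullet O V) (e : O.E) (x y : V) :
    A.op e (relRight x) (relRight y) = relRight (A.right e x y + A.right (O.τ e) y x) := by
  have h := congrArg Prod.snd (A.isCochAlg.leibniz e (relRight x) (relRight y))
  rw [cochD_relRight, cochD_relRight, op_relRight_arrow, op_arrow_relRight] at h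
  simp only [cochD, LinearMap.coe_mk, AddHom.coe_mk, coch_zero_left, arrow, Prod.snd_add,
    sub_zero] at h
  refine coch_ext (fun i => ?_) (A.isCochAlg.op_zero_zero e _ _ rfl rfl)
  fin_cases i
  · exact (coch_zero_left _).trans (coch_zero_left _).symm
  · simpa [relRight, vert] using h

theorem coch_eq_relRight_add (a : Coch K {0} V) : a = relRight (a.1.1 1) + arrow K a.2 := by
  refine coch_ext (fun i => ?_) ?_
  · fin_cases i
    · exact (coch_zero_left _).trans (coch_zero_left _).symm
    · simp [relRight, arrow, vert]
  · simp [relRight, arrow, vert]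

theorem op_eq (A : PreLieBullet O V) : A.op = rightOp O.τ A.right := by
  refine LinearMap.ext fun e => LinearMap.ext₂ fun a b => ?_
  rw [coch_eq_relRight_add a, coch_eq_relRight_add b]
  have h : A.op e (arrow K a.2) (arrow K b.2) = 0 := A.isCochAlg.op_one_one e _ _ rfl rfl
  simp only [map_add, LinearMap.add_apply, op_arrow_relRight, op_relRight_arrow,
    op_relRight_relRight, h]
  refine coch_ext (fun i => ?_) ?_
  · fin_cases i <;> simp [relRight, arrow, vert, rightOp_apply, rightMul_fst]
  · simp [relRight, arrow, vert, rightOp_apply, rightMul_snd]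

theorem right_ofRight (P : O.E →ₗ[K] V →ₗ[K] V →ₗ[K] V)
    (hP : ∀ r ∈ O.R, ∀ v, evalQ (rightOp O.τ P) r v = 0) : (ofRight P hP).right = P := by
  ext e x y
  simp [right_apply, ofRight, rightOp_apply, rightMul_snd, relRight, vert, arrow]

theorem ext_right {A B : PreLieBullet O V} (h : A.right = B.right) : A = B :=
  PreLieBullet.ext (by rw [op_eq, op_eq, h])

theorem rel_right (A : PreLieBullet O V) :
    ∀ r ∈ O.R, ∀ v, evalQ (rightOp O.τ A.right) r v = 0 := by
  rw [← op_eq]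
  exact A.isCochAlg.rel

end PreLieBullet

/-- The three identities correspond to the arrow being the first, second or third factor. On vertex
cochains the product is `P + S`, whose associativity is their sum. -/
theorem rightMul_assoc_iff (P S : V →ₗ[K] V →ₗ[K] V) :
    (∀ a b c, rightMul P S (rightMul P S a b) c = rightMul P S a (rightMul P S b c)) ↔
      (∀ x y z, P (P x y) z = P x (P y z) + P x (S y z)) ∧
      (∀ x y z, P (S x y) z = S x (P y z)) ∧
      ∀ x y z, S (P x y) z + S (S x y) z = S x (S y z) := by
  constructor
  · intro h
    refine ⟨fun x y z => ?_, fun x y z => ?_, fun x y z => ?_⟩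
    · simpa [rightMul_snd, rightMul_fst, relRight, vert, arrow] using
        congrArg Prod.snd (h (arrow K x) (relRight y) (relRight z))
    · simpa [rightMul_snd, rightMul_fst, relRight, vert, arrow] using
        congrArg Prod.snd (h (relRight x) (arrow K y) (relRight z))
    · simpa [rightMul_snd, rightMul_fst, relRight, vert, arrow] using
        congrArg Prod.snd (h (relRight x) (relRight y) (arrow K z))
  · rintro ⟨h1, h2, h3⟩ a b c
    refine coch_ext (fun i => ?_) ?_
    · simp only [rightMul_fst, map_add, LinearMap.add_apply]
      linear_combination (norm := module) h1 (a.1.1 i) (b.1.1 i) (c.1.1 i) +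
        h2 (a.1.1 i) (b.1.1 i) (c.1.1 i) + h3 (a.1.1 i) (b.1.1 i) (c.1.1 i)
    · simp only [rightMul_snd, rightMul_fst, map_add, LinearMap.add_apply]
      linear_combination (norm := module) h1 a.2 (b.1.1 1) (c.1.1 1) +
        h2 (a.1.1 1) b.2 (c.1.1 1) + h3 (a.1.1 1) (b.1.1 1) c.2

end Right

/-! ### Algebra structures from bilinear products, and the bijections -/

section Structures

variable {K : Type u} [Field K] {V : Type v} [AddCommGroup V] [Module K V]

/-- The linear family of binary operations with given values at the operation without symmetry and
at its opposite. -/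
def pairOp (B C : V →ₗ[K] V →ₗ[K] V) : K × K →ₗ[K] V →ₗ[K] V →ₗ[K] V :=
  (LinearMap.toSpanSingleton K _ B).coprod (LinearMap.toSpanSingleton K _ C)

theorem pairOp_apply (B C : V →ₗ[K] V →ₗ[K] V) (e : K × K) :
    pairOp B C e = e.1 • B + e.2 • C := by
  simp [pairOp]

theorem pairOp_gen (B C : V →ₗ[K] V →ₗ[K] V) : pairOp B C (gen K) = B := by
  simp [pairOp_apply, gen]

theorem pairOp_opp_gen (B C : V →ₗ[K] V →ₗ[K] V) : pairOp B C (opp K (gen K)) = C := by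
  simp [pairOp_apply, gen, opp]

theorem pairOp_symm (B : V →ₗ[K] V →ₗ[K] V) (e : K × K) (x y : V) :
    pairOp B B.flip (opp K e) x y = pairOp B B.flip e y x := by
  simp [pairOp_apply, opp, add_comm]

theorem eq_pairOp {W : Type*} [AddCommGroup W] [Module K W] {f g : K × K →ₗ[K] W}
    (h : f (gen K) = g (gen K)) (h' : f (opp K (gen K)) = g (opp K (gen K))) : f = g := by
  refine LinearMap.ext fun e => ?_
  rw [eq_gen_add_opp_gen K e]
  simp only [map_add, map_smul, h, h']

/-- The linear family of binary operations with a given value at `1`. -/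
def singleOp (B : V →ₗ[K] V →ₗ[K] V) : K →ₗ[K] V →ₗ[K] V →ₗ[K] V :=
  LinearMap.toSpanSingleton K _ B

theorem singleOp_apply (B : V →ₗ[K] V →ₗ[K] V) (c : K) : singleOp B c = c • B := rfl

theorem singleOp_one (B : V →ₗ[K] V →ₗ[K] V) : singleOp B 1 = B := one_smul _ _

/-- Two step nilpotent associative products. -/
def nilAssOf (B : V →ₗ[K] V →ₗ[K] V) (h1 : ∀ x y z, B (B x y) z = 0)
    (h2 : ∀ x y z, B x (B y z) = 0) : (nilAss K).Alg V where
  op := pairOp B B.flip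
  symm := pairOp_symm B
  rel := (nilAss_rel_iff (pairOp_symm B)).2 (by simpa [pairOp_gen] using ⟨h1, h2⟩)

theorem nilAssOf_op_gen (B : V →ₗ[K] V →ₗ[K] V) (h1 h2) :
    (nilAssOf B h1 h2).op (gen K) = B := pairOp_gen _ _

theorem nilAss_ext {A A' : (nilAss K).Alg V} (h : A.op (gen K) = A'.op (gen K)) : A = A' := by
  refine BQ.Alg.ext (eq_pairOp h (LinearMap.ext₂ fun x y => ?_))
  rw [A.symm (gen K) x y, A'.symm (gen K) x y, h]

/-- Zinbiel products. -/
def zinbOf (B : V →ₗ[K] V →ₗ[K] V) (h : ∀ x y z, B (B x y) z = B x (B y z) + B x (B z y)) :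
    (Zinb K).Alg V where
  op := pairOp B B.flip
  symm := pairOp_symm B
  rel := (zinb_rel_iff (pairOp_symm B)).2 (by simpa [pairOp_gen] using h)

theorem zinbOf_op_gen (B : V →ₗ[K] V →ₗ[K] V) (h) :
    (zinbOf B h).op (gen K) = B := pairOp_gen _ _

theorem zinb_ext {A A' : (Zinb K).Alg V} (h : A.op (gen K) = A'.op (gen K)) : A = A' := by
  refine BQ.Alg.ext (eq_pairOp h (LinearMap.ext₂ fun x y => ?_))
  rw [A.symm (gen K) x y, A'.symm (gen K) x y, h]

/-- Two step nilpotent Lie brackets. -/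
def nilLieOf (B : V →ₗ[K] V →ₗ[K] V) (h1 : ∀ x y, B y x = -B x y)
    (h2 : ∀ x y z, B (B x y) z = 0) : (nilLie K).Alg V where
  op := singleOp B
  symm e x y := by simp [singleOp_apply, h1 x y]
  rel := (nilLie_rel_iff fun e x y => by simp [singleOp_apply, h1 x y]).2
    (by simpa [singleOp_one] using h2)

theorem nilLieOf_op_one (B : V →ₗ[K] V →ₗ[K] V) (h1 h2) :
    (nilLieOf B h1 h2).op (1 : K) = B := singleOp_one _

theorem nilLie_ext {A A' : (nilLie K).Alg V} (h : A.op (1 : K) = A'.op (1 : K)) : A = A' :=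
  BQ.Alg.ext (LinearMap.ext_ring h)

theorem coprod_pairOp_symm (B C : V →ₗ[K] V →ₗ[K] V) (e : (K × K) × (K × K)) (x y : V) :
    (pairOp B B.flip).coprod (pairOp C C.flip) (LinearMap.prodMap (opp K) (opp K) e) x y =
      (pairOp B B.flip).coprod (pairOp C C.flip) e y x := by
  simp [pairOp_symm]

/-- Dendriform products. -/
def dendOf (B C : V →ₗ[K] V →ₗ[K] V) (h1 : ∀ x y z, B (B x y) z = B x (B y z) + B x (C y z))
    (h2 : ∀ x y z, B (C x y) z = C x (B y z))
    (h3 : ∀ x y z, C (B x y) z + C (C x y) z = C x (C y z)) : (Dend K).Alg V where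
  op := (pairOp B B.flip).coprod (pairOp C C.flip)
  symm := coprod_pairOp_symm B C
  rel := (dend_rel_iff (coprod_pairOp_symm B C)).2
    (by simpa [pairOp_gen, dprec, dsucc] using ⟨h1, h2, h3⟩)

theorem dendOf_op_dprec (B C : V →ₗ[K] V →ₗ[K] V) (h1 h2 h3) :
    (dendOf B C h1 h2 h3).op (dprec K) = B := by
  simp [dendOf, dprec, pairOp_gen]

theorem dendOf_op_dsucc (B C : V →ₗ[K] V →ₗ[K] V) (h1 h2 h3) :
    (dendOf B C h1 h2 h3).op (dsucc K) = C := by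
  simp [dendOf, dsucc, pairOp_gen]

theorem dend_ext {A A' : (Dend K).Alg V} (h : A.op (dprec K) = A'.op (dprec K))
    (h' : A.op (dsucc K) = A'.op (dsucc K)) : A = A' := by
  refine BQ.Alg.ext (LinearMap.prod_ext (eq_pairOp h (LinearMap.ext₂ fun x y => ?_))
    (eq_pairOp h' (LinearMap.ext₂ fun x y => ?_)))
  · exact (A.symm (dprec K) x y).trans (by rw [h]; exact (A'.symm (dprec K) x y).symm)
  · exact (A.symm (dsucc K) x y).trans (by rw [h']; exact (A'.symm (dsucc K) x y).symm)

/-- Pairs of associative products whose mixed triple products vanish. -/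
def assProdOf (B C : V →ₗ[K] V →ₗ[K] V) (h1 : ∀ x y z, B (B x y) z = B x (B y z))
    (h2 : ∀ x y z, C (C x y) z = C x (C y z)) (h3 : ∀ x y z, B (C x y) z = 0)
    (h4 : ∀ x y z, B x (C y z) = 0) (h5 : ∀ x y z, C (B x y) z = 0)
    (h6 : ∀ x y z, C x (B y z) = 0) : ((Ass K).prod (Ass K)).Alg V where
  op := (pairOp B B.flip).coprod (pairOp C C.flip)
  symm := coprod_pairOp_symm B C
  rel := (assProd_rel_iff (coprod_pairOp_symm B C)).2 (by
    refine ⟨by simpa [pairOp_gen] using h1, by simpa [pairOp_gen] using h2, ?_, ?_⟩ <;>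
    simp [pairOp_apply, h3, h4, h5, h6])

theorem assProdOf_op_left (B C : V →ₗ[K] V →ₗ[K] V) (h1 h2 h3 h4 h5 h6) :
    (assProdOf B C h1 h2 h3 h4 h5 h6).op (gen K, 0) = B := by
  simp [assProdOf, pairOp_gen]

theorem assProdOf_op_right (B C : V →ₗ[K] V →ₗ[K] V) (h1 h2 h3 h4 h5 h6) :
    (assProdOf B C h1 h2 h3 h4 h5 h6).op (0, gen K) = C := by
  simp [assProdOf, pairOp_gen]

theorem assProd_ext {A A' : ((Ass K).prod (Ass K)).Alg V}
    (h : A.op (gen K, 0) = A'.op (gen K, 0)) (h' : A.op (0, gen K) = A'.op (0, gen K)) :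
    A = A' := by
  have hl : ∀ (A : ((Ass K).prod (Ass K)).Alg V) x y,
      A.op (opp K (gen K), 0) x y = A.op (gen K, 0) y x := fun A x y => by
    simpa using A.symm (gen K, 0) x y
  have hr : ∀ (A : ((Ass K).prod (Ass K)).Alg V) x y,
      A.op (0, opp K (gen K)) x y = A.op (0, gen K) y x := fun A x y => by
    simpa using A.symm (0, gen K) x y
  refine BQ.Alg.ext (LinearMap.prod_ext (eq_pairOp h (LinearMap.ext₂ fun x y => ?_))
    (eq_pairOp h' (LinearMap.ext₂ fun x y => ?_)))
  · exact (hl A x y).trans (by rw [h]; exact (hl A' x y).symm)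
  · exact (hr A x y).trans (by rw [h']; exact (hr A' x y).symm)

/-! ## Relations of local structures -/

theorem localOp_ass_rel_iff (L : K × K →ₗ[K] V →ₗ[K] V →ₗ[K] V) :
    (∀ r ∈ (Ass K).R, ∀ v, evalQ (localOp (opp K) L) r v = 0) ↔
      ∀ a b c, localMul (L (gen K)) (L (opp K (gen K))).flip
          (localMul (L (gen K)) (L (opp K (gen K))).flip a b) c =
        localMul (L (gen K)) (L (opp K (gen K))).flip a
          (localMul (L (gen K)) (L (opp K (gen K))).flip b c) :=
  ass_rel_iff (localOp_symm (opp_opp K) L)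

theorem localOp_com_rel_iff (L : K →ₗ[K] V →ₗ[K] V →ₗ[K] V) :
    (∀ r ∈ (Com K).R, ∀ v, evalQ (localOp LinearMap.id L) r v = 0) ↔
      ∀ a b c, localMul (L 1) (L 1).flip (localMul (L 1) (L 1).flip a b) c =
        localMul (L 1) (L 1).flip a (localMul (L 1) (L 1).flip b c) :=
  com_rel_iff (localOp_symm (τ := LinearMap.id) (fun _ => rfl) L)

theorem rightOp_ass_rel_iff (P : K × K →ₗ[K] V →ₗ[K] V →ₗ[K] V) :
    (∀ r ∈ (Ass K).R, ∀ v, evalQ (rightOp (opp K) P) r v = 0) ↔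
      ∀ a b c, rightMul (P (gen K)) (P (opp K (gen K))).flip
          (rightMul (P (gen K)) (P (opp K (gen K))).flip a b) c =
        rightMul (P (gen K)) (P (opp K (gen K))).flip a
          (rightMul (P (gen K)) (P (opp K (gen K))).flip b c) :=
  ass_rel_iff (rightOp_symm (opp_opp K) P)

theorem rightOp_com_rel_iff (P : K →ₗ[K] V →ₗ[K] V →ₗ[K] V) :
    (∀ r ∈ (Com K).R, ∀ v, evalQ (rightOp LinearMap.id P) r v = 0) ↔
      ∀ a b c, rightMul (P 1) (P 1).flip (rightMul (P 1) (P 1).flip a b) c =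
        rightMul (P 1) (P 1).flip a (rightMul (P 1) (P 1).flip b c) :=
  com_rel_iff (rightOp_symm (τ := LinearMap.id) (fun _ => rfl) P)

/-! ## The bijections -/

/-! ### Local associative structures as pairs of associative products -/

section AssAss

variable (A : AssBullet (Ass K) V) (B : ((Ass K).prod (Ass K)).Alg V)

/-- Here `R` is the flip of `A.left` at the opposite operation. The second product of the pair is
`-R` flipped: reversing and negating a product preserve associativity and the vanishing of mixed
products. -/
theorem AssBullet.left_rel_ass :
    (∀ x y z, A.left (gen K) (A.left (gen K) x y) z = A.left (gen K) x (A.left (gen K) y z)) ∧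
    (∀ x y z, A.left (opp K (gen K)) z (A.left (opp K (gen K)) y x) =
      A.left (opp K (gen K)) (A.left (opp K (gen K)) z y) x) ∧
    (∀ x y z, A.left (gen K) (A.left (opp K (gen K)) y x) z = 0) ∧
    (∀ x y z, A.left (gen K) x (A.left (opp K (gen K)) z y) = 0) ∧
    (∀ x y z, A.left (opp K (gen K)) z (A.left (gen K) x y) = 0) ∧
    ∀ x y z, A.left (opp K (gen K)) (A.left (gen K) y z) x = 0 :=
  (localMul_assoc_iff _ _).1 ((localOp_ass_rel_iff A.left).1 A.rel_left)

/-- The pair of products of a local structure over the associative operad. -/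
def AssBullet.toAssProd : ((Ass K).prod (Ass K)).Alg V :=
  assProdOf (A.left (gen K)) (-A.left (opp K (gen K)))
    A.left_rel_ass.1
    (fun x y z => by simpa using (A.left_rel_ass.2.1 z y x).symm)
    (fun x y z => by simpa using A.left_rel_ass.2.2.1 y x z)
    (fun x y z => by simpa using A.left_rel_ass.2.2.2.1 x z y)
    (fun x y z => by simpa using A.left_rel_ass.2.2.2.2.2 z x y)
    (fun x y z => by simpa using A.left_rel_ass.2.2.2.2.1 y z x)

theorem AssBullet.toAssProd_op_left : A.toAssProd.op (gen K, 0) = A.left (gen K) :=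
  assProdOf_op_left _ _ _ _ _ _ _ _

theorem AssBullet.toAssProd_op_right : A.toAssProd.op (0, gen K) = -A.left (opp K (gen K)) :=
  assProdOf_op_right _ _ _ _ _ _ _ _

theorem localOp_assProd_rel : ∀ r ∈ (Ass K).R, ∀ v,
    evalQ (localOp (opp K) (pairOp (B.op (gen K, 0)) (-B.op (0, gen K)))) r v = 0 := by
  obtain ⟨h1, h2, h3, h4⟩ := (assProd_rel_iff B.symm).1 B.rel
  -- A right-nested product is a left-nested one for the opposite outer operation.
  have h5 : ∀ x y z, B.op (gen K, 0) x (B.op (0, gen K) y z) = 0 := by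
    intro x y z
    rw [← B.symm]
    simpa using h3 (opp K (gen K)) (gen K) y z x
  have h6 : ∀ x y z, B.op (0, gen K) x (B.op (gen K, 0) y z) = 0 := by
    intro x y z
    rw [← B.symm]
    simpa using h4 (gen K) (opp K (gen K)) y z x
  refine (localOp_ass_rel_iff _).2 ((localMul_assoc_iff _ _).2 ?_)
  simp only [pairOp_gen, pairOp_opp_gen, LinearMap.flip_apply, LinearMap.neg_apply, map_neg,
    neg_neg, neg_eq_zero]
  exact ⟨h1, fun x y z => (h2 z y x).symm, fun x y z => h3 _ _ _ _ _, fun x y z => h5 _ _ _,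
    fun x y z => h6 _ _ _, fun x y z => h4 _ _ _ _ _⟩

/-- The local structure over the associative operad defined by a pair of products. -/
def AssBullet.ofAssProd : AssBullet (Ass K) V := AssBullet.ofLeft _ (localOp_assProd_rel B)

theorem AssBullet.left_ofAssProd :
    (AssBullet.ofAssProd B).left = pairOp (B.op (gen K, 0)) (-B.op (0, gen K)) :=
  AssBullet.left_ofLeft _ _

theorem AssBullet.ofAssProd_toAssProd : AssBullet.ofAssProd A.toAssProd = A := by
  apply AssBullet.ext_left
  refine (AssBullet.left_ofAssProd _).trans (eq_pairOp ?_ ?_)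
  · exact (pairOp_gen _ _).trans A.toAssProd_op_left
  · rw [pairOp_opp_gen, A.toAssProd_op_right]
    exact neg_neg _

theorem AssBullet.toAssProd_ofAssProd : (AssBullet.ofAssProd B).toAssProd = B := by
  apply assProd_ext
  · rw [AssBullet.toAssProd_op_left, AssBullet.left_ofAssProd, pairOp_gen]
  · rw [AssBullet.toAssProd_op_right, AssBullet.left_ofAssProd, pairOp_opp_gen, neg_neg]

/-- `Ass_•(Ass) = Ass × Ass`. -/
def assBulletAssEquiv : AssBullet (Ass K) V ≃ ((Ass K).prod (Ass K)).Alg V :=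
  ⟨_, _, AssBullet.ofAssProd_toAssProd, AssBullet.toAssProd_ofAssProd⟩

theorem assBullet_ass : ∃ Φ : AssBullet (Ass K) V ≃ ((Ass K).prod (Ass K)).Alg V, ∀ A x y,
    A.op (gen K) (atLeft x) (arrow K y) = arrow K ((Φ A).op (gen K, 0) x y) ∧
    A.op (gen K) (atRight x) (arrow K y) = -arrow K ((Φ A).op (0, gen K) y x) := by
  refine ⟨assBulletAssEquiv, fun A x y => ⟨?_, ?_⟩⟩
  · refine (A.op_atLeft_arrow (gen K) x y).trans ?_
    exact congrArg (arrow K) (LinearMap.congr_fun₂ A.toAssProd_op_left x y).symm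
  · refine (A.op_atRight_arrow (gen K) x y).trans ?_
    have h : A.toAssProd.op (0, gen K) y x = -A.left (opp K (gen K)) y x :=
      LinearMap.congr_fun₂ A.toAssProd_op_right y x
    change _ = -arrow K (A.toAssProd.op (0, gen K) y x)
    rw [h]
    exact Prod.ext neg_zero.symm (neg_neg _).symm

end AssAss

/-! ### Local associative structures with trivial associated product -/

section ComAss

variable (A : ComBullet (Ass K) V) (B : (nilAss K).Alg V)

/-- Here `R = -L`, so the vanishing of mixed products says exactly that the product `L` is two-step
nilpotent on both sides. -/
theorem ComBullet.left_opp_gen (x y : V) :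
    A.1.left (opp K (gen K)) y x = -A.1.left (gen K) x y :=
  eq_neg_of_add_eq_zero_right ((A.1.assoc_eq (gen K) x y).symm.trans (A.2 (gen K) x y))

/-- The nilpotent product of a local structure over the associative operad whose associated product
is trivial. -/
def ComBullet.toNilAss : (nilAss K).Alg V :=
  nilAssOf (A.1.left (gen K))
    (fun x y z => by
      have h := A.1.left_rel_ass.2.2.1 x y z
      rw [A.left_opp_gen, map_neg, LinearMap.neg_apply, neg_eq_zero] at h
      exact h)
    (fun x y z => by
      have h := A.1.left_rel_ass.2.2.2.1 x y z
      rw [A.left_opp_gen, map_neg, neg_eq_zero] at h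
      exact h)

theorem ComBullet.toNilAss_op : A.toNilAss.op (gen K) = A.1.left (gen K) :=
  nilAssOf_op_gen _ _ _

theorem localOp_nilAss_rel : ∀ r ∈ (Ass K).R, ∀ v,
    evalQ (localOp (opp K) (pairOp (B.op (gen K)) (-(B.op (gen K)).flip))) r v = 0 := by
  obtain ⟨h1, h2⟩ := (nilAss_rel_iff B.symm).1 B.rel
  refine (localOp_ass_rel_iff _).2 ((localMul_assoc_iff _ _).2 ?_)
  simp only [pairOp_gen, pairOp_opp_gen, LinearMap.flip_apply, LinearMap.neg_apply, map_neg,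
    neg_neg, neg_eq_zero]
  simp only [h1, h2, implies_true, and_self]

/-- The local structure over the associative operad, with trivial associated product, defined by a
nilpotent product. -/
def ComBullet.ofNilAss : ComBullet (Ass K) V :=
  ⟨AssBullet.ofLeft _ (localOp_nilAss_rel B), fun e x y => by
    refine (AssBullet.assoc_eq _ e x y).trans ?_
    rw [AssBullet.left_ofLeft]
    simp [pairOp_apply, opp]⟩

theorem ComBullet.left_ofNilAss :
    (ComBullet.ofNilAss B).1.left = pairOp (B.op (gen K)) (-(B.op (gen K)).flip) :=
  AssBullet.left_ofLeft _ (localOp_nilAss_rel B)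

theorem ComBullet.ofNilAss_toNilAss : ComBullet.ofNilAss A.toNilAss = A := by
  apply Subtype.ext
  apply AssBullet.ext_left
  refine (ComBullet.left_ofNilAss _).trans (eq_pairOp ?_ ?_)
  · exact (pairOp_gen _ _).trans A.toNilAss_op
  · rw [pairOp_opp_gen, A.toNilAss_op]
    exact LinearMap.ext₂ fun x y => (A.left_opp_gen y x).symm

theorem ComBullet.toNilAss_ofNilAss : (ComBullet.ofNilAss B).toNilAss = B := by
  apply nilAss_ext
  rw [ComBullet.toNilAss_op, ComBullet.left_ofNilAss, pairOp_gen]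

/-- `Com_•(Ass) = nilAss`. -/
def comBulletAssEquiv : ComBullet (Ass K) V ≃ (nilAss K).Alg V :=
  ⟨_, _, ComBullet.ofNilAss_toNilAss, ComBullet.toNilAss_ofNilAss⟩

theorem comBullet_ass : ∃ Φ : ComBullet (Ass K) V ≃ (nilAss K).Alg V, ∀ A x y,
    A.1.op (gen K) (atLeft x) (arrow K y) = arrow K ((Φ A).op (gen K) x y) := by
  refine ⟨comBulletAssEquiv, fun A x y => ?_⟩
  refine (A.1.op_atLeft_arrow (gen K) x y).trans ?_
  exact congrArg (arrow K) (LinearMap.congr_fun₂ A.toNilAss_op x y).symm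

end ComAss

/-! ### Relative associative structures as dendriform products -/

section PreLieAss

variable (A : PreLieBullet (Ass K) V) (B : (Dend K).Alg V)

theorem PreLieBullet.right_rel_ass :
    (∀ x y z, A.right (gen K) (A.right (gen K) x y) z =
      A.right (gen K) x (A.right (gen K) y z) +
        A.right (gen K) x ((A.right (opp K (gen K))).flip y z)) ∧
    (∀ x y z, A.right (gen K) ((A.right (opp K (gen K))).flip x y) z =
      (A.right (opp K (gen K))).flip x (A.right (gen K) y z)) ∧
    ∀ x y z, (A.right (opp K (gen K))).flip (A.right (gen K) x y) z +
        (A.right (opp K (gen K))).flip ((A.right (opp K (gen K))).flip x y) z =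
      (A.right (opp K (gen K))).flip x ((A.right (opp K (gen K))).flip y z) :=
  (rightMul_assoc_iff _ _).1 ((rightOp_ass_rel_iff A.right).1 A.rel_right)

/-- The dendriform products of a relative structure over the associative operad. -/
def PreLieBullet.toDend : (Dend K).Alg V :=
  dendOf (A.right (gen K)) (A.right (opp K (gen K))).flip
    A.right_rel_ass.1 A.right_rel_ass.2.1 A.right_rel_ass.2.2

theorem PreLieBullet.toDend_op_dprec : A.toDend.op (dprec K) = A.right (gen K) :=
  dendOf_op_dprec _ _ A.right_rel_ass.1 A.right_rel_ass.2.1 A.right_rel_ass.2.2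

theorem PreLieBullet.toDend_op_dsucc : A.toDend.op (dsucc K) = (A.right (opp K (gen K))).flip :=
  dendOf_op_dsucc _ _ A.right_rel_ass.1 A.right_rel_ass.2.1 A.right_rel_ass.2.2

theorem rightOp_dend_rel : ∀ r ∈ (Ass K).R, ∀ v,
    evalQ (rightOp (opp K) (pairOp (B.op (dprec K)) (B.op (dsucc K)).flip)) r v = 0 := by
  refine (rightOp_ass_rel_iff _).2 ((rightMul_assoc_iff _ _).2 ?_)
  simp only [pairOp_gen, pairOp_opp_gen, LinearMap.flip_apply]
  exact (dend_rel_iff B.symm).1 B.rel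

/-- The relative structure over the associative operad defined by dendriform products. -/
def PreLieBullet.ofDend : PreLieBullet (Ass K) V := PreLieBullet.ofRight _ (rightOp_dend_rel B)

theorem PreLieBullet.right_ofDend :
    (PreLieBullet.ofDend B).right = pairOp (B.op (dprec K)) (B.op (dsucc K)).flip :=
  PreLieBullet.right_ofRight _ _

theorem PreLieBullet.ofDend_toDend : PreLieBullet.ofDend A.toDend = A := by
  apply PreLieBullet.ext_right
  refine (PreLieBullet.right_ofDend _).trans (eq_pairOp ?_ ?_)
  · exact (pairOp_gen _ _).trans A.toDend_op_dprec
  · rw [pairOp_opp_gen, A.toDend_op_dsucc]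
    rfl

theorem PreLieBullet.toDend_ofDend : (PreLieBullet.ofDend B).toDend = B := by
  apply dend_ext
  · rw [PreLieBullet.toDend_op_dprec, PreLieBullet.right_ofDend, pairOp_gen]
  · rw [PreLieBullet.toDend_op_dsucc, PreLieBullet.right_ofDend, pairOp_opp_gen]
    rfl

/-- `preLie_•(Ass) = Dend`. -/
def preLieBulletAssEquiv : PreLieBullet (Ass K) V ≃ (Dend K).Alg V :=
  ⟨_, _, PreLieBullet.ofDend_toDend, PreLieBullet.toDend_ofDend⟩

theorem preLieBullet_ass : ∃ Φ : PreLieBullet (Ass K) V ≃ (Dend K).Alg V, ∀ A x y,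
    A.op (gen K) (arrow K x) (relRight y) = arrow K ((Φ A).op (dprec K) x y) ∧
    A.op (gen K) (relRight x) (arrow K y) = arrow K ((Φ A).op (dsucc K) x y) := by
  refine ⟨preLieBulletAssEquiv, fun A x y => ⟨?_, ?_⟩⟩
  · refine (A.op_arrow_relRight (gen K) x y).trans ?_
    exact congrArg (arrow K) (LinearMap.congr_fun₂ A.toDend_op_dprec x y).symm
  · refine (A.op_relRight_arrow (gen K) x y).trans ?_
    exact congrArg (arrow K) (LinearMap.congr_fun₂ A.toDend_op_dsucc x y).symm

end PreLieAss

/-! ### Local commutative structures as nilpotent products -/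

section AssCom

variable (A : AssBullet (Com K) V) (B : (nilAss K).Alg V)

/-- Commutativity gives `R = L.flip`, so the mixed identities already make both triple products of
`L` vanish, and the associativities add nothing. -/
theorem AssBullet.left_rel_com :
    (∀ x y z, A.left (1 : K) (A.left (1 : K) y x) z = 0) ∧
    ∀ x y z, A.left (1 : K) x (A.left (1 : K) z y) = 0 :=
  have h := (localMul_assoc_iff _ _).1 ((localOp_com_rel_iff A.left).1 A.rel_left)
  ⟨h.2.2.1, h.2.2.2.1⟩

/-- The nilpotent product of a local structure over the commutative operad. -/
def AssBullet.toNilAss : (nilAss K).Alg V :=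
  nilAssOf (A.left (1 : K)) (fun x y z => A.left_rel_com.1 y x z)
    (fun x y z => A.left_rel_com.2 x z y)

theorem AssBullet.toNilAss_op : A.toNilAss.op (gen K) = A.left (1 : K) := nilAssOf_op_gen _ _ _

theorem localOp_single_nilAss_rel : ∀ r ∈ (Com K).R, ∀ v,
    evalQ (localOp LinearMap.id (singleOp (B.op (gen K)))) r v = 0 := by
  obtain ⟨h1, h2⟩ := (nilAss_rel_iff B.symm).1 B.rel
  refine (localOp_com_rel_iff _).2 ((localMul_assoc_iff _ _).2 ?_)
  simp only [singleOp_one, LinearMap.flip_apply, h1, h2, implies_true, and_self]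

/-- The local structure over the commutative operad defined by a nilpotent product. -/
def AssBullet.ofNilAss : AssBullet (Com K) V := AssBullet.ofLeft _ (localOp_single_nilAss_rel B)

theorem AssBullet.left_ofNilAss :
    (AssBullet.ofNilAss B).left = singleOp (B.op (gen K)) :=
  AssBullet.left_ofLeft _ _

theorem AssBullet.ofNilAss_toNilAss : AssBullet.ofNilAss A.toNilAss = A := by
  apply AssBullet.ext_left
  refine (AssBullet.left_ofNilAss _).trans (LinearMap.ext_ring ?_)
  exact (singleOp_one _).trans A.toNilAss_op

theorem AssBullet.toNilAss_ofNilAss : (AssBullet.ofNilAss B).toNilAss = B := by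
  apply nilAss_ext
  rw [AssBullet.toNilAss_op, AssBullet.left_ofNilAss, singleOp_one]

/-- `Ass_•(Com) = nilAss`. -/
def assBulletComEquiv : AssBullet (Com K) V ≃ (nilAss K).Alg V :=
  ⟨_, _, AssBullet.ofNilAss_toNilAss, AssBullet.toNilAss_ofNilAss⟩

theorem assBullet_com : ∃ Φ : AssBullet (Com K) V ≃ (nilAss K).Alg V, ∀ A x y,
    A.op (1 : K) (atLeft x) (arrow K y) = arrow K ((Φ A).op (gen K) x y) := by
  refine ⟨assBulletComEquiv, fun A x y => ?_⟩
  refine (A.op_atLeft_arrow (1 : K) x y).trans ?_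
  exact congrArg (arrow K) (LinearMap.congr_fun₂ A.toNilAss_op x y).symm

end AssCom

/-! ### Local commutative structures with trivial associated product -/

section ComCom

variable (A : ComBullet (Com K) V) (B : (nilLie K).Alg V)

/-- The generator of Com is its own opposite, so triviality of the associated product is
anti-commutativity of the bracket. -/
theorem ComBullet.left_swap (x y : V) : A.1.left (1 : K) y x = -A.1.left (1 : K) x y :=
  eq_neg_of_add_eq_zero_right ((A.1.assoc_eq (1 : K) x y).symm.trans (A.2 (1 : K) x y))

/-- The nilpotent bracket of a local structure over the commutative operad whose associated product
is trivial. -/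
def ComBullet.toNilLie : (nilLie K).Alg V :=
  nilLieOf (A.1.left (1 : K)) A.left_swap (fun x y z => A.1.left_rel_com.1 y x z)

theorem ComBullet.toNilLie_op : A.toNilLie.op (1 : K) = A.1.left (1 : K) :=
  nilLieOf_op_one _ _ _

theorem nilLie_op_swap (x y : V) : B.op (1 : K) y x = -B.op (1 : K) x y := by
  rw [← B.symm]
  exact (LinearMap.congr_fun₂ (map_neg B.op (1 : K)) x y)

theorem localOp_nilLie_rel : ∀ r ∈ (Com K).R, ∀ v,
    evalQ (localOp LinearMap.id (singleOp (B.op (1 : K)))) r v = 0 := by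
  have h1 : ∀ x y z, B.op (1 : K) (B.op (1 : K) x y) z = 0 := (nilLie_rel_iff B.symm).1 B.rel
  have h2 : ∀ x y z, B.op (1 : K) x (B.op (1 : K) y z) = 0 := fun x y z => by
    rw [nilLie_op_swap, h1, neg_zero]
  refine (localOp_com_rel_iff _).2 ((localMul_assoc_iff _ _).2 ?_)
  simp only [singleOp_one, LinearMap.flip_apply, h1, h2, implies_true, and_self]

/-- The local structure over the commutative operad, with trivial associated product, defined by a
nilpotent bracket. -/
def ComBullet.ofNilLie : ComBullet (Com K) V :=
  ⟨AssBullet.ofLeft _ (localOp_nilLie_rel B), fun e x y => by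
    refine (AssBullet.assoc_eq _ e x y).trans ?_
    rw [AssBullet.left_ofLeft]
    simp [singleOp_apply, nilLie_op_swap B x y]⟩

theorem ComBullet.left_ofNilLie :
    (ComBullet.ofNilLie B).1.left = singleOp (B.op (1 : K)) :=
  AssBullet.left_ofLeft _ (localOp_nilLie_rel B)

theorem ComBullet.ofNilLie_toNilLie : ComBullet.ofNilLie A.toNilLie = A := by
  apply Subtype.ext
  apply AssBullet.ext_left
  refine (ComBullet.left_ofNilLie _).trans (LinearMap.ext_ring ?_)
  exact (singleOp_one _).trans A.toNilLie_op

theorem ComBullet.toNilLie_ofNilLie : (ComBullet.ofNilLie B).toNilLie = B := by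
  apply nilLie_ext
  rw [ComBullet.toNilLie_op, ComBullet.left_ofNilLie, singleOp_one]

/-- `Com_•(Com) = nilLie`. -/
def comBulletComEquiv : ComBullet (Com K) V ≃ (nilLie K).Alg V :=
  ⟨_, _, ComBullet.ofNilLie_toNilLie, ComBullet.toNilLie_ofNilLie⟩

theorem comBullet_com : ∃ Φ : ComBullet (Com K) V ≃ (nilLie K).Alg V, ∀ A x y,
    A.1.op (1 : K) (atLeft x) (arrow K y) = arrow K ((Φ A).op (1 : K) x y) := by
  refine ⟨comBulletComEquiv, fun A x y => ?_⟩
  refine (A.1.op_atLeft_arrow (1 : K) x y).trans ?_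
  exact congrArg (arrow K) (LinearMap.congr_fun₂ A.toNilLie_op x y).symm

end ComCom

/-! ### Relative commutative structures as Zinbiel products -/

section PreLieCom

variable (A : PreLieBullet (Com K) V) (B : (Zinb K).Alg V)

/-- The Zinbiel product of a relative structure over the commutative operad. -/
def PreLieBullet.toZinb : (Zinb K).Alg V :=
  zinbOf (A.right (1 : K))
    ((rightMul_assoc_iff _ _).1 ((rightOp_com_rel_iff A.right).1 A.rel_right)).1

theorem PreLieBullet.toZinb_op : A.toZinb.op (gen K) = A.right (1 : K) := zinbOf_op_gen _ _

theorem rightOp_zinb_rel : ∀ r ∈ (Com K).R, ∀ v,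
    evalQ (rightOp LinearMap.id (singleOp (B.op (gen K)))) r v = 0 := by
  have h := (zinb_rel_iff B.symm).1 B.rel
  refine (rightOp_com_rel_iff _).2 ((rightMul_assoc_iff _ _).2 ?_)
  simp only [singleOp_one, LinearMap.flip_apply]
  -- With `S = P.flip` the first dendriform axiom is the Zinbiel identity. It implies the other two,
  -- since the right-hand side of that identity is symmetric in the last two variables.
  refine ⟨h, fun x y z => ?_, fun x y z => ?_⟩
  · rw [h, h, add_comm]
  · rw [h, add_comm]

/-- The relative structure over the commutative operad defined by a Zinbiel product. -/
def PreLieBullet.ofZinb : PreLieBullet (Com K) V := PreLieBullet.ofRight _ (rightOp_zinb_rel B)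

theorem PreLieBullet.right_ofZinb :
    (PreLieBullet.ofZinb B).right = singleOp (B.op (gen K)) :=
  PreLieBullet.right_ofRight _ _

theorem PreLieBullet.ofZinb_toZinb : PreLieBullet.ofZinb A.toZinb = A := by
  apply PreLieBullet.ext_right
  refine (PreLieBullet.right_ofZinb _).trans (LinearMap.ext_ring ?_)
  exact (singleOp_one _).trans A.toZinb_op

theorem PreLieBullet.toZinb_ofZinb : (PreLieBullet.ofZinb B).toZinb = B := by
  apply zinb_ext
  rw [PreLieBullet.toZinb_op, PreLieBullet.right_ofZinb, singleOp_one]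

/-- `preLie_•(Com) = Zinb`. -/
def preLieBulletComEquiv : PreLieBullet (Com K) V ≃ (Zinb K).Alg V :=
  ⟨_, _, PreLieBullet.ofZinb_toZinb, PreLieBullet.toZinb_ofZinb⟩

theorem preLieBullet_com : ∃ Φ : PreLieBullet (Com K) V ≃ (Zinb K).Alg V, ∀ A x y,
    A.op (1 : K) (arrow K x) (relRight y) = arrow K ((Φ A).op (gen K) x y) := by
  refine ⟨preLieBulletComEquiv, fun A x y => ?_⟩
  refine (A.op_arrow_relRight (1 : K) x y).trans ?_
  exact congrArg (arrow K) (LinearMap.congr_fun₂ A.toZinb_op x y).symm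

end PreLieCom

end Structures

end Manin

theorem mainTheorem8 (K : Type u) [Field K] :
    -- `Ass • Ass = Ass × Ass`, `Com • Ass = nilAss`, `preLie • Ass = Dend`
    Nonempty (((Manin.Ass K).black (Manin.Ass K)).operad.Iso
      ((Manin.Ass K).prod (Manin.Ass K)).operad) ∧
    Nonempty (((Manin.Com K).black (Manin.Ass K)).operad.Iso (Manin.nilAss K).operad) ∧
    Nonempty (((Manin.preLie K).black (Manin.Ass K)).operad.Iso (Manin.Dend K).operad) ∧
    -- `Ass • Com = nilAss`, `Com • Com = nilLie`, `preLie • Com = Zinb`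
    Nonempty (((Manin.Ass K).black (Manin.Com K)).operad.Iso (Manin.nilAss K).operad) ∧
    Nonempty (((Manin.Com K).black (Manin.Com K)).operad.Iso (Manin.nilLie K).operad) ∧
    Nonempty (((Manin.preLie K).black (Manin.Com K)).operad.Iso (Manin.Zinb K).operad) ∧
    -- the same computations for the functors `Ass_•`, `Com_•`, `preLie_•`
    ∀ (V : Type v) [AddCommGroup V] [Module K V],
      (∃ Φ : Manin.AssBullet (Manin.Ass K) V ≃ ((Manin.Ass K).prod (Manin.Ass K)).Alg V,
        ∀ A x y,
          A.op (Manin.gen K) (Manin.atLeft x) (Manin.arrow K y) =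
            Manin.arrow K ((Φ A).op (Manin.gen K, 0) x y) ∧
          A.op (Manin.gen K) (Manin.atRight x) (Manin.arrow K y) =
            -Manin.arrow K ((Φ A).op (0, Manin.gen K) y x)) ∧
      (∃ Φ : Manin.ComBullet (Manin.Ass K) V ≃ (Manin.nilAss K).Alg V,
        ∀ A x y,
          A.1.op (Manin.gen K) (Manin.atLeft x) (Manin.arrow K y) =
            Manin.arrow K ((Φ A).op (Manin.gen K) x y)) ∧
      (∃ Φ : Manin.PreLieBullet (Manin.Ass K) V ≃ (Manin.Dend K).Alg V,
        ∀ A x y,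
          A.op (Manin.gen K) (Manin.arrow K x) (Manin.relRight y) =
            Manin.arrow K ((Φ A).op (Manin.dprec K) x y) ∧
          A.op (Manin.gen K) (Manin.relRight x) (Manin.arrow K y) =
            Manin.arrow K ((Φ A).op (Manin.dsucc K) x y)) ∧
      (∃ Φ : Manin.AssBullet (Manin.Com K) V ≃ (Manin.nilAss K).Alg V,
        ∀ A x y,
          A.op (1 : K) (Manin.atLeft x) (Manin.arrow K y) =
            Manin.arrow K ((Φ A).op (Manin.gen K) x y)) ∧
      (∃ Φ : Manin.ComBullet (Manin.Com K) V ≃ (Manin.nilLie K).Alg V,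
        ∀ A x y,
          A.1.op (1 : K) (Manin.atLeft x) (Manin.arrow K y) =
            Manin.arrow K ((Φ A).op (1 : K) x y)) ∧
      (∃ Φ : Manin.PreLieBullet (Manin.Com K) V ≃ (Manin.Zinb K).Alg V,
        ∀ A x y,
          A.op (1 : K) (Manin.arrow K x) (Manin.relRight y) =
            Manin.arrow K ((Φ A).op (Manin.gen K) x y)) := by
  exact ⟨Manin.black_ass_ass K, Manin.black_com_ass K, Manin.black_preLie_ass K,
    Manin.black_ass_com K, Manin.black_com_com K, Manin.black_preLie_com K,
    fun V _ _ => ⟨Manin.assBullet_ass, Manin.comBullet_ass, Manin.preLieBullet_ass,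
      Manin.assBullet_com, Manin.comBullet_com, Manin.preLieBullet_com⟩⟩
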